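/- Write $(z,x)\in\mathbb{R}^+\times\mathbb{R}^2$, where $\mathbb{R}^+=(0,\infty)$. Let $\Lambda>0$. There is a constant $C$ depending only on $\Lambda$ with the following property. Let $\lambda=\lambda(z)$ be a measurable function on $\mathbb{R}^+$ with $1/\Lambda\le\lambda(z)\le\Lambda$ for almost every $z>0$. Let $\Psi$ be a real, locally integrable function on $\mathbb{R}^+\times\mathbb{R}^2$ with locally integrable distributional gradient, and put $$\nabla_\lambda\Psi=(\lambda\,\partial_z\Psi,\partial_{x_1}\Psi,\partial_{x_2}\Psi),\qquad L_\lambda\Psi=\mathrm{div}(\nabla_\lambda\Psi)=\partial_z(\lambda\,\partial_z\Psi)+\partial_{x_1}^2\Psi+\partial_{x_2}^2\Psi$$ in the sense of distributions. Assume that $\nabla_\lambda\Psi\in L^2(\mathbb{R}^+\times\mathbb{R}^2)$, $L_\lambda\Psi\in L^2(\mathbb{R}^+\times\mathbb{R}^2)$ and $\gamma_\nu(\nabla_\lambda\Psi)\in L^2(\mathbb{R}^2)$. Here the normal trace $\gamma_\nu(\nabla_\lambda\Psi)$ at $z=0$ (for smooth fields, the opposite of the vertical component at $z=0$) is defined by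 $$\int_0^\infty\!\!\int_{\mathbb{R}^2}\nabla_\lambda\Psi\cdot\nabla\phi\,dx\,dz=-\int_0^\infty\!\!\int_{\mathbb{R}^2}(L_\lambda\Psi)\,\phi\,dx\,dz+\int_{\mathbb{R}^2}\gamma_\nu(\nabla_\lambda\Psi)\,\phi(0,x)\,dx\qquad\text{for all }\phi\in C_c^\infty(\mathbb{R}\times\mathbb{R}^2).$$ Put $$N=\|\gamma_\nu(\nabla_\lambda\Psi)\|_{L^2(\mathbb{R}^2)}+\|L_\lambda\Psi\|_{L^2(\mathbb{R}^+\times\mathbb{R}^2)}+\|\nabla_\lambda\Psi\|_{L^2(\mathbb{R}^+\times\mathbb{R}^2)}.$$ Then: 1. $\nabla_\lambda\Psi\in L^2(\mathbb{R}^+;H^{1/2}(\mathbb{R}^2))$, and $\nabla_\lambda\Psi$ has a representative in $C^0([0,\infty);L^2(\mathbb{R}^2))$. The value of this representative at $z=0$ is the trace $\gamma_0(\nabla_\lambda\Psi)\in L^2(\mathbb{R}^2)$, and the vertical component of this trace is $-\gamma_\nu(\nabla_\lambda\Psi)$. Moreover $$\|\nabla_\lambda\Psi\|_{L^2(\mathbb{R}^+;H^{1/2}(\mathbb{R}^2))}+\|\gamma_0(\nabla_\lambda\Psi)\|_{L^2(\mathbb{R}^2)}+\sup_{z\ge0}\|\nabla_\lambda\Psi(z,\cdot)\|_{L^2(\mathbb{R}^2)}\le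 C\,N.$$ 2. $\nabla_\lambda\Psi\in L^3(\mathbb{R}^+\times\mathbb{R}^2)\cap L^4(\mathbb{R}^+;L^{8/3}(\mathbb{R}^2))$, and $$\|\nabla_\lambda\Psi\|_{L^3(\mathbb{R}^+\times\mathbb{R}^2)}+\|\nabla_\lambda\Psi\|_{L^4(\mathbb{R}^+;L^{8/3}(\mathbb{R}^2))}\le C\,N.$$ -/

import Mathlib

open MeasureTheory Set Filter Topology
open scoped ENNReal NNReal ContDiff

noncomputable section

namespace HalfSpaceQG

/-- The horizontal plane `ℝ²`. -/
abbrev Plane : Type := EuclideanSpace ℝ (Fin 2)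

/-- Values of real vector fields. Component `0` is the vertical one, components `1` and `2` are
the horizontal ones. -/
abbrev Vec : Type := EuclideanSpace ℝ (Fin 3)

/-- Complexified vectors, used only to take Fourier transforms. -/
abbrev CVec : Type := EuclideanSpace ℂ (Fin 3)

/-- The open half-space `{(z, x) : z > 0, x ∈ ℝ²}`. -/
def halfSpace : Set (ℝ × Plane) := Ioi 0 ×ˢ univ

/-- Lebesgue measure on the half-space. -/
def halfVol : Measure (ℝ × Plane) := volume.restrict halfSpace

/-- The coordinate directions `(∂_z, ∂_{x₁}, ∂_{x₂})`. -/
def dir : Fin 3 → ℝ × Plane :=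
  ![(1, 0), (0, EuclideanSpace.single 0 1), (0, EuclideanSpace.single 1 1)]

/-- Real test functions `C_c^∞(ℝ × ℝ²)`. They need not vanish near the boundary `z = 0`. -/
structure IsTest (φ : ℝ × Plane → ℝ) : Prop where
  smooth : ContDiff ℝ ∞ φ
  compact : HasCompactSupport φ

/-- `D` is the distributional gradient `(∂_z Ψ, ∂_{x₁} Ψ, ∂_{x₂} Ψ)` of the function `Ψ` on the
open half-space. -/
structure IsWeakGradient (Ψ : ℝ × Plane → ℝ) (D : ℝ × Plane → Vec) : Prop where
  locallyIntegrable : LocallyIntegrableOn Ψ halfSpace volume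
  locallyIntegrable_grad : LocallyIntegrableOn D halfSpace volume
  integral_eq : ∀ φ : ℝ × Plane → ℝ, IsTest φ → tsupport φ ⊆ halfSpace → ∀ i : Fin 3,
    ∫ p, Ψ p * fderiv ℝ φ p (dir i) ∂halfVol = -∫ p, D p i * φ p ∂halfVol

/-- `∇_λ Ψ = (λ ∂_z Ψ, ∂_{x₁} Ψ, ∂_{x₂} Ψ)`, as a function of the gradient `D = ∇ Ψ`. -/
def lambdaGrad (lam : ℝ → ℝ) (D : ℝ × Plane → Vec) (p : ℝ × Plane) : Vec :=
  WithLp.toLp 2 ![lam p.1 * D p 0, D p 1, D p 2]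

/-- `div u = f` in the sense of distributions on the open half-space.
With `u = ∇_λ Ψ` this says `L_λ Ψ = f`. -/
def IsWeakDiv (u : ℝ × Plane → Vec) (f : ℝ × Plane → ℝ) : Prop :=
  ∀ φ : ℝ × Plane → ℝ, IsTest φ → tsupport φ ⊆ halfSpace →
    ∫ p, ∑ i, u p i * fderiv ℝ φ p (dir i) ∂halfVol = -∫ p, f p * φ p ∂halfVol

/-- For a vector field `u` whose distributional divergence is `f`, the normal trace `γ_ν(u)` at
`z = 0` (for smooth `u`, the opposite of the vertical component of `u(0, ·)`) is the function `g`: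
the divergence theorem holds for all test functions, up to the boundary. -/
def IsNormalTrace (u : ℝ × Plane → Vec) (f : ℝ × Plane → ℝ) (g : Plane → ℝ) : Prop :=
  ∀ φ : ℝ × Plane → ℝ, IsTest φ →
    ∫ p, ∑ i, u p i * fderiv ℝ φ p (dir i) ∂halfVol
      = -∫ p, f p * φ p ∂halfVol + ∫ x, g x * φ (0, x)

/-- Coordinatewise inclusion `ℝ³ ⊆ ℂ³`. -/
def complexify (v : Vec) : CVec := WithLp.toLp 2 fun i => (v i : ℂ)

/-- `v ∈ L²(ℝ²)` belongs to `H^s(ℝ²)`, and `w ∈ L²(ℝ²)` is its Bessel potential of order `s`, so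
that `‖w‖_{L²}` is the `H^s`-norm of `v`. In Mathlib's normalization the Fourier multiplier is
`(1 + |ξ|²)^{s/2}` for the Fourier transform with kernel `exp (-2 π i x·ξ)`; this changes the usual
norm only into an equivalent one. -/
def IsBesselPotential (s : ℝ) (v : Plane → Vec) (w : Lp CVec 2 (volume : Measure Plane)) : Prop :=
  ∃ hv : MemLp (fun x => complexify (v x)) 2 (volume : Measure Plane),
    TemperedDistribution.besselPotential Plane CVec s (Lp.toTemperedDistribution (hv.toLp _))
      = Lp.toTemperedDistribution w

/-- `u ∈ L²(ℝ⁺; H^s(ℝ²))`, with norm `‖W‖_{L²(ℝ⁺; L²(ℝ²))}`: the slices `u(z, ·)` are in `H^s` and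
their Bessel potentials `W(z)` form an element of the Bochner space `L²(ℝ⁺; L²(ℝ²))`. -/
structure IsL2SobolevLift (s : ℝ) (u : ℝ × Plane → Vec)
    (W : ℝ → Lp CVec 2 (volume : Measure Plane)) : Prop where
  memLp : MemLp W 2 (volume.restrict (Ioi 0))
  bessel : ∀ᵐ z ∂(volume.restrict (Ioi (0 : ℝ))), IsBesselPotential s (fun x => u (z, x)) (W z)

/-- `V` is the representative of `u` in `C⁰([0, ∞); L²(ℝ²))`. In particular `V 0`, the limit in
`L²(ℝ²)` of `V z` as `z → 0⁺`, is the trace `γ₀(u)`. -/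
structure IsContinuousRep (u : ℝ × Plane → Vec)
    (V : ℝ → Lp Vec 2 (volume : Measure Plane)) : Prop where
  continuousOn : ContinuousOn V (Ici 0)
  slice_eq : ∀ᵐ z ∂(volume.restrict (Ioi (0 : ℝ))), V z =ᵐ[volume] fun x => u (z, x)

/-- The norm of `u` in `L^p(ℝ⁺; L^q(ℝ²))`. -/
def mixedNorm (p q : ℝ≥0∞) (u : ℝ × Plane → Vec) : ℝ≥0∞ :=
  eLpNorm (fun z : ℝ => eLpNorm (fun x : Plane => u (z, x)) q volume) p (volume.restrict (Ioi 0))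

end HalfSpaceQG

end

open HalfSpaceQG

/-! Take the Fourier transform in x and keep the equation in flux form. Let û = (û₀, û_h) be the
transform of ∇_λΨ, and put q = û₀ and p = −i (ξ/|ξ|)·û_h. The divergence equation and the
commutation of ∂_z with the horizontal derivatives become q' = f̂ + R p, p' = λ⁻¹ R q, q(0) = −ĝ, R
= multiplication by 2π|ξ|. Only λ∂_zΨ and the horizontal gradient are differentiated in z, never λ
itself, so bounded measurable λ suffices. Since û_h is parallel to ξ
(`IsFrequencySystem.curl_eq_zero`), p and q determine û.

The estimate is `exists_continuous_rep_energy_bound`. Integrating ⟨q, p⟩' over the half-line gives D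
:= ∫ ⟨Rp, p⟩ + λ⁻¹⟨Rq, q⟩ = ⟨ĝ, p(0)⟩ − ∫ ⟨f̂, p⟩. Integrating (|p|²)' = 2λ⁻¹⟨Rq, p⟩ from z to
infinity gives sup |p|² ≤ Λ D, by Cauchy-Schwarz for the form of R. Hence ⟨ĝ, p(0)⟩ is absorbed by
half of D, and D is bounded by the data; the same computation for |q|² bounds sup |q|. Thus half a
horizontal derivative in L² and the supremum of the L² norm are controlled together, with constants
independent of R.

The independence of R allows a frequency cut-off. On a bounded set of frequencies R is a bounded
operator, and p, q are honest primitives with values in L²(ℝ²) (`IsFrequencySystem.exists_rep`).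
Applied to annuli, the estimate shows that the truncations are uniformly Cauchy in C⁰([0,∞); L²),
because the energy outside a large ball tends to 0 (`IsFrequencySystem.exists_continuous_rep`).
Monotone convergence over balls gives the H^{1/2} bound (`IsFrequencySystem.exists_halfBessel`). The
system itself is read off from the weak formulation with test functions a(z) b(x), keeping a and
transforming in x (`IsWeakGradient.exists_frequencySystem`).

The integrability statements follow from H^{1/2}(ℝ²) ⊆ L⁴(ℝ²) (`eLpNorm_four_le_of_halfBessel`): on
each slice, Hölder interpolates L³ and L^{8/3} between L² and L⁴, and then the L² norm is bounded
uniformly in z while the L⁴ norm is square integrable in z. -/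

/-! ### Integration by parts for vector-valued primitives -/

section Primitives

variable {E F G : Type*} [NormedAddCommGroup E] [NormedSpace ℝ E]
  [NormedAddCommGroup F] [NormedSpace ℝ F] [NormedAddCommGroup G] [NormedSpace ℝ G]

theorem integrable_bilin_prod {α β : Type*} [MeasurableSpace α] [MeasurableSpace β]
    {μ : Measure α} {ν : Measure β} [SFinite μ] [SFinite ν] (B : E →L[ℝ] F →L[ℝ] G)
    {a : α → E} {b : β → F} (ha : Integrable a μ) (hb : Integrable b ν) :
    Integrable (fun p : α × β => B (a p.1) (b p.2)) (μ.prod ν) := by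
  refine Integrable.mono' ((ha.norm.mul_prod hb.norm).const_mul ‖B‖)
    (B.aestronglyMeasurable_comp₂ ha.1.comp_fst hb.1.comp_snd) (.of_forall fun p => ?_)
  simpa [mul_assoc] using B.le_opNorm₂ (a p.1) (b p.2)

/-- Integration by parts for a bilinear map applied to two primitives. -/
theorem bilin_primitive_integrable_and_eq [CompleteSpace E] [CompleteSpace F] [CompleteSpace G]
    (B : E →L[ℝ] F →L[ℝ] G) {a : ℝ → E} {b : ℝ → F}
    {c T : ℝ} (hcT : c ≤ T) (ha : IntegrableOn a (Ioc c T)) (hb : IntegrableOn b (Ioc c T))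
    (A₀ : E) (B₀ : F) :
    IntegrableOn (fun t => B (a t) (B₀ + ∫ s in c..t, b s)) (Ioc c T) ∧
    IntegrableOn (fun t => B (A₀ + ∫ s in c..t, a s) (b t)) (Ioc c T) ∧
    (∫ t in c..T, B (a t) (B₀ + ∫ s in c..t, b s)) +
        (∫ t in c..T, B (A₀ + ∫ s in c..t, a s) (b t)) =
      B (A₀ + ∫ s in c..T, a s) (B₀ + ∫ s in c..T, b s) - B A₀ B₀ := by
  set ν := volume.restrict (Ioc c T) with hν
  set K : ℝ × ℝ → G := fun p => B (a p.1) (b p.2) with hK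
  have hKi : Integrable K (ν.prod ν) := integrable_bilin_prod B ha hb
  have hS1 : MeasurableSet {p : ℝ × ℝ | p.2 ≤ p.1} := measurableSet_le measurable_snd measurable_fst
  have hS2 : MeasurableSet {p : ℝ × ℝ | p.1 < p.2} := measurableSet_lt measurable_fst measurable_snd
  have hK1 : Integrable ({p : ℝ × ℝ | p.2 ≤ p.1}.indicator K) (ν.prod ν) := hKi.indicator hS1
  have hK2 : Integrable ({p : ℝ × ℝ | p.1 < p.2}.indicator K) (ν.prod ν) := hKi.indicator hS2
  -- Both terms are integrals of the kernel B(a(t), b(s)) over the square: the first over s ≤ t, the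
  -- second over s > t. Together they fill the square, which gives the boundary term.
  have e1 : ∀ t ∈ Ioc c T, B (a t) (∫ s in c..t, b s)
      = ∫ s, {p : ℝ × ℝ | p.2 ≤ p.1}.indicator K (t, s) ∂ν := by
    intro t ht
    have hbt : IntegrableOn b (Ioc c t) := hb.mono_set (Ioc_subset_Ioc_right ht.2)
    have : (fun s => {p : ℝ × ℝ | p.2 ≤ p.1}.indicator K (t, s))
        = (Iic t).indicator (fun s => B (a t) (b s)) := by
      ext s; simp [indicator, K]
    rw [this, integral_indicator measurableSet_Iic, hν, Measure.restrict_restrict measurableSet_Iic,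
      inter_comm, Ioc_inter_Iic, min_eq_right ht.2, intervalIntegral.integral_of_le ht.1.le,
      ← ContinuousLinearMap.integral_comp_comm _ hbt]
  have e2 : ∀ t ∈ Ioc c T, B (∫ s in c..t, a s) (b t)
      = ∫ s, {p : ℝ × ℝ | p.1 < p.2}.indicator K (s, t) ∂ν := by
    intro t ht
    have hat : IntegrableOn a (Ioo c t) :=
      ha.mono_set (Ioo_subset_Ioc_self.trans (Ioc_subset_Ioc_right ht.2))
    have : (fun s => {p : ℝ × ℝ | p.1 < p.2}.indicator K (s, t))
        = (Iio t).indicator (fun s => B.flip (b t) (a s)) := by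
      ext s; simp [indicator, K]
    have h3 : Ioc c T ∩ Iio t = Ioo c t := by
      ext s; simp only [mem_inter_iff, mem_Ioc, mem_Iio, mem_Ioo]
      constructor
      · rintro ⟨⟨h1, h2⟩, h3⟩; exact ⟨h1, h3⟩
      · rintro ⟨h1, h2⟩; exact ⟨⟨h1, h2.le.trans ht.2⟩, h2⟩
    rw [this, integral_indicator measurableSet_Iio, hν, Measure.restrict_restrict measurableSet_Iio,
      inter_comm, h3, intervalIntegral.integral_of_le ht.1.le, integral_Ioc_eq_integral_Ioo,
      ContinuousLinearMap.integral_comp_comm _ hat]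
    rfl
  have i1 : IntegrableOn (fun t => B (a t) (∫ s in c..t, b s)) (Ioc c T) :=
    (hK1.integral_prod_left).congr
      ((ae_restrict_mem measurableSet_Ioc).mono fun t ht => (e1 t ht).symm)
  have i2 : IntegrableOn (fun t => B (∫ s in c..t, a s) (b t)) (Ioc c T) :=
    (hK2.integral_prod_right).congr
      ((ae_restrict_mem measurableSet_Ioc).mono fun t ht => (e2 t ht).symm)
  have j1 : IntegrableOn (fun t => B (a t) B₀) (Ioc c T) := (B.flip B₀).integrable_comp ha
  have j2 : IntegrableOn (fun t => B A₀ (b t)) (Ioc c T) := (B A₀).integrable_comp hb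
  refine ⟨by simp only [map_add]; exact j1.add i1,
    by simp only [map_add, add_apply]; exact j2.add i2, ?_⟩
  have s1 : ∫ t in Ioc c T, B (a t) (∫ s in c..t, b s)
      = ∫ p, {p : ℝ × ℝ | p.2 ≤ p.1}.indicator K p ∂(ν.prod ν) := by
    rw [integral_prod _ hK1]
    exact setIntegral_congr_fun measurableSet_Ioc e1
  have s2 : ∫ t in Ioc c T, B (∫ s in c..t, a s) (b t)
      = ∫ p, {p : ℝ × ℝ | p.1 < p.2}.indicator K p ∂(ν.prod ν) := by
    rw [integral_prod_symm _ hK2]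
    exact setIntegral_congr_fun measurableSet_Ioc e2
  have s3 : (∫ t in Ioc c T, B (a t) (∫ s in c..t, b s))
      + ∫ t in Ioc c T, B (∫ s in c..t, a s) (b t)
      = B (∫ s in Ioc c T, a s) (∫ s in Ioc c T, b s) := by
    rw [s1, s2, ← integral_add hK1 hK2]
    have : (fun p => {p : ℝ × ℝ | p.2 ≤ p.1}.indicator K p + {p : ℝ × ℝ | p.1 < p.2}.indicator K p)
        = K := by
      ext p
      by_cases h : p.2 ≤ p.1
      · simp [indicator, h]
      · simp [indicator, h, not_le.mp h]
    rw [this, integral_prod _ hKi]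
    simp only [hK]
    have : ∀ t, ∫ s, B (a t) (b s) ∂ν = B.flip (∫ s, b s ∂ν) (a t) := fun t => by
      rw [ContinuousLinearMap.integral_comp_comm _ hb]; rfl
    simp_rw [this]
    rw [ContinuousLinearMap.integral_comp_comm _ ha]
    rfl
  simp only [intervalIntegral.integral_of_le hcT, map_add, add_apply] at *
  rw [integral_add j1 i1, integral_add j2 i2]
  have k1 : ∫ t in Ioc c T, B (a t) B₀ = B (∫ s in Ioc c T, a s) B₀ :=
    ContinuousLinearMap.integral_comp_comm (B.flip B₀) ha
  have k2 : ∫ t in Ioc c T, B A₀ (b t) = B A₀ (∫ s in Ioc c T, b s) :=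
    ContinuousLinearMap.integral_comp_comm (B A₀) hb
  rw [k1, k2, ← sub_eq_zero]
  rw [← sub_eq_zero] at s3
  rw [← s3]
  abel

end Primitives

/-! ### Weak derivatives of vector-valued functions on the half-line -/

section WeakDerivative

theorem integrable_compactSupport_smul {X H : Type*} [TopologicalSpace X] [MeasurableSpace X]
    [OpensMeasurableSpace X] {μ : Measure X} [IsFiniteMeasureOnCompacts μ] [NormedAddCommGroup H]
    [NormedSpace ℝ H] {a : X → ℝ} (ha : Continuous a) (hc : HasCompactSupport a) {w : X → H}
    (hw : MemLp w 2 μ) : Integrable (fun t => a t • w t) μ :=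
  memLp_one_iff_integrable.mp (hw.smul (ha.memLp_of_hasCompactSupport (p := 2) hc))

theorem MeasureTheory.MemLp.integrableOn_Ioc_of_Ioi {H : Type*} [NormedAddCommGroup H] {v : ℝ → H}
    (hv : MemLp v 2 (volume.restrict (Ioi 0))) {c : ℝ} (hc : 0 ≤ c) (T : ℝ) :
    IntegrableOn v (Ioc c T) := by
  have h : MemLp v 2 (volume.restrict (Ioc c T)) :=
    hv.mono_measure (Measure.restrict_mono (fun x hx => hc.trans_lt hx.1) le_rfl)
  exact h.integrable (by norm_num)

variable {H : Type*} [NormedAddCommGroup H] [NormedSpace ℝ H] [CompleteSpace H]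

theorem exists_pos_tsupport_subset_Iio {a : ℝ → ℝ} (hc : HasCompactSupport a) :
    ∃ T : ℝ, 0 < T ∧ tsupport a ⊆ Iio T := by
  obtain ⟨T, hT⟩ := hc.isCompact.bddAbove
  exact ⟨max T 0 + 1, by positivity, fun x hx => by
    have := hT hx; have := le_max_left T 0; simp only [mem_Iio]; linarith⟩

theorem deriv_eq_zero_of_notMem_tsupport {a : ℝ → ℝ} {t : ℝ} (ht : t ∉ tsupport a) :
    deriv a t = 0 :=
  Function.notMem_support.mp fun h => ht (support_deriv_subset h)

/-- The test function need not vanish at 0. The boundary term at 0 is what later identifies the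
trace of the vertical flux. -/
theorem integral_deriv_smul_primitive {a : ℝ → ℝ} (ha : ContDiff ℝ ∞ a) (hc : HasCompactSupport a)
    {v : ℝ → H} (hv : ∀ T, IntegrableOn v (Ioc 0 T)) (w₀ : H) :
    ∫ t in Ioi 0, deriv a t • (w₀ + ∫ s in (0 : ℝ)..t, v s)
      = -(a 0 • w₀) - ∫ t in Ioi 0, a t • v t := by
  obtain ⟨T, hT, hTs⟩ := exists_pos_tsupport_subset_Iio hc
  have h1 := bilin_primitive_integrable_and_eq (ContinuousLinearMap.lsmul ℝ ℝ (E := H))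
    hT.le (a := deriv a) (((ha.continuous_deriv (by simp)).integrableOn_Icc).mono_set
      Ioc_subset_Icc_self) (hv T) (a 0) w₀
  have h2 : ∀ t, a 0 + ∫ s in (0 : ℝ)..t, deriv a s = a t := fun t => by
    rw [intervalIntegral.integral_deriv_eq_sub]
    · ring
    · exact fun x _ => (ha.differentiable (by simp)) x
    · exact (ha.continuous_deriv (by simp)).intervalIntegrable _ _
  have hout : ∀ t ∈ Ioi (0 : ℝ) \ Ioc 0 T, t ∉ tsupport a := fun t ht h => by
    have := hTs h
    simp only [Set.mem_sdiff, mem_Ioi, mem_Ioc, not_and, not_le, mem_Iio] at *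
    linarith [ht.2 ht.1]
  have h3 := h1.2.2
  simp only [h2, ContinuousLinearMap.lsmul_apply] at h3
  rw [image_eq_zero_of_notMem_tsupport (fun h => lt_irrefl T (hTs h)), zero_smul, zero_sub,
    intervalIntegral.integral_of_le hT.le, intervalIntegral.integral_of_le hT.le] at h3
  rw [setIntegral_eq_of_subset_of_forall_sdiff_eq_zero measurableSet_Ioi Ioc_subset_Ioi_self
      (fun t ht => by rw [deriv_eq_zero_of_notMem_tsupport (hout t ht), zero_smul]),
    setIntegral_eq_of_subset_of_forall_sdiff_eq_zero (f := fun t => a t • v t) measurableSet_Ioi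
      Ioc_subset_Ioi_self
      (fun t ht => by rw [image_eq_zero_of_notMem_tsupport (hout t ht), zero_smul]), ← h3]
  abel

/-- The primitive from 0 vanishes before the support of θ, and vanishes beyond it because θ has mean
zero. -/
theorem exists_antiderivative_test {θ : ℝ → ℝ} (hθ : ContDiff ℝ ∞ θ) (hc : HasCompactSupport θ)
    (hs : tsupport θ ⊆ Ioi 0) (h0 : ∫ t in Ioi 0, θ t = 0) :
    ∃ a : ℝ → ℝ, ContDiff ℝ ∞ a ∧ HasCompactSupport a ∧ tsupport a ⊆ Ioi 0 ∧ deriv a = θ := by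
  have hd : ∀ t, HasDerivAt (fun t => ∫ s in (0 : ℝ)..t, θ s) (θ t) t := fun t =>
    hθ.continuous.integral_hasStrictDerivAt 0 t |>.hasDerivAt
  have hderiv : deriv (fun t => ∫ s in (0 : ℝ)..t, θ s) = θ := funext fun t => (hd t).deriv
  obtain ⟨T, hT, hTs⟩ := exists_pos_tsupport_subset_Iio hc
  obtain ⟨m, hm, hms⟩ : ∃ m : ℝ, 0 < m ∧ tsupport θ ⊆ Ici m := by
    rcases (tsupport θ).eq_empty_or_nonempty with h | h
    · exact ⟨1, one_pos, by simp [h]⟩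
    · obtain ⟨m, hm, hm'⟩ := hc.isCompact.exists_isLeast h
      exact ⟨m, hs hm, hm'⟩
  have hθ0 : ∀ t, t < m ∨ T ≤ t → θ t = 0 := fun t ht =>
    image_eq_zero_of_notMem_tsupport fun h => by
      rcases ht with ht | ht
      · exact absurd (hms h) (not_le.mpr ht)
      · exact absurd (hTs h) (not_lt.mpr ht)
  have hsub : Function.support (fun t => ∫ s in (0 : ℝ)..t, θ s) ⊆ Icc m T := by
    intro t ht
    by_contra hcon
    apply ht
    beta_reduce
    rcases not_and_or.mp hcon with h | h
    · rw [intervalIntegral.integral_congr (g := fun _ => (0 : ℝ)), intervalIntegral.integral_zero]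
      intro s hs
      refine hθ0 s (Or.inl ?_)
      exact hs.2.trans_lt (max_lt hm (not_le.mp h))
    · rw [not_le] at h
      rw [intervalIntegral.integral_of_le (hT.trans h).le,
        ← setIntegral_eq_of_subset_of_forall_sdiff_eq_zero measurableSet_Ioi Ioc_subset_Ioi_self, h0]
      intro s hs
      refine hθ0 s (Or.inr ?_)
      simp only [Set.mem_sdiff, mem_Ioi, mem_Ioc, not_and, not_le] at hs
      linarith [hs.2 hs.1]
  refine ⟨fun t => ∫ s in (0 : ℝ)..t, θ s, ?_, ?_, ?_, hderiv⟩
  · exact contDiff_infty_iff_deriv.mpr ⟨fun t => (hd t).differentiableAt, by rwa [hderiv]⟩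
  · exact HasCompactSupport.of_support_subset_isCompact isCompact_Icc hsub
  · exact (closure_minimal hsub isClosed_Icc).trans fun t ht => hm.trans_le ht.1

/-- A locally integrable function on the half-line whose weak derivative vanishes is constant. -/
theorem exists_ae_eq_const_of_weakDeriv_zero {w : ℝ → H} (hw : LocallyIntegrableOn w (Ioi 0))
    (h : ∀ a : ℝ → ℝ, ContDiff ℝ ∞ a → HasCompactSupport a → tsupport a ⊆ Ioi 0 →
      ∫ t in Ioi 0, deriv a t • w t = 0) :
    ∃ w₀ : H, ∀ᵐ t ∂(volume.restrict (Ioi (0 : ℝ))), w t = w₀ := by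
  have hint : ∀ a : ℝ → ℝ, ContDiff ℝ ∞ a → HasCompactSupport a → tsupport a ⊆ Ioi 0 →
      IntegrableOn (fun t => a t • w t) (Ioi 0) := by
    intro a ha hac has
    have h1 : IntegrableOn (fun t => a t • w t) (tsupport a) :=
      (hw.integrableOn_compact_subset has hac.isCompact).continuousOn_smul
        ha.continuous.continuousOn hac.isCompact
    refine IntegrableOn.of_forall_sdiff_eq_zero h1 measurableSet_Ioi fun t ht => ?_
    rw [image_eq_zero_of_notMem_tsupport ht.2, zero_smul]
  obtain ⟨η₀, hη₀s, hη₀c, hη₀, hη₀r, hη₀1⟩ :=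
    exists_contDiff_tsupport_subset (n := ⊤) (Ioi_mem_nhds (zero_lt_one' ℝ))
  have hpos : 0 < ∫ t in Ioi 0, η₀ t := by
    rw [setIntegral_eq_integral_of_forall_compl_eq_zero fun t ht =>
      image_eq_zero_of_notMem_tsupport fun h => ht (hη₀s h)]
    exact hη₀.continuous.integral_pos_of_hasCompactSupport_nonneg_nonzero hη₀c
      (fun t => (hη₀r ⟨t, rfl⟩).1) (x := 1) (by rw [hη₀1]; exact one_ne_zero)
  set I := ∫ t in Ioi 0, η₀ t with hI
  refine ⟨I⁻¹ • ∫ t in Ioi 0, η₀ t • w t, ?_⟩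
  set w₀ := I⁻¹ • ∫ t in Ioi 0, η₀ t • w t with hw₀
  have key := isOpen_Ioi.ae_eq_zero_of_integral_contDiff_smul_eq_zero (μ := volume)
    (f := fun t => w t - w₀) (hw.sub ((locallyIntegrable_const w₀).locallyIntegrableOn _)) ?_
  · rw [ae_restrict_iff' measurableSet_Ioi]
    filter_upwards [key] with t ht h0 using sub_eq_zero.mp (ht h0)
  intro ψ hψ hψc hψs
  have hψi : IntegrableOn ψ (Ioi 0) := (hψ.continuous.integrable_of_hasCompactSupport hψc).integrableOn
  have hηi : IntegrableOn η₀ (Ioi 0) :=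
    (hη₀.continuous.integrable_of_hasCompactSupport hη₀c).integrableOn
  set J := ∫ t in Ioi 0, ψ t with hJ
  -- Subtracting the right multiple of η₀ gives ψ mean zero, so the difference is the derivative of
  -- a test function and the hypothesis applies to it.
  have hsub : tsupport (fun t => ψ t - (J * I⁻¹) * η₀ t) ⊆ Ioi 0 := by
    refine (tsupport_sub _ _).trans (union_subset hψs ?_)
    exact (tsupport_mul_subset_right).trans hη₀s
  obtain ⟨a, ha, hac, has, had⟩ := exists_antiderivative_test
    (θ := fun t => ψ t - (J * I⁻¹) * η₀ t) (hψ.sub (contDiff_const.mul hη₀))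
    (hψc.sub hη₀c.mul_left) hsub (by
      rw [integral_sub hψi (hηi.const_mul _), integral_const_mul]
      simp only [← hI, ← hJ]
      field_simp
      ring)
  have h1 := h a ha hac has
  rw [had] at h1
  simp only [sub_smul, mul_smul] at h1
  rw [integral_sub (f := fun t => ψ t • w t) (g := fun t => J • I⁻¹ • η₀ t • w t)
    (hint ψ hψ hψc hψs) (((hint η₀ hη₀ hη₀c hη₀s).smul (I⁻¹)).smul J), integral_smul, integral_smul, ← hw₀,
    sub_eq_zero] at h1
  rw [← setIntegral_eq_integral_of_forall_compl_eq_zero (s := Ioi 0) fun t ht => by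
      rw [image_eq_zero_of_notMem_tsupport fun h => ht (hψs h), zero_smul]]
  simp only [smul_sub]
  rw [integral_sub (hint ψ hψ hψc hψs) (hψi.smul_const w₀), h1, integral_smul_const, sub_self]

theorem continuousOn_primitive_Ici {H : Type*} [NormedAddCommGroup H] [NormedSpace ℝ H]
    {v : ℝ → H} (hv : MemLp v 2 (volume.restrict (Ioi 0))) (w₀ : H) :
    ContinuousOn (fun t => w₀ + ∫ s in (0 : ℝ)..t, v s) (Ici 0) := by
  refine continuousOn_const.add fun t ht => ?_
  have h1 : ContinuousOn (fun t => ∫ s in (0 : ℝ)..t, v s) (uIcc 0 (t + 1)) := by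
    refine intervalIntegral.continuousOn_primitive_interval ?_
    have : (0 : ℝ) ≤ t + 1 := by simp only [mem_Ici] at ht; linarith
    rw [uIcc_of_le this, integrableOn_Icc_iff_integrableOn_Ioc]
    exact hv.integrableOn_Ioc_of_Ioi le_rfl _
  have h2 : t ∈ uIcc 0 (t + 1) := by
    simp only [mem_Ici] at ht
    rw [uIcc_of_le (by linarith)]; exact ⟨ht, by linarith⟩
  refine (h1 t h2).mono_of_mem_nhdsWithin ?_
  simp only [mem_Ici] at ht
  rw [uIcc_of_le (by linarith)]
  exact mem_nhdsWithin.mpr ⟨Iio (t + 1), isOpen_Iio, by simp, fun x hx => ⟨hx.2, hx.1.le⟩⟩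

/-- A function on the half-line with a weak derivative in `L²` is a.e. a primitive. -/
theorem exists_ae_eq_primitive {w v : ℝ → H} (hw : MemLp w 2 (volume.restrict (Ioi 0)))
    (hv : MemLp v 2 (volume.restrict (Ioi 0)))
    (h : ∀ a : ℝ → ℝ, ContDiff ℝ ∞ a → HasCompactSupport a → tsupport a ⊆ Ioi 0 →
      ∫ t in Ioi 0, deriv a t • w t = -∫ t in Ioi 0, a t • v t) :
    ∃ w₀ : H, ∀ᵐ t ∂(volume.restrict (Ioi (0 : ℝ))), w t = w₀ + ∫ s in (0 : ℝ)..t, v s := by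
  have hpc := continuousOn_primitive_Ici hv 0
  simp only [zero_add] at hpc
  have hwl : LocallyIntegrableOn w (Ioi 0) := by
    have : LocallyIntegrable w (volume.restrict (Ioi 0)) := hw.locallyIntegrable (by norm_num)
    exact locallyIntegrableOn_of_locallyIntegrable_restrict this
  have hpl : LocallyIntegrableOn (fun t => ∫ s in (0 : ℝ)..t, v s) (Ioi 0) :=
    (hpc.mono Ioi_subset_Ici_self).locallyIntegrableOn measurableSet_Ioi
  obtain ⟨w₀, hw₀⟩ := exists_ae_eq_const_of_weakDeriv_zero (hwl.sub hpl) fun a ha hac has => by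
    have h1 := integral_deriv_smul_primitive ha hac
      (fun T => hv.integrableOn_Ioc_of_Ioi le_rfl T) 0
    simp only [zero_add, smul_zero, neg_zero, zero_sub] at h1
    have hc' : HasCompactSupport (deriv a) := hac.deriv
    have hci : Continuous (deriv a) := ha.continuous_deriv (by simp)
    have i1 : Integrable (fun t => deriv a t • w t) (volume.restrict (Ioi 0)) :=
      integrable_compactSupport_smul hci hc' hw
    obtain ⟨T, hT, hTs⟩ := exists_pos_tsupport_subset_Iio hac
    have i2 : Integrable (fun t => deriv a t • ∫ s in (0 : ℝ)..t, v s)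
        (volume.restrict (Ioi 0)) := by
      have : IntegrableOn (fun t => deriv a t • ∫ s in (0 : ℝ)..t, v s) (Icc 0 T) :=
        (hci.continuousOn.smul (hpc.mono Icc_subset_Ici_self)).integrableOn_Icc
      refine IntegrableOn.of_forall_sdiff_eq_zero this measurableSet_Ioi fun t ht => ?_
      rw [deriv_eq_zero_of_notMem_tsupport, zero_smul]
      exact fun hh => ht.2 ⟨ht.1.le, (hTs hh).le⟩
    simp only [Pi.sub_apply, smul_sub]
    rw [integral_sub i1 i2, h1, h a ha hac has, sub_self]
  exact ⟨w₀, hw₀.mono fun t ht => by rw [← ht]; simp⟩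

end WeakDerivative

/-! ### The energy estimate for the abstract first-order system -/

section Energy

theorem MeasureTheory.MemLp.integrable_real_inner {X H : Type*} [MeasurableSpace X] {μ : Measure X}
    [NormedAddCommGroup H] [InnerProductSpace ℝ H] {u v : X → H} (hu : MemLp u 2 μ)
    (hv : MemLp v 2 μ) : Integrable (fun t => inner ℝ (u t) (v t)) μ :=
  (hu.norm.integrable_mul hv.norm).mono' (hu.1.inner hv.1)
    (.of_forall fun t => norm_inner_le_norm (u t) (v t))

variable {H : Type*} [NormedAddCommGroup H] [InnerProductSpace ℝ H] [CompleteSpace H]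

/-- This is the fundamental theorem of calculus for ⟨A, B⟩ on (z, ∞). There is no contribution from
infinity: ⟨A, B⟩ has a limit because its derivative is integrable, and the limit is 0 because ⟨A, B⟩
is itself integrable. -/
theorem neg_inner_eq_integral_Ioi {A a B b : ℝ → H}
    (ha : MemLp a 2 (volume.restrict (Ioi 0))) (hb : MemLp b 2 (volume.restrict (Ioi 0)))
    (hA : MemLp A 2 (volume.restrict (Ioi 0))) (hB : MemLp B 2 (volume.restrict (Ioi 0)))
    (hAa : ∀ t, 0 ≤ t → A t = A 0 + ∫ s in (0 : ℝ)..t, a s)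
    (hBb : ∀ t, 0 ≤ t → B t = B 0 + ∫ s in (0 : ℝ)..t, b s) {z : ℝ} (hz : 0 ≤ z) :
    -inner ℝ (A z) (B z)
      = ∫ t in Ioi z, (inner ℝ (a t) (B t) + inner ℝ (A t) (b t)) := by
  have hadd : ∀ {u U : ℝ → H}, MemLp u 2 (volume.restrict (Ioi 0)) →
      (∀ t, 0 ≤ t → U t = U 0 + ∫ s in (0 : ℝ)..t, u s) →
      ∀ t, z ≤ t → U z + ∫ s in z..t, u s = U t := by
    intro u U hu hU t ht
    have e : ∀ T, 0 ≤ T → IntervalIntegrable u volume 0 T := fun T hT =>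
      (intervalIntegrable_iff_integrableOn_Ioc_of_le hT).mpr (hu.integrableOn_Ioc_of_Ioi le_rfl T)
    rw [hU z hz, hU t (hz.trans ht), add_assoc, intervalIntegral.integral_add_adjacent_intervals
      (e z hz) ((e z hz).symm.trans (e t (hz.trans ht)))]
  have hmono : volume.restrict (Ioi z) ≤ volume.restrict (Ioi (0 : ℝ)) :=
    Measure.restrict_mono (Ioi_subset_Ioi hz) le_rfl
  have i1 : IntegrableOn (fun t => inner ℝ (a t) (B t)) (Ioi z) :=
    (ha.integrable_real_inner hB).mono_measure hmono
  have i2 : IntegrableOn (fun t => inner ℝ (A t) (b t)) (Ioi z) :=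
    (hA.integrable_real_inner hb).mono_measure hmono
  have key : ∀ T, z ≤ T → inner ℝ (A T) (B T)
      = inner ℝ (A z) (B z)
        + ∫ t in z..T, (inner ℝ (a t) (B t) + inner ℝ (A t) (b t)) := by
    intro T hT
    have h := (bilin_primitive_integrable_and_eq (innerSL ℝ (E := H)) hT
      (ha.integrableOn_Ioc_of_Ioi hz T) (hb.integrableOn_Ioc_of_Ioi hz T) (A z) (B z)).2.2
    rw [hadd ha hAa T hT, hadd hb hBb T hT] at h
    have c1 : ∫ t in z..T, (innerSL ℝ (a t)) (B z + ∫ s in z..t, b s)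
        = ∫ t in z..T, inner ℝ (a t) (B t) := by
      refine intervalIntegral.integral_congr fun t ht => ?_
      rw [uIcc_of_le hT] at ht
      simp only [innerSL_apply_apply, hadd hb hBb t ht.1]
    have c2 : ∫ t in z..T, (innerSL ℝ (A z + ∫ s in z..t, a s)) (b t)
        = ∫ t in z..T, inner ℝ (A t) (b t) := by
      refine intervalIntegral.integral_congr fun t ht => ?_
      rw [uIcc_of_le hT] at ht
      simp only [innerSL_apply_apply, hadd ha hAa t ht.1]
    rw [c1, c2, innerSL_apply_apply, innerSL_apply_apply] at h
    rw [intervalIntegral.integral_add, h]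
    · ring
    · exact (intervalIntegrable_iff_integrableOn_Ioc_of_le hT).mpr (i1.mono_set Ioc_subset_Ioi_self)
    · exact (intervalIntegrable_iff_integrableOn_Ioc_of_le hT).mpr (i2.mono_set Ioc_subset_Ioi_self)
  have hlim : Tendsto (fun T => inner ℝ (A T) (B T)) atTop (𝓝 (inner ℝ (A z) (B z)
      + ∫ t in Ioi z, (inner ℝ (a t) (B t) + inner ℝ (A t) (b t)))) := by
    refine ((intervalIntegral_tendsto_integral_Ioi z (i1.add i2) tendsto_id).const_add _).congr' ?_
    filter_upwards [eventually_ge_atTop z] with T hT using (key T hT).symm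
  have hAB : IntegrableOn (fun t => inner ℝ (A t) (B t)) (Ioi 0) := hA.integrable_real_inner hB
  have := IntegrableAtFilter.eq_zero_of_tendsto (μ := volume) (l := atTop)
    ⟨Ioi 0, Ioi_mem_atTop 0, hAB⟩ (by
      intro s hs
      obtain ⟨T, hT⟩ := mem_atTop_sets.mp hs
      exact top_le_iff.mp (Real.volume_Ici (a := T) ▸ measure_mono hT)) hlim
  linarith

/-- The energy estimate for `q' = f + R p`, `p' = λ⁻¹ R q`, `q 0 = -g` on the half-line, where `R` is
a nonnegative symmetric operator. The bounds do not depend on `R`. -/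
theorem exists_continuous_rep_energy_bound {R : H →L[ℝ] H}
    (hsym : ∀ x y, inner ℝ (R x) y = inner ℝ x (R y)) (hpos : ∀ x, 0 ≤ inner ℝ (R x) x)
    {Lam : ℝ} (hLam : 1 ≤ Lam) {lam : ℝ → ℝ} (hlm : AEMeasurable lam (volume.restrict (Ioi 0)))
    (hlam : ∀ᵐ z ∂(volume.restrict (Ioi (0 : ℝ))), 1 / Lam ≤ lam z ∧ lam z ≤ Lam)
    {p q f : ℝ → H} (hp : MemLp p 2 (volume.restrict (Ioi 0)))
    (hq : MemLp q 2 (volume.restrict (Ioi 0))) (hf : MemLp f 2 (volume.restrict (Ioi 0))) (g : H)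
    (h1 : ∀ a : ℝ → ℝ, ContDiff ℝ ∞ a → HasCompactSupport a →
      ∫ t in Ioi 0, deriv a t • q t = -(∫ t in Ioi 0, a t • (f t + R (p t))) + a 0 • g)
    (h2 : ∀ a : ℝ → ℝ, ContDiff ℝ ∞ a → HasCompactSupport a → tsupport a ⊆ Ioi 0 →
      ∫ t in Ioi 0, deriv a t • p t = -∫ t in Ioi 0, a t • ((lam t)⁻¹ • R (q t))) :
    ∃ P Q : ℝ → H, ContinuousOn P (Ici 0) ∧ ContinuousOn Q (Ici 0) ∧
      (∀ᵐ t ∂(volume.restrict (Ioi (0 : ℝ))), P t = p t) ∧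
      (∀ᵐ t ∂(volume.restrict (Ioi (0 : ℝ))), Q t = q t) ∧ Q 0 = -g ∧
      ∃ E : ℝ, E = (∫ t in Ioi 0, ‖f t‖ ^ 2) + (∫ t in Ioi 0, ‖p t‖ ^ 2) + Lam * ‖g‖ ^ 2 ∧
        (∫ t in Ioi 0, (inner ℝ (R (p t)) (p t) + inner ℝ (R (q t)) (q t))) ≤ Lam * E ∧
        (∀ z, 0 ≤ z → ‖P z‖ ^ 2 ≤ Lam * E) ∧
        ∀ z, 0 ≤ z → ‖Q z‖ ^ 2 ≤
          (∫ t in Ioi 0, ‖f t‖ ^ 2) + (∫ t in Ioi 0, ‖q t‖ ^ 2) + Lam * E := by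
  set μ := volume.restrict (Ioi (0 : ℝ)) with hμ
  have hL0 : 0 < Lam := by linarith
  have hinv : ∀ᵐ z ∂μ, 1 / Lam ≤ (lam z)⁻¹ ∧ (lam z)⁻¹ ≤ Lam := by
    filter_upwards [hlam] with z hz
    have h0 : 0 < lam z := lt_of_lt_of_le (by positivity) hz.1
    constructor
    · rw [one_div]; exact inv_anti₀ h0 hz.2
    · rw [inv_le_comm₀ h0 hL0, ← one_div]; exact hz.1
  have hRp : MemLp (fun t => R (p t)) 2 μ := R.comp_memLp' hp
  have hRq : MemLp (fun t => R (q t)) 2 μ := R.comp_memLp' hq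
  have hv : MemLp (fun t => f t + R (p t)) 2 μ := hf.add hRp
  have hw : MemLp (fun t => (lam t)⁻¹ • R (q t)) 2 μ := by
    refine MemLp.of_le_mul (c := Lam) hRq (hlm.inv.aestronglyMeasurable.smul hRq.1) ?_
    filter_upwards [hinv] with t ht
    rw [norm_smul, Real.norm_of_nonneg (le_trans (by positivity) ht.1)]
    exact mul_le_mul_of_nonneg_right ht.2 (norm_nonneg _)
  -- continuous representatives
  obtain ⟨p₀, hp₀⟩ := exists_ae_eq_primitive hp hw h2
  obtain ⟨q₀, hq₀⟩ := exists_ae_eq_primitive hq hv fun a ha hac has => by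
    rw [h1 a ha hac, image_eq_zero_of_notMem_tsupport fun h => lt_irrefl (0 : ℝ) (has h), zero_smul,
      add_zero]
  set P : ℝ → H := fun t => p₀ + ∫ s in (0 : ℝ)..t, (lam s)⁻¹ • R (q s) with hP
  set Q : ℝ → H := fun t => q₀ + ∫ s in (0 : ℝ)..t, (f s + R (p s)) with hQ
  have hP0 : P 0 = p₀ := by simp [hP]
  have hQ0 : Q 0 = q₀ := by simp [hQ]
  have hPp : ∀ᵐ t ∂μ, P t = p t := hp₀.mono fun t ht => ht.symm
  have hQq : ∀ᵐ t ∂μ, Q t = q t := hq₀.mono fun t ht => ht.symm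
  have hPm : MemLp P 2 μ := hp.ae_eq (hPp.mono fun t ht => ht.symm)
  have hQm : MemLp Q 2 μ := hq.ae_eq (hQq.mono fun t ht => ht.symm)
  -- A test function equal to 1 at 0 detects the initial value: once the weak equation is compared
  -- with the integration by parts for the primitive, only the boundary terms remain.
  have hQg : Q 0 = -g := by
    obtain ⟨η, -, hηc, hη, -, hη1⟩ :=
      exists_contDiff_tsupport_subset (n := ⊤) (univ_mem (f := 𝓝 (0 : ℝ)))
    have e1 := integral_deriv_smul_primitive hη hηc
      (fun T => hv.integrableOn_Ioc_of_Ioi le_rfl T) q₀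
    have e2 := h1 η hη hηc
    have e3 : ∫ t in Ioi 0, deriv η t • q t
        = ∫ t in Ioi 0, deriv η t • (q₀ + ∫ s in (0 : ℝ)..t, (f s + R (p s))) :=
      integral_congr_ae (hq₀.mono fun t ht => by simp only [ht])
    rw [e3, e1, hη1, one_smul, one_smul, sub_eq_add_neg, add_comm] at e2
    rw [hQ0, ← neg_eq_iff_eq_neg]
    exact add_left_cancel e2
  have hPd : ∀ t, 0 ≤ t → P t = P 0 + ∫ s in (0 : ℝ)..t, (lam s)⁻¹ • R (q s) :=
    fun t _ => by rw [hP0]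
  have hQd : ∀ t, 0 ≤ t → Q t = Q 0 + ∫ s in (0 : ℝ)..t, (f s + R (p s)) :=
    fun t _ => by rw [hQ0]
  -- notation for the quantities in the estimate
  have ipp : Integrable (fun t => inner ℝ (R (p t)) (p t)) μ := hRp.integrable_real_inner hp
  have iqq : Integrable (fun t => inner ℝ (R (q t)) (q t)) μ := hRq.integrable_real_inner hq
  have iqq' : Integrable (fun t => (lam t)⁻¹ * inner ℝ (R (q t)) (q t)) μ := by
    simpa only [real_inner_smul_left] using hw.integrable_real_inner hq
  have hff : Integrable (fun t => ‖f t‖ ^ 2) μ := hf.integrable_norm_pow (by norm_num)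
  have hpp : Integrable (fun t => ‖p t‖ ^ 2) μ := hp.integrable_norm_pow (by norm_num)
  have hqq : Integrable (fun t => ‖q t‖ ^ 2) μ := hq.integrable_norm_pow (by norm_num)
  set D : ℝ → ℝ := fun t => inner ℝ (R (p t)) (p t) + (lam t)⁻¹ * inner ℝ (R (q t)) (q t) with hD
  have hDi : Integrable D μ := ipp.add iqq'
  have hD0 : ∀ᵐ t ∂μ, 0 ≤ D t := by
    filter_upwards [hinv] with t ht
    exact add_nonneg (hpos _) (mul_nonneg (le_trans (by positivity) ht.1) (hpos _))
  -- Expand the nonnegative numbers ⟨R(x ± y), x ± y⟩.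
  have hcs : ∀ x y, 2 * |inner ℝ (R x) y| ≤ inner ℝ (R x) x + inner ℝ (R y) y := by
    intro x y
    have a1 := hpos (x + y)
    have a2 := hpos (x - y)
    have a3 : inner ℝ (R y) x = inner ℝ (R x) y := by rw [hsym, real_inner_comm]
    simp only [map_add, map_sub, inner_add_left, inner_add_right, inner_sub_left, inner_sub_right,
      a3] at a1 a2
    rcases abs_cases (inner ℝ (R x) y) with h | h <;> rw [h.1] <;> linarith
  have htail : ∀ {F G : ℝ → ℝ}, Integrable G μ → (∀ᵐ t ∂μ, F t ≤ G t) → (∀ᵐ t ∂μ, 0 ≤ G t) →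
      Integrable F μ → ∀ z, 0 ≤ z → ∫ t in Ioi z, F t ≤ ∫ t in Ioi 0, G t := by
    intro F G hG hFG hG0 hF z hz
    have hmono : volume.restrict (Ioi z) ≤ μ := Measure.restrict_mono (Ioi_subset_Ioi hz) le_rfl
    exact (integral_mono_ae (hF.mono_measure hmono) (hG.mono_measure hmono)
      (ae_mono hmono hFG)).trans (integral_mono_measure hmono hG0 hG)
  set E₁ := ∫ t, D t ∂μ with hE₁
  -- bound for `P`
  have hPb : ∀ z, 0 ≤ z → ‖P z‖ ^ 2 ≤ Lam * E₁ := by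
    intro z hz
    -- Here ‖P z‖² = −2 ∫_z^∞ λ⁻¹⟨Rq, p⟩, and the integrand is at most Lam times the density D: the
    -- factor Lam ≥ 1 serves the q part, the bound λ⁻¹ ≤ Lam the p part.
    have e := neg_inner_eq_integral_Ioi hw hw hPm hPm hPd hPd hz
    rw [real_inner_self_eq_norm_sq] at e
    have hi : Integrable (fun t => -(inner ℝ ((lam t)⁻¹ • R (q t)) (P t)
        + inner ℝ (P t) ((lam t)⁻¹ • R (q t)))) μ :=
      ((hw.integrable_real_inner hPm).add (hPm.integrable_real_inner hw)).neg
    have := htail (hDi.const_mul Lam) (F := fun t => -(inner ℝ ((lam t)⁻¹ • R (q t)) (P t)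
        + inner ℝ (P t) ((lam t)⁻¹ • R (q t)))) ?_ ?_ hi z hz
    · rw [integral_neg, ← e, neg_neg, integral_const_mul] at this
      exact this
    · filter_upwards [hinv, hPp] with t ht htP
      rw [htP, real_inner_comm ((lam t)⁻¹ • R (q t)) (p t), real_inner_smul_left]
      have b1 := hcs (q t) (p t)
      have b2 := hpos (p t)
      have b3 := hpos (q t)
      have b0 : 0 ≤ (lam t)⁻¹ := le_trans (by positivity) ht.1
      have b4 := neg_abs_le (inner ℝ (R (q t)) (p t))
      have b5 : (lam t)⁻¹ * (-(2 * inner ℝ (R (q t)) (p t)))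
          ≤ (lam t)⁻¹ * (inner ℝ (R (q t)) (q t) + inner ℝ (R (p t)) (p t)) :=
        mul_le_mul_of_nonneg_left (by linarith) b0
      have b6 : (lam t)⁻¹ * inner ℝ (R (p t)) (p t) ≤ Lam * inner ℝ (R (p t)) (p t) :=
        mul_le_mul_of_nonneg_right ht.2 b2
      have b7 : 1 * ((lam t)⁻¹ * inner ℝ (R (q t)) (q t))
          ≤ Lam * ((lam t)⁻¹ * inner ℝ (R (q t)) (q t)) :=
        mul_le_mul_of_nonneg_right hLam (mul_nonneg b0 b3)
      simp only [hD]
      linarith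
    · filter_upwards [hD0] with t ht using mul_nonneg hL0.le ht
  -- the energy identity
  have hE : E₁ ≤ (∫ t, ‖f t‖ ^ 2 ∂μ) + (∫ t, ‖p t‖ ^ 2 ∂μ) + Lam * ‖g‖ ^ 2 := by
    have e := neg_inner_eq_integral_Ioi hv hw hQm hPm hQd hPd le_rfl
    have ifp : Integrable (fun t => inner ℝ (f t) (p t)) μ := hf.integrable_real_inner hp
    have e2 : ∫ t, (inner ℝ (f t + R (p t)) (P t) + inner ℝ (Q t) ((lam t)⁻¹ • R (q t))) ∂μ
        = (∫ t, inner ℝ (f t) (p t) ∂μ) + E₁ := by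
      rw [hE₁, ← integral_add ifp hDi]
      refine integral_congr_ae ?_
      filter_upwards [hPp, hQq] with t ht1 ht2
      rw [ht1, ht2, inner_add_left, real_inner_smul_right,
        real_inner_comm (R (q t)) (q t)]
      simp only [hD]
      ring
    rw [e2, hQg, inner_neg_left, neg_neg] at e
    have e3 : -(∫ t, inner ℝ (f t) (p t) ∂μ)
        ≤ ((∫ t, ‖f t‖ ^ 2 ∂μ) + (∫ t, ‖p t‖ ^ 2 ∂μ)) / 2 := by
      rw [← integral_neg, ← integral_add hff hpp, ← integral_div]
      refine integral_mono ifp.neg ((hff.add hpp).div_const 2) fun t => ?_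
      have b1 := abs_real_inner_le_norm (f t) (p t)
      have b2 := neg_abs_le (inner ℝ (f t) (p t))
      have b3 := two_mul_le_add_sq ‖f t‖ ‖p t‖
      simp only
      linarith
    -- Young's inequality with weight Lam: since ‖P 0‖² ≤ Lam E₁, the P 0 part costs at most E₁/2,
    -- which is absorbed on the left.
    have e4 : inner ℝ g (P 0) ≤ Lam * ‖g‖ ^ 2 / 2 + E₁ / 2 := by
      have b1 := real_inner_le_norm g (P 0)
      have b2 := hPb 0 le_rfl
      have b3 : ‖P 0‖ ^ 2 / Lam ≤ E₁ := by rw [div_le_iff₀ hL0]; linarith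
      have b4 : 2 * (‖g‖ * ‖P 0‖) ≤ Lam * ‖g‖ ^ 2 + ‖P 0‖ ^ 2 / Lam := by
        have : 0 ≤ (Lam * ‖g‖ - ‖P 0‖) ^ 2 / Lam := by positivity
        have h5 : (Lam * ‖g‖ - ‖P 0‖) ^ 2 / Lam
            = Lam * ‖g‖ ^ 2 + ‖P 0‖ ^ 2 / Lam - 2 * (‖g‖ * ‖P 0‖) := by
          field_simp; ring
        linarith
      linarith
    linarith
  have hS : (∫ t, (inner ℝ (R (p t)) (p t) + inner ℝ (R (q t)) (q t)) ∂μ) ≤ Lam * E₁ := by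
    rw [hE₁, ← integral_const_mul]
    refine integral_mono_ae (ipp.add iqq) (hDi.const_mul Lam) ?_
    filter_upwards [hinv] with t ht
    have b2 := hpos (p t)
    have b3 := hpos (q t)
    have b4 : 1 / Lam * inner ℝ (R (q t)) (q t) ≤ (lam t)⁻¹ * inner ℝ (R (q t)) (q t) :=
      mul_le_mul_of_nonneg_right ht.1 b3
    have b5 : Lam * (1 / Lam * inner ℝ (R (q t)) (q t))
        ≤ Lam * ((lam t)⁻¹ * inner ℝ (R (q t)) (q t)) := mul_le_mul_of_nonneg_left b4 hL0.le
    have b6 : Lam * (1 / Lam * inner ℝ (R (q t)) (q t)) = inner ℝ (R (q t)) (q t) := by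
      field_simp
    have b7 : 1 * inner ℝ (R (p t)) (p t) ≤ Lam * inner ℝ (R (p t)) (p t) :=
      mul_le_mul_of_nonneg_right hLam b2
    simp only [hD]
    linarith
  have hLE := mul_le_mul_of_nonneg_left hE hL0.le
  refine ⟨P, Q, continuousOn_primitive_Ici hw p₀, continuousOn_primitive_Ici hv q₀, hPp, hQq, hQg,
    _, rfl, hS.trans hLE, fun z hz => (hPb z hz).trans hLE, fun z hz => ?_⟩
  have e := neg_inner_eq_integral_Ioi hv hv hQm hQm hQd hQd hz
  rw [real_inner_self_eq_norm_sq] at e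
  have hi : Integrable (fun t => -(inner ℝ (f t + R (p t)) (Q t)
      + inner ℝ (Q t) (f t + R (p t)))) μ :=
    ((hv.integrable_real_inner hQm).add (hQm.integrable_real_inner hv)).neg
  have := htail (G := fun t => (‖f t‖ ^ 2 + ‖q t‖ ^ 2)
    + (inner ℝ (R (p t)) (p t) + inner ℝ (R (q t)) (q t))) ((hff.add hqq).add (ipp.add iqq))
    ?_ (.of_forall fun t => by have := hpos (p t); have := hpos (q t); positivity) hi z hz
  · rw [integral_neg, ← e, neg_neg, integral_add (f := fun t => ‖f t‖ ^ 2 + ‖q t‖ ^ 2)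
      (g := fun t => inner ℝ (R (p t)) (p t) + inner ℝ (R (q t)) (q t)) (hff.add hqq) (ipp.add iqq),
      integral_add hff hqq] at this
    linarith
  · filter_upwards [hQq] with t ht
    rw [ht, real_inner_comm (f t + R (p t)) (q t), inner_add_left]
    have b1 := hcs (p t) (q t)
    have b2 := neg_abs_le (inner ℝ (R (p t)) (q t))
    have b3 := abs_real_inner_le_norm (f t) (q t)
    have b4 := neg_abs_le (inner ℝ (f t) (q t))
    have b5 := two_mul_le_add_sq ‖f t‖ ‖q t‖
    linarith

end Energy

/-! ### Multiplication operators on L² -/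

section Multiplier

variable {X E F : Type*} [MeasurableSpace X] {μ : Measure X}
  [NormedAddCommGroup E] [NormedSpace ℂ E] [NormedAddCommGroup F] [NormedSpace ℂ F]

/-- Multiplication by a bounded operator-valued function, on `L²`. -/
noncomputable def mulOp (m : X → E →L[ℂ] F) (hm : MemLp m ∞ μ) : Lp E 2 μ →L[ℂ] Lp F 2 μ :=
  (ContinuousLinearMap.id ℂ (E →L[ℂ] F)).holderL μ ∞ 2 2 (hm.toLp m)

theorem coeFn_mulOp (m : X → E →L[ℂ] F) (hm : MemLp m ∞ μ) (v : Lp E 2 μ) :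
    mulOp m hm v =ᵐ[μ] fun x => m x (v x) := by
  have h := (ContinuousLinearMap.id ℂ (E →L[ℂ] F)).coeFn_holder (r := 2) (hm.toLp m) v
  filter_upwards [h, hm.coeFn_toLp] with x h1 h2
  change (ContinuousLinearMap.holder 2 (ContinuousLinearMap.id ℂ (E →L[ℂ] F)) (hm.toLp m) v) x = _
  rw [h1, h2]; rfl

theorem norm_sq_eq_integral_norm_sq {X E : Type*} [MeasurableSpace X] {μ : Measure X}
    [NormedAddCommGroup E] (v : Lp E 2 μ) : ‖v‖ ^ 2 = ∫ x, ‖v x‖ ^ 2 ∂μ := by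
  rw [Lp.norm_def, (Lp.memLp v).eLpNorm_eq_integral_rpow_norm (by norm_num) (by norm_num),
    ENNReal.toReal_ofReal (by positivity)]
  simp only [ENNReal.toReal_ofNat, Real.rpow_ofNat]
  rw [← Real.rpow_natCast, ← Real.rpow_mul (by positivity)]
  norm_num

end Multiplier

/-! ### Fourier transform of first-order weak identities -/

section FourierWeak

open scoped SchwartzMap FourierTransform LineDeriv

variable {V F : Type*} [NormedAddCommGroup V] [InnerProductSpace ℝ V] [FiniteDimensional ℝ V]
  [MeasurableSpace V] [BorelSpace V] [NormedAddCommGroup F] [InnerProductSpace ℂ F]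
  [CompleteSpace F]

theorem integrable_smul_of_memLp_two {X : Type*} [MeasurableSpace X] {μ : Measure X}
    {c u : X → ℂ} (hc : MemLp c 2 μ) (hu : MemLp u 2 μ) : Integrable (fun x => c x • u x) μ :=
  memLp_one_iff_integrable.mp (hu.smul hc)

/-- A first-order weak identity tested with compactly supported functions can be tested with
Schwartz functions. -/
theorem weak_identity_schwartz {ι : Type*} [Fintype ι] (e : ι → V) {s : V → ℂ} {y : ι → V → ℂ}
    (hs : MemLp s 2) (hy : ∀ j, MemLp (y j) 2)
    (h : ∀ b : V → ℝ, ContDiff ℝ ∞ b → HasCompactSupport b →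
      (∫ x, b x • s x) + ∑ j, ∫ x, fderiv ℝ b x (e j) • y j x = 0) (c : 𝓢(V, ℂ)) :
    (∫ x, c x • s x) + ∑ j, ∫ x, (∂_{e j} c) x • y j x = 0 := by
  -- Complex compactly supported test functions are reached by splitting into real and imaginary
  -- parts.
  have hC : ∀ b : V → ℂ, ContDiff ℝ ∞ b → HasCompactSupport b →
      (∫ x, b x • s x) + ∑ j, ∫ x, fderiv ℝ b x (e j) • y j x = 0 := by
    intro b hb hbc
    have hbre : ContDiff ℝ ∞ (fun x => (b x).re) := Complex.reCLM.contDiff.comp hb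
    have hbim : ContDiff ℝ ∞ (fun x => (b x).im) := Complex.imCLM.contDiff.comp hb
    have hbrec : HasCompactSupport (fun x => (b x).re) := hbc.comp_left (g := Complex.re) rfl
    have hbimc : HasCompactSupport (fun x => (b x).im) := hbc.comp_left (g := Complex.im) rfl
    have hsplit : ∀ {r t : V → ℝ} {u : V → ℂ}, Continuous r → HasCompactSupport r → Continuous t →
        HasCompactSupport t → MemLp u 2 → ∀ w : V → ℂ, (∀ x, w x = r x + t x * Complex.I) →
        ∫ x, w x • u x = (∫ x, r x • u x) + Complex.I * ∫ x, t x • u x := by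
      intro r t u hr hrc ht htc hu w hw
      rw [← integral_const_mul, ← integral_add (integrable_compactSupport_smul hr hrc hu)
        ((integrable_compactSupport_smul ht htc hu).const_mul _)]
      refine integral_congr_ae (.of_forall fun x => ?_)
      simp only [hw, smul_eq_mul, Complex.real_smul]
      ring
    have hf : ∀ x v, fderiv ℝ b x v = (fderiv ℝ (fun x => (b x).re) x v : ℝ)
        + (fderiv ℝ (fun x => (b x).im) x v : ℝ) * Complex.I := by
      intro x v
      have hd := (hb.differentiable (by simp)) x
      have e1 : fderiv ℝ (fun x => (b x).re) x = Complex.reCLM ∘L fderiv ℝ b x :=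
        (Complex.reCLM.hasFDerivAt.comp x hd.hasFDerivAt).fderiv
      have e2 : fderiv ℝ (fun x => (b x).im) x = Complex.imCLM ∘L fderiv ℝ b x :=
        (Complex.imCLM.hasFDerivAt.comp x hd.hasFDerivAt).fderiv
      rw [e1, e2]
      simp
    have hcd : ∀ {r : V → ℝ}, ContDiff ℝ ∞ r → ∀ v, Continuous (fun x => fderiv ℝ r x v) :=
      fun hr v => (hr.continuous_fderiv (by simp)).clm_apply continuous_const
    have h1 := h _ hbre hbrec
    have h2 := h _ hbim hbimc
    rw [hsplit hbre.continuous hbrec hbim.continuous hbimc hs b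
      (fun x => (Complex.re_add_im (b x)).symm)]
    have h3 : ∀ j, ∫ x, fderiv ℝ b x (e j) • y j x
        = (∫ x, fderiv ℝ (fun x => (b x).re) x (e j) • y j x)
          + Complex.I * ∫ x, fderiv ℝ (fun x => (b x).im) x (e j) • y j x := fun j =>
      hsplit (hcd hbre _) (hbrec.fderiv_apply ℝ _) (hcd hbim _) (hbimc.fderiv_apply ℝ _) (hy j) _
        (fun x => hf x _)
    simp only [h3, Finset.sum_add_distrib, ← Finset.mul_sum]
    linear_combination h1 + Complex.I * h2
  -- Cut off with χ(x/(n+1)). The derivative falling on the cut-off is O(1/(n+1)), and all terms are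
  -- dominated by products of L² functions.
  set χ : ContDiffBump (0 : V) := ⟨1, 2, one_pos, one_lt_two⟩
  have hχ : ContDiff ℝ ∞ χ := χ.contDiff
  obtain ⟨C, hCb⟩ := (χ.hasCompactSupport.fderiv ℝ).exists_bound_of_continuous
    (hχ.continuous_fderiv (by simp))
  have hε : ∀ n : ℕ, (0 : ℝ) < (n + 1 : ℝ)⁻¹ := fun n => by positivity
  have hε1 : ∀ n : ℕ, (n + 1 : ℝ)⁻¹ ≤ 1 := fun n => inv_le_one_of_one_le₀ (by simp)
  have hεlim : Tendsto (fun n : ℕ => (n + 1 : ℝ)⁻¹) atTop (𝓝 0) := by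
    simpa using tendsto_one_div_add_atTop_nhds_zero_nat (𝕜 := ℝ)
  set b : ℕ → V → ℂ := fun n x => (χ ((n + 1 : ℝ)⁻¹ • x) : ℂ) * c x with hb
  have hc : ContDiff ℝ ∞ c := c.smooth ⊤
  have hχn : ∀ n : ℕ, ContDiff ℝ ∞ (fun x : V => (χ ((n + 1 : ℝ)⁻¹ • x) : ℂ)) := fun n =>
    Complex.ofRealCLM.contDiff.comp (hχ.comp (contDiff_const_smul _))
  have hbs : ∀ n, ContDiff ℝ ∞ (b n) := fun n => (hχn n).mul hc
  have hbc : ∀ n, HasCompactSupport (b n) := fun n =>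
    ((χ.hasCompactSupport.comp_smul (hε n).ne').comp_left (g := Complex.ofReal)
      Complex.ofReal_zero).mul_right
  have hbd : ∀ n x v, fderiv ℝ (b n) x v = (χ ((n + 1 : ℝ)⁻¹ • x) : ℂ) * fderiv ℝ c x v
      + c x * (((n + 1 : ℝ)⁻¹ * fderiv ℝ χ ((n + 1 : ℝ)⁻¹ • x) v : ℝ) : ℂ) := by
    intro n x v
    have d1 : HasFDerivAt (fun x : V => χ ((n + 1 : ℝ)⁻¹ • x))
        (fderiv ℝ χ ((n + 1 : ℝ)⁻¹ • x) ∘L ((n + 1 : ℝ)⁻¹ • ContinuousLinearMap.id ℝ V)) x :=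
      ((hχ.differentiable (by simp)) _).hasFDerivAt.comp x
        ((hasFDerivAt_id x).const_smul ((n + 1 : ℝ)⁻¹))
    have d2 := Complex.ofRealCLM.hasFDerivAt.comp x d1
    have d3 := d2.mul ((hc.differentiable (by simp)) x).hasFDerivAt
    have d4 : fderiv ℝ (b n) x = _ := d3.fderiv
    rw [d4]
    simp
  have h01 : ∀ n x, ‖(χ ((n + 1 : ℝ)⁻¹ • x) : ℂ)‖ ≤ 1 := fun n x => by
    rw [Complex.norm_real, Real.norm_of_nonneg χ.nonneg]; exact χ.le_one
  have hχ1 : ∀ x, ∀ᶠ n : ℕ in atTop, χ ((n + 1 : ℝ)⁻¹ • x) = 1 := by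
    intro x
    have : Tendsto (fun n : ℕ => (n + 1 : ℝ)⁻¹ • x) atTop (𝓝 0) := by
      simpa using hεlim.smul_const x
    filter_upwards [this.eventually (Metric.closedBall_mem_nhds (0 : V) one_pos)] with n hn
    exact χ.one_of_mem_closedBall hn
  have hcm : MemLp c 2 (volume : Measure V) := c.memLp 2
  have hcd : ∀ v, MemLp (fun x => fderiv ℝ c x v) 2 (volume : Measure V) := fun v => by
    have := (∂_{v} c).memLp 2 (volume : Measure V)
    exact this.ae_eq (.of_forall fun x => SchwartzMap.lineDerivOp_apply_eq_fderiv v c x)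
  have lim0 : Tendsto (fun n => ∫ x, b n x • s x) atTop (𝓝 (∫ x, c x • s x)) := by
    refine tendsto_integral_of_dominated_convergence (fun x => ‖c x • s x‖)
      (fun n => ((hbs n).continuous.aestronglyMeasurable.smul hs.1))
      (integrable_smul_of_memLp_two hcm hs).norm (fun n => .of_forall fun x => ?_)
      (.of_forall fun x => ?_)
    · rw [norm_smul, norm_smul]
      refine mul_le_mul_of_nonneg_right ?_ (norm_nonneg _)
      rw [hb, norm_mul]
      exact mul_le_of_le_one_left (norm_nonneg _) (h01 n x)
    · refine tendsto_const_nhds.congr' ?_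
      filter_upwards [hχ1 x] with n hn
      simp [hb, hn]
  have limj : ∀ j, Tendsto (fun n => ∫ x, fderiv ℝ (b n) x (e j) • y j x) atTop
      (𝓝 (∫ x, (∂_{e j} c) x • y j x)) := by
    intro j
    refine tendsto_integral_of_dominated_convergence
      (fun x => ‖fderiv ℝ c x (e j) • y j x‖ + C * ‖e j‖ * ‖c x • y j x‖)
      (fun n => ((((hbs n).continuous_fderiv (by simp)).clm_apply
        continuous_const).aestronglyMeasurable.smul (hy j).1))
      ((integrable_smul_of_memLp_two (hcd _) (hy j)).norm.add
        ((integrable_smul_of_memLp_two hcm (hy j)).norm.const_mul _))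
      (fun n => .of_forall fun x => ?_) (.of_forall fun x => ?_)
    · rw [norm_smul, norm_smul, norm_smul, ← mul_assoc, ← add_mul]
      refine mul_le_mul_of_nonneg_right ?_ (norm_nonneg _)
      rw [hbd]
      refine (norm_add_le _ _).trans (add_le_add ?_ ?_)
      · rw [norm_mul]; exact mul_le_of_le_one_left (norm_nonneg _) (h01 n x)
      · rw [norm_mul, mul_comm, Complex.norm_real, norm_mul, Real.norm_of_nonneg (hε n).le]
        refine mul_le_mul_of_nonneg_right ?_ (norm_nonneg _)
        have := ((fderiv ℝ χ ((n + 1 : ℝ)⁻¹ • x)).le_opNorm (e j)).trans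
          (mul_le_mul_of_nonneg_right (hCb _) (norm_nonneg _))
        exact (mul_le_of_le_one_left (norm_nonneg _) (hε1 n)).trans this
    · refine Tendsto.smul_const ?_ _
      simp only [hbd, SchwartzMap.lineDerivOp_apply_eq_fderiv]
      have t1 : Tendsto (fun n : ℕ => (χ ((n + 1 : ℝ)⁻¹ • x) : ℂ) * fderiv ℝ c x (e j)) atTop
          (𝓝 (fderiv ℝ c x (e j))) := by
        refine tendsto_const_nhds.congr' ?_
        filter_upwards [hχ1 x] with n hn
        simp [hn]
      have t2 : Tendsto (fun n : ℕ => (n + 1 : ℝ)⁻¹ * fderiv ℝ χ ((n + 1 : ℝ)⁻¹ • x) (e j)) atTop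
          (𝓝 0) := by
        refine squeeze_zero_norm (a := fun n : ℕ => (n + 1 : ℝ)⁻¹ * (C * ‖e j‖)) (fun n => ?_) ?_
        · rw [norm_mul, Real.norm_of_nonneg (hε n).le]
          exact mul_le_mul_of_nonneg_left (((fderiv ℝ χ _).le_opNorm (e j)).trans
            (mul_le_mul_of_nonneg_right (hCb _) (norm_nonneg _))) (hε n).le
        · simpa using hεlim.mul_const (C * ‖e j‖)
      have t3 := (Complex.continuous_ofReal.tendsto 0).comp t2
      simpa using t1.add (t3.const_mul (c x))
  have := lim0.add (tendsto_finsetSum Finset.univ fun j _ => limj j)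
  refine tendsto_nhds_unique this ?_
  simp only [hC _ (hbs _) (hbc _)]
  exact tendsto_const_nhds

/-- The Fourier transform moves from one factor of the pairing to the other, as in the definition of
the transform of a tempered distribution. The functional α passes through the integral. -/
theorem integral_fourier_smul_clm (α : F →L[ℂ] ℂ) (S : Lp F 2 (volume : Measure V)) (c : 𝓢(V, ℂ)) :
    ∫ x, (𝓕 c) x • α (S x) = ∫ ξ, c ξ • α ((𝓕 S : Lp F 2 (volume : Measure V)) ξ) := by
  have hint : ∀ (c : 𝓢(V, ℂ)) (S : Lp F 2 (volume : Measure V)),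
      ∫ x, c x • α (S x) = α (Lp.toTemperedDistribution S c) := by
    intro c S
    rw [Lp.toTemperedDistribution_apply, ← ContinuousLinearMap.integral_comp_comm]
    · simp
    · exact memLp_one_iff_integrable.mp ((Lp.memLp S).smul (c.memLp 2 (volume : Measure V)))
  rw [hint, hint, ← Lp.fourier_toTemperedDistribution_eq, TemperedDistribution.fourier_apply]

/-- A first-order weak identity between `L²` functions, on the Fourier side. -/
theorem fourier_of_weak_identity {ι : Type*} [Fintype ι] (e : ι → V)
    (S Y : Lp F 2 (volume : Measure V)) (α : F →L[ℂ] ℂ) (β : ι → F →L[ℂ] ℂ)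
    (h : ∀ b : V → ℝ, ContDiff ℝ ∞ b → HasCompactSupport b →
      (∫ x, b x • α (S x)) + ∑ j, ∫ x, fderiv ℝ b x (e j) • β j (Y x) = 0) :
    ∀ᵐ ξ, α ((𝓕 S : Lp F 2 (volume : Measure V)) ξ)
      = 2 * Real.pi * Complex.I * ∑ j, (inner ℝ ξ (e j) : ℂ)
        * β j ((𝓕 Y : Lp F 2 (volume : Measure V)) ξ) := by
  set S' := (𝓕 S : Lp F 2 (volume : Measure V))
  set Y' := (𝓕 Y : Lp F 2 (volume : Measure V))
  have hαS : MemLp (fun x => α (S' x)) 2 := α.comp_memLp' (Lp.memLp S')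
  have hβY : ∀ j, MemLp (fun x => β j (Y' x)) 2 := fun j => (β j).comp_memLp' (Lp.memLp Y')
  have hw := weak_identity_schwartz e (s := fun x => α (S x)) (y := fun j x => β j (Y x))
    (α.comp_memLp' (Lp.memLp S)) (fun j => (β j).comp_memLp' (Lp.memLp Y)) h
  have hloc : LocallyIntegrable (fun ξ => α (S' ξ)
      - 2 * Real.pi * Complex.I * ∑ j, (inner ℝ ξ (e j) : ℂ) * β j (Y' ξ)) := by
    refine (hαS.locallyIntegrable (by norm_num)).sub ?_
    have : LocallyIntegrable (fun ξ => ∑ j,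
        (2 * Real.pi * Complex.I * (inner ℝ ξ (e j) : ℂ)) • β j (Y' ξ)) := by
      refine locallyIntegrable_finsetSum _ fun j _ => ?_
      exact ((hβY j).locallyIntegrable (by norm_num)).continuous_smul (by fun_prop)
    simpa only [Finset.mul_sum, smul_eq_mul, mul_assoc] using this
  have key := ae_eq_zero_of_integral_contDiff_smul_eq_zero hloc fun g hg hgc => ?_
  · filter_upwards [key] with ξ hξ using sub_eq_zero.mp hξ
  have hgc' : HasCompactSupport (Complex.ofRealCLM ∘ g) := hgc.comp_left rfl
  have hg' : ContDiff ℝ ∞ (Complex.ofRealCLM ∘ g) := by fun_prop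
  set c : 𝓢(V, ℂ) := hgc'.toSchwartzMap hg' with hcdef
  have hcx : ∀ x, c x = (g x : ℂ) := fun x => rfl
  -- Testing with the transform of a bump c turns the derivative along e j into the multiplier
  -- −2πi⟨ξ, e j⟩ on c. After the transform is moved onto S and Y, the result is the claimed
  -- identity integrated against c.
  have h1 := hw (𝓕 c)
  rw [integral_fourier_smul_clm] at h1
  have h2 : ∀ j, ∫ x, (∂_{e j} (𝓕 c)) x • β j (Y x)
      = ∫ ξ, (-(2 * Real.pi * Complex.I) * (inner ℝ ξ (e j) : ℂ) * g ξ) * β j (Y' ξ) := by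
    intro j
    have ht : (inner ℝ · (e j) : V → ℝ).HasTemperateGrowth := by fun_prop
    rw [SchwartzMap.lineDerivOp_fourier_eq, integral_fourier_smul_clm]
    refine integral_congr_ae (.of_forall fun ξ => ?_)
    simp [ht, hcx, SchwartzMap.smulLeftCLM_apply_apply]
    ring
  simp only [h2] at h1
  have i1 : Integrable (fun ξ => c ξ • α (S' ξ)) := integrable_smul_of_memLp_two (c.memLp 2) hαS
  have i2 : ∀ j, Integrable (fun ξ =>
      (-(2 * Real.pi * Complex.I) * (inner ℝ ξ (e j) : ℂ) * g ξ) * β j (Y' ξ)) := fun j => by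
    have hcont : Continuous fun ξ => (-(2 * Real.pi * Complex.I) * (inner ℝ ξ (e j) : ℂ) * g ξ) := by
      have := hg.continuous
      fun_prop
    exact integrable_smul_of_memLp_two (hcont.memLp_of_hasCompactSupport
      (HasCompactSupport.mul_left hgc')) (hβY j)
  rw [← integral_finsetSum _ fun j _ => i2 j, ← integral_add i1
    (integrable_finsetSum _ fun j _ => i2 j)] at h1
  rw [← h1]
  refine integral_congr_ae (.of_forall fun ξ => ?_)
  simp only [hcx, Complex.real_smul, smul_eq_mul]
  rw [mul_sub, sub_eq_add_neg, Finset.mul_sum, Finset.mul_sum, ← Finset.sum_neg_distrib]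
  congr 1
  exact Finset.sum_congr rfl fun j _ => by ring

end FourierWeak

/-! ### Square integrable functions on a product as L²-valued functions -/

section Slices

/-- In a second countable space every open set is a countable union of balls, so measurability of
the distances to fixed points is enough. For L²-valued maps these distances are iterated integrals.
-/
theorem stronglyMeasurable_of_measurable_edist {α Y : Type*} [MeasurableSpace α]
    [PseudoEMetricSpace Y] [SecondCountableTopology Y] {U : α → Y}
    (h : ∀ y, Measurable fun z => edist (U z) y) : StronglyMeasurable U := by
  borelize Y
  refine Measurable.stronglyMeasurable (measurable_of_isOpen fun s hs => ?_)
  have hr : ∀ y : s, ∃ ε > 0, Metric.eball (y : Y) ε ⊆ s := fun y => EMetric.isOpen_iff.mp hs y y.2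
  choose ε hε hεs using hr
  obtain ⟨T, hT, hTU⟩ := TopologicalSpace.isOpen_iUnion_countable
    (fun y : s => Metric.eball (y : Y) (ε y)) (fun y => Metric.isOpen_eball)
  have hsU : s = ⋃ y ∈ T, Metric.eball (y : Y) (ε y) := by
    rw [hTU]
    exact Subset.antisymm (fun y hy => mem_iUnion.mpr ⟨⟨y, hy⟩, Metric.mem_eball_self (hε _)⟩)
      (iUnion_subset hεs)
  rw [hsU, preimage_iUnion₂]
  exact MeasurableSet.biUnion hT fun y _ => measurableSet_lt (h y) measurable_const

variable {α β E : Type*} [MeasurableSpace α] [MeasurableSpace β] [NormedAddCommGroup E]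
  [SecondCountableTopology E] {μ : Measure α} {ν : Measure β} [SFinite ν]
  [IsSeparable ν]

/-- A square integrable function on a product, as a square integrable function with values in the
`L²` space of the second factor. -/
theorem exists_memLp_slices {w : α × β → E} (hw : MemLp w 2 (μ.prod ν)) :
    ∃ U : α → Lp E 2 ν, MemLp U 2 μ ∧ (∀ᵐ z ∂μ, U z =ᵐ[ν] fun x => w (z, x)) ∧
      eLpNorm U 2 μ = eLpNorm w 2 (μ.prod ν) := by
  classical
  set w' := hw.1.mk w with hw'
  have hw'm : StronglyMeasurable w' := hw.1.stronglyMeasurable_mk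
  have hww' : w =ᵐ[μ.prod ν] w' := hw.1.ae_eq_mk
  have hslm : ∀ z, StronglyMeasurable fun x => w' (z, x) := fun z =>
    hw'm.comp_measurable measurable_prodMk_left
  have heN : ∀ u : β → E, eLpNorm u 2 ν = (∫⁻ x, ‖u x‖ₑ ^ (2 : ℝ) ∂ν) ^ (1 / 2 : ℝ) := fun u => by
    rw [eLpNorm_eq_lintegral_rpow_enorm_toReal (by norm_num) (by norm_num)]; simp
  have hmeas : ∀ u : β → E, StronglyMeasurable u →
      Measurable fun z => eLpNorm (fun x => w' (z, x) - u x) 2 ν := by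
    intro u hu
    simp only [heN]
    have : Measurable fun p : α × β => ‖w' p - u p.2‖ₑ ^ (2 : ℝ) :=
      ((hw'm.sub (hu.comp_measurable measurable_snd)).enorm).pow_const _
    exact (this.lintegral_prod_right').pow_const _
  have hgood : MeasurableSet {z | eLpNorm (fun x => w' (z, x)) 2 ν < ⊤} := by
    have := hmeas 0 stronglyMeasurable_zero
    simp only [Pi.zero_apply, sub_zero] at this
    exact measurableSet_lt this measurable_const
  -- The default value 0 is used only on the null set of z whose slice is not square integrable.
  set U : α → Lp E 2 ν := fun z =>
    if h : eLpNorm (fun x => w' (z, x)) 2 ν < ⊤ then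
      MemLp.toLp (fun x => w' (z, x)) ⟨(hslm z).aestronglyMeasurable, h⟩ else 0 with hU
  have hUm : StronglyMeasurable U := by
    have : Fact ((2 : ℝ≥0∞) ≠ ⊤) := ⟨ENNReal.ofNat_ne_top⟩
    refine stronglyMeasurable_of_measurable_edist fun y => ?_
    have e : (fun z => edist (U z) y) = fun z =>
        if eLpNorm (fun x => w' (z, x)) 2 ν < ⊤ then
          eLpNorm (fun x => w' (z, x) - y x) 2 ν
        else edist 0 y := by
      ext z
      by_cases h : eLpNorm (fun x => w' (z, x)) 2 ν < ⊤
      · simp only [hU, h, ↓reduceDIte, ↓reduceIte]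
        rw [Lp.edist_def]
        refine eLpNorm_congr_ae ?_
        filter_upwards [MemLp.coeFn_toLp (f := fun x => w' (z, x))
          ⟨(hslm z).aestronglyMeasurable, h⟩] with x h1
        simp only [Pi.sub_apply, h1]
      · simp only [hU, h, ↓reduceDIte, ↓reduceIte]
    rw [e]
    exact Measurable.ite hgood (hmeas _ (Lp.stronglyMeasurable y)) measurable_const
  have hww2 : ∀ᵐ z ∂μ, (fun x => w (z, x)) =ᵐ[ν] fun x => w' (z, x) :=
    Measure.ae_ae_of_ae_prod hww'
  have hw'L : MemLp w' 2 (μ.prod ν) := hw.ae_eq hww'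
  have hlin : ∫⁻ z, eLpNorm (fun x => w' (z, x)) 2 ν ^ (2 : ℝ) ∂μ
      = eLpNorm w' 2 (μ.prod ν) ^ (2 : ℝ) := by
    rw [eLpNorm_eq_lintegral_rpow_enorm_toReal (by norm_num) (by norm_num)]
    simp only [heN, ENNReal.toReal_ofNat, ← ENNReal.rpow_mul]
    norm_num
    rw [lintegral_prod _ (by exact (hw'm.enorm.pow_const 2).aemeasurable)]
  have hfin : ∀ᵐ z ∂μ, eLpNorm (fun x => w' (z, x)) 2 ν < ⊤ := by
    have hm : Measurable fun z => eLpNorm (fun x => w' (z, x)) 2 ν ^ (2 : ℝ) := by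
      have := hmeas 0 stronglyMeasurable_zero
      simp only [Pi.zero_apply, sub_zero] at this
      exact this.pow_const _
    have := ae_lt_top hm (hlin ▸ (ENNReal.rpow_lt_top_of_nonneg (by norm_num) hw'L.2.ne).ne)
    filter_upwards [this] with z hz
    exact (ENNReal.rpow_lt_top_iff_of_pos (by norm_num)).mp hz
  have hUw : ∀ᵐ z ∂μ, U z =ᵐ[ν] fun x => w' (z, x) := by
    filter_upwards [hfin] with z hz
    simp only [hU, hz, ↓reduceDIte]
    exact MemLp.coeFn_toLp _
  have hnorm : eLpNorm U 2 μ = eLpNorm w 2 (μ.prod ν) := by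
    rw [eLpNorm_congr_ae hww', eLpNorm_eq_lintegral_rpow_enorm_toReal (by norm_num) (by norm_num)]
    have : ∫⁻ z, ‖U z‖ₑ ^ (2 : ℝ) ∂μ = eLpNorm w' 2 (μ.prod ν) ^ (2 : ℝ) := by
      rw [← hlin]
      refine lintegral_congr_ae ?_
      filter_upwards [hUw] with z hz
      rw [Lp.enorm_def, eLpNorm_congr_ae hz]
    simp only [ENNReal.toReal_ofNat]
    rw [this, ← ENNReal.rpow_mul]
    norm_num
  refine ⟨U, ⟨hUm.aestronglyMeasurable, hnorm ▸ hw.2⟩, ?_, hnorm⟩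
  filter_upwards [hUw, hww2] with z h1 h2 using h1.trans h2.symm

end Slices

theorem HalfSpaceQG.halfVol_eq_prod :
    halfVol = (volume.restrict (Ioi (0 : ℝ))).prod (volume : Measure Plane) := by
  rw [halfVol, halfSpace, Measure.volume_eq_prod, ← Measure.prod_restrict, Measure.restrict_univ]

/-! ### Frequency cut-offs and the transformed system -/

section Frequency

/-- Complex vector-valued square integrable functions on the plane. -/
abbrev L2Vec : Type := Lp CVec 2 (volume : Measure Plane)

theorem norm_mulOp_le {X E F : Type*} [MeasurableSpace X] {μ : Measure X}
    [NormedAddCommGroup E] [NormedSpace ℂ E] [NormedAddCommGroup F] [NormedSpace ℂ F]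
    {m : X → E →L[ℂ] F} (hm : MemLp m ⊤ μ) {K : ℝ} (hK : ∀ x, ‖m x‖ ≤ K) (v : Lp E 2 μ) :
    ‖mulOp m hm v‖ ≤ K * ‖v‖ := by
  refine Lp.norm_le_mul_norm_of_ae_le_mul ?_
  filter_upwards [coeFn_mulOp m hm v] with x hx
  rw [hx]
  exact ((m x).le_opNorm _).trans (mul_le_mul_of_nonneg_right (hK x) (norm_nonneg _))

theorem memLp_top_smul_const {E F : Type*}
    [NormedAddCommGroup E] [NormedSpace ℂ E] [NormedAddCommGroup F] [NormedSpace ℂ F]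
    {c : Plane → ℂ} (hc : Measurable c) {K : ℝ} (hK : ∀ x, ‖c x‖ ≤ K) (L : E →L[ℂ] F) :
    MemLp (fun x => c x • L) ⊤ (volume : Measure Plane) :=
  memLp_top_of_bound (hc.stronglyMeasurable.smul_const L).aestronglyMeasurable (K * ‖L‖)
    (.of_forall fun x => by
      rw [norm_smul]; exact mul_le_mul_of_nonneg_right (hK x) (norm_nonneg _))

theorem memLp_top_sum_smul_const {E F : Type*}
    [NormedAddCommGroup E] [NormedSpace ℂ E] [NormedAddCommGroup F] [NormedSpace ℂ F]
    {c : Fin 2 → Plane → ℂ} (hc : ∀ j, Measurable (c j)) {K : ℝ} (hK : ∀ j x, ‖c j x‖ ≤ K)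
    (L : Fin 2 → E →L[ℂ] F) :
    MemLp (fun x => ∑ j, c j x • L j) ⊤ (volume : Measure Plane) :=
  ((memLp_top_smul_const (hc 0) (hK 0) (L 0)).sub (memLp_top_smul_const (c := fun x => -c 1 x)
    (hc 1).neg (fun x => by rw [norm_neg]; exact hK 1 x) (L 1))).ae_eq
    (.of_forall fun x => by simp [Fin.sum_univ_two])

/-- Multiplication by a bounded scalar function on `L²(ℝ²; ℂ³)`. -/
noncomputable def scalarMul (c : Plane → ℂ) (hc : Measurable c) (hb : ∃ K : ℝ, ∀ x, ‖c x‖ ≤ K) :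
    L2Vec →L[ℂ] L2Vec :=
  mulOp (fun x => c x • ContinuousLinearMap.id ℂ CVec)
    (memLp_top_smul_const hc hb.choose_spec _)

theorem coeFn_scalarMul {c : Plane → ℂ} (hc : Measurable c) (hb : ∃ K : ℝ, ∀ x, ‖c x‖ ≤ K)
    (v : L2Vec) : scalarMul c hc hb v =ᵐ[volume] fun x => c x • v x :=
  coeFn_mulOp _ _ v

theorem norm_indicator_one_le {X : Type*} (B : Set X) :
    ∃ K : ℝ, ∀ x, ‖B.indicator (fun _ => (1 : ℂ)) x‖ ≤ K :=
  ⟨1, fun x => by by_cases h : x ∈ B <;> simp [h]⟩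

/-- The projection onto the frequencies in `B`. -/
noncomputable def freqCut (B : Set Plane) (hB : MeasurableSet B) : L2Vec →L[ℂ] L2Vec :=
  scalarMul (B.indicator fun _ => 1) (measurable_const.indicator hB) (norm_indicator_one_le B)

theorem coeFn_freqCut {B : Set Plane} (hB : MeasurableSet B) (v : L2Vec) :
    freqCut B hB v =ᵐ[volume] B.indicator v := by
  filter_upwards [coeFn_scalarMul (measurable_const.indicator hB) (norm_indicator_one_le B) v]
    with x hx
  rw [freqCut, hx]
  by_cases h : x ∈ B <;> simp [h]

theorem measurable_sqrt_norm_indicator {B : Set Plane} (hB : MeasurableSet B) :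
    Measurable (B.indicator fun x => ((Real.sqrt ‖x‖ : ℝ) : ℂ)) :=
  (by fun_prop : Measurable fun x : Plane => ((Real.sqrt ‖x‖ : ℝ) : ℂ)).indicator hB

theorem norm_sqrt_norm_indicator_le {B : Set Plane} {k : ℝ} (hk : ∀ x ∈ B, ‖x‖ ≤ k) :
    ∃ K : ℝ, ∀ x, ‖B.indicator (fun x => ((Real.sqrt ‖x‖ : ℝ) : ℂ)) x‖ ≤ K := by
  refine ⟨Real.sqrt k, fun x => ?_⟩
  by_cases h : x ∈ B
  · simpa [h, abs_of_nonneg (Real.sqrt_nonneg _)] using Real.sqrt_le_sqrt (hk x h)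
  · simp [h]

/-- The Fourier transform in the horizontal variables of the first order system satisfied by
`∇_λ Ψ`, tested with functions of the vertical variable. -/
structure IsFrequencySystem (lam : ℝ → ℝ) (U F : ℝ → L2Vec) (G : L2Vec) : Prop where
  memLp : MemLp U 2 (volume.restrict (Ioi 0))
  memLp_source : MemLp F 2 (volume.restrict (Ioi 0))
  div_eq : ∀ a : ℝ → ℝ, ContDiff ℝ ∞ a → HasCompactSupport a → ∀ᵐ ξ,
    ((∫ t in Ioi 0, deriv a t • U t) + (∫ t in Ioi 0, a t • F t) - a 0 • G) ξ 0
      = 2 * Real.pi * Complex.I * ∑ j : Fin 2, (ξ j : ℂ) * (∫ t in Ioi 0, a t • U t) ξ j.succ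
  vertical_eq : ∀ a : ℝ → ℝ, ContDiff ℝ ∞ a → HasCompactSupport a → tsupport a ⊆ Ioi 0 →
    ∀ j : Fin 2, ∀ᵐ ξ, (∫ t in Ioi 0, deriv a t • U t) ξ j.succ
      = -(2 * Real.pi * Complex.I * ((ξ j : ℂ) * (∫ t in Ioi 0, (a t * (lam t)⁻¹) • U t) ξ 0))
  curl_eq : ∀ a : ℝ → ℝ, ContDiff ℝ ∞ a → HasCompactSupport a → tsupport a ⊆ Ioi 0 →
    ∀ᵐ ξ, (ξ 0 : ℂ) * (∫ t in Ioi 0, a t • U t) ξ 2 = (ξ 1 : ℂ) * (∫ t in Ioi 0, a t • U t) ξ 1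

/-- The direction `ξ / |ξ|` of a frequency. -/
noncomputable def freqDir (j : Fin 2) (ξ : Plane) : ℂ := ((ξ j / ‖ξ‖ : ℝ) : ℂ)

theorem measurable_freqDir (j : Fin 2) : Measurable (freqDir j) := by
  unfold freqDir; fun_prop

theorem norm_freqDir_le (j : Fin 2) (ξ : Plane) : ‖freqDir j ξ‖ ≤ 1 := by
  rw [freqDir, Complex.norm_real, norm_div, norm_norm]
  exact div_le_one_of_le₀ (PiLp.norm_apply_le ξ j) (norm_nonneg _)

theorem Plane.norm_sq_eq (ξ : Plane) : ‖ξ‖ ^ 2 = ξ 0 ^ 2 + ξ 1 ^ 2 := by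
  rw [EuclideanSpace.real_norm_sq_eq, Fin.sum_univ_two]

theorem norm_smul_freqDir_sum_le (c : ℂ) (ξ : Plane) :
    ‖c * freqDir 0 ξ‖ ^ 2 + ‖c * freqDir 1 ξ‖ ^ 2 ≤ ‖c‖ ^ 2 := by
  simp only [norm_mul, freqDir, Complex.norm_real, norm_div, mul_pow, div_pow,
    Real.norm_eq_abs, sq_abs]
  rw [← mul_add, ← add_div, ← Plane.norm_sq_eq]
  exact mul_le_of_le_one_right (by positivity) (div_self_le_one _)

theorem norm_freqDir_sum_le (v : CVec) (ξ : Plane) :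
    ‖∑ j : Fin 2, freqDir j ξ * v j.succ‖ ≤ ‖v‖ := by
  have h1 : ‖freqDir 0 ξ‖ ^ 2 + ‖freqDir 1 ξ‖ ^ 2 ≤ 1 := by
    simpa using norm_smul_freqDir_sum_le 1 ξ
  have h2 : ‖v‖ ^ 2 = ‖v 0‖ ^ 2 + ‖v 1‖ ^ 2 + ‖v 2‖ ^ 2 := by
    rw [EuclideanSpace.norm_sq_eq, Fin.sum_univ_three]
  rw [Fin.sum_univ_two]
  refine (norm_add_le _ _).trans (abs_le_of_sq_le_sq' ?_ (norm_nonneg _)).2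
  rw [norm_mul, norm_mul, h2]
  simp only [Fin.succ_zero_eq_one, Fin.succ_one_eq_two]
  have h3 : (‖freqDir 0 ξ‖ * ‖v 1‖ + ‖freqDir 1 ξ‖ * ‖v 2‖) ^ 2
      ≤ (‖freqDir 0 ξ‖ ^ 2 + ‖freqDir 1 ξ‖ ^ 2) * (‖v 1‖ ^ 2 + ‖v 2‖ ^ 2) := by
    nlinarith [sq_nonneg (‖freqDir 0 ξ‖ * ‖v 2‖ - ‖freqDir 1 ξ‖ * ‖v 1‖)]
  nlinarith [sq_nonneg ‖v 0‖, sq_nonneg ‖v 1‖, sq_nonneg ‖v 2‖]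

end Frequency

/-! ### Symbols for the vertical and longitudinal components -/

section FrequencyEstimate

/-- Complex-valued square integrable functions on the plane. -/
abbrev L2Scalar : Type := Lp ℂ 2 (volume : Measure Plane)

/-- The symbol of the vertical component. -/
noncomputable def vertSymbol (B : Set Plane) (ξ : Plane) : CVec →L[ℂ] ℂ :=
  B.indicator (fun _ => (1 : ℂ)) ξ • EuclideanSpace.proj 0

/-- The symbol of the longitudinal part of the horizontal components. -/
noncomputable def horSymbol (B : Set Plane) (ξ : Plane) : CVec →L[ℂ] ℂ :=
  ∑ j : Fin 2, B.indicator (fun ξ => -Complex.I * freqDir j ξ) ξ • EuclideanSpace.proj j.succ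

/-- The symbol of `2π|ξ|`, restricted to the frequencies in `B`. -/
noncomputable def absSymbol (B : Set Plane) (ξ : Plane) : ℂ →L[ℂ] ℂ :=
  B.indicator (fun ξ => ((2 * Real.pi * ‖ξ‖ : ℝ) : ℂ)) ξ • ContinuousLinearMap.id ℂ ℂ

/-- The symbol of the curl of the horizontal components. -/
noncomputable def curlSymbol (B : Set Plane) (ξ : Plane) : CVec →L[ℂ] ℂ :=
  B.indicator (fun ξ => (ξ 0 : ℂ)) ξ • EuclideanSpace.proj 2
    - B.indicator (fun ξ => (ξ 1 : ℂ)) ξ • EuclideanSpace.proj 1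

/-- The embedding of scalars as vertical vectors. -/
noncomputable def vertEmbed (_ : Plane) : ℂ →L[ℂ] CVec :=
  (1 : ℂ) • ContinuousLinearMap.toSpanSingleton ℂ (EuclideanSpace.single 0 1)

/-- The embedding of scalars as longitudinal horizontal vectors. -/
noncomputable def horEmbed (ξ : Plane) : ℂ →L[ℂ] CVec :=
  ∑ j : Fin 2, (Complex.I * freqDir j ξ) •
    ContinuousLinearMap.toSpanSingleton ℂ (EuclideanSpace.single j.succ 1)

theorem memLp_vertSymbol {B : Set Plane} (hB : MeasurableSet B) : MemLp (vertSymbol B) ⊤ volume :=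
  memLp_top_smul_const (measurable_const.indicator hB) (norm_indicator_one_le B).choose_spec _

theorem memLp_horSymbol {B : Set Plane} (hB : MeasurableSet B) : MemLp (horSymbol B) ⊤ volume :=
  memLp_top_sum_smul_const (fun j => ((measurable_freqDir j).const_mul _).indicator hB) (K := 1)
    (fun j x => by
      by_cases h : x ∈ B
      · simpa [h] using norm_freqDir_le j x
      · simp [h]) _

theorem memLp_absSymbol {B : Set Plane} (hB : MeasurableSet B) {k : ℝ} (hk : ∀ x ∈ B, ‖x‖ ≤ k) :
    MemLp (absSymbol B) ⊤ volume := by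
  refine memLp_top_smul_const (Measurable.indicator (by fun_prop) hB) (K := |2 * Real.pi * k|)
    (fun x => ?_) _
  by_cases h : x ∈ B
  · simp only [h, indicator_of_mem, Complex.norm_real, Real.norm_eq_abs]
    exact abs_le_abs_of_nonneg (by positivity)
      (mul_le_mul_of_nonneg_left (hk x h) (by positivity))
  · simp [h]

theorem memLp_curlSymbol {B : Set Plane} (hB : MeasurableSet B) {k : ℝ} (hk : ∀ x ∈ B, ‖x‖ ≤ k) :
    MemLp (curlSymbol B) ⊤ volume := by
  have key : ∀ j : Fin 2, ∀ x, ‖B.indicator (fun ξ : Plane => (ξ j : ℂ)) x‖ ≤ |k| := by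
    intro j x
    by_cases h : x ∈ B
    · simp only [h, indicator_of_mem, Complex.norm_real]
      exact ((PiLp.norm_apply_le x j).trans (hk x h)).trans (le_abs_self k)
    · simp [h]
  exact (memLp_top_smul_const (Measurable.indicator (by fun_prop) hB) (key 0) _).sub
    (memLp_top_smul_const (Measurable.indicator (by fun_prop) hB) (key 1) _)

theorem memLp_vertEmbed : MemLp vertEmbed ⊤ volume :=
  memLp_top_smul_const measurable_const (K := 1) (fun _ => by simp) _

theorem memLp_horEmbed : MemLp horEmbed ⊤ volume :=
  memLp_top_sum_smul_const (fun j => (measurable_freqDir j).const_mul _) (K := 1)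
    (fun j x => by simpa using norm_freqDir_le j x) _

theorem vertSymbol_apply (B : Set Plane) (ξ : Plane) (v : CVec) :
    vertSymbol B ξ v = B.indicator (fun _ => v 0) ξ := by
  by_cases h : ξ ∈ B <;> simp [vertSymbol, h]

theorem horSymbol_apply (B : Set Plane) (ξ : Plane) (v : CVec) : horSymbol B ξ v
    = B.indicator (fun ξ => -Complex.I * ∑ j : Fin 2, freqDir j ξ * v j.succ) ξ := by
  by_cases h : ξ ∈ B <;> simp [horSymbol, h, mul_add, mul_assoc]

theorem absSymbol_apply (B : Set Plane) (ξ : Plane) (c : ℂ) : absSymbol B ξ c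
    = B.indicator (fun ξ => ((2 * Real.pi * ‖ξ‖ : ℝ) : ℂ) * c) ξ := by
  by_cases h : ξ ∈ B <;> simp [absSymbol, h]

theorem curlSymbol_apply (B : Set Plane) (ξ : Plane) (v : CVec) : curlSymbol B ξ v
    = B.indicator (fun ξ => (ξ 0 : ℂ) * v 2 - (ξ 1 : ℂ) * v 1) ξ := by
  by_cases h : ξ ∈ B <;> simp [curlSymbol, h]

theorem vertEmbed_apply (ξ : Plane) (c : ℂ) : vertEmbed ξ c = WithLp.toLp 2 ![c, 0, 0] := by
  ext i; fin_cases i <;> simp [vertEmbed]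

theorem horEmbed_apply (ξ : Plane) (c : ℂ) : horEmbed ξ c = WithLp.toLp 2
    ![0, Complex.I * freqDir 0 ξ * c, Complex.I * freqDir 1 ξ * c] := by
  ext i; fin_cases i <;> simp [horEmbed, Fin.sum_univ_two]

theorem norm_vertEmbed_le (ξ : Plane) : ‖vertEmbed ξ‖ ≤ 1 := by
  refine ContinuousLinearMap.opNorm_le_bound _ zero_le_one fun c => ?_
  rw [vertEmbed_apply, one_mul, EuclideanSpace.norm_eq]
  simp [Fin.sum_univ_three]

theorem norm_horEmbed_le (ξ : Plane) : ‖horEmbed ξ‖ ≤ 1 := by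
  refine ContinuousLinearMap.opNorm_le_bound _ zero_le_one fun c => ?_
  rw [horEmbed_apply, one_mul]
  refine (abs_le_of_sq_le_sq' ?_ (norm_nonneg _)).2
  rw [EuclideanSpace.norm_sq_eq, Fin.sum_univ_three]
  simpa [mul_comm, mul_assoc, mul_left_comm] using norm_smul_freqDir_sum_le c ξ

theorem freqDir_mul_norm {ξ : Plane} (j : Fin 2) : (‖ξ‖ : ℂ) * freqDir j ξ = (ξ j : ℂ) := by
  rw [freqDir, ← Complex.ofReal_mul]
  rcases eq_or_ne ξ 0 with h | h
  · simp [h]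
  · rw [mul_div_cancel₀ _ (norm_ne_zero_iff.mpr h)]

theorem sum_coord_mul_freqDir (ξ : Plane) : ∑ j : Fin 2, (ξ j : ℂ) * freqDir j ξ = (‖ξ‖ : ℂ) := by
  rcases eq_or_ne ξ 0 with h | h
  · simp [h]
  · have h0 : ‖ξ‖ ≠ 0 := norm_ne_zero_iff.mpr h
    simp only [freqDir, Fin.sum_univ_two, ← Complex.ofReal_mul, ← Complex.ofReal_add]
    congr 1
    field_simp
    rw [Plane.norm_sq_eq]

/-- A horizontally curl-free vector is the sum of its vertical and longitudinal parts. -/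
theorem vertEmbed_add_horEmbed_eq {B : Set Plane} {ξ : Plane} (hξ : ξ ≠ 0) {v : CVec}
    (hv : curlSymbol B ξ v = 0) :
    vertEmbed ξ (vertSymbol B ξ v) + horEmbed ξ (horSymbol B ξ v) = B.indicator (fun _ => v) ξ := by
  rw [vertEmbed_apply, horEmbed_apply, vertSymbol_apply, horSymbol_apply]
  rw [curlSymbol_apply] at hv
  by_cases h : ξ ∈ B
  · simp only [h, indicator_of_mem] at hv ⊢
    have h0 : (‖ξ‖ : ℂ) ≠ 0 := by exact_mod_cast norm_ne_zero_iff.mpr hξ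
    have h2 : freqDir 0 ξ ^ 2 + freqDir 1 ξ ^ 2 = 1 := by
      have := sum_coord_mul_freqDir ξ
      rw [Fin.sum_univ_two, ← freqDir_mul_norm, ← freqDir_mul_norm] at this
      exact mul_left_cancel₀ h0 (by linear_combination this)
    have h3 : freqDir 0 ξ * v 2 - freqDir 1 ξ * v 1 = 0 := by
      rw [← freqDir_mul_norm, ← freqDir_mul_norm] at hv
      exact mul_left_cancel₀ h0 (by linear_combination hv)
    ext i
    fin_cases i
    · simp
    · simp [Fin.sum_univ_two]
      linear_combination (-freqDir 0 ξ ^ 2 * v 1 - freqDir 0 ξ * freqDir 1 ξ * v 2) * Complex.I_sq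
        + v 1 * h2 + freqDir 1 ξ * h3
    · simp [Fin.sum_univ_two]
      linear_combination (-freqDir 1 ξ ^ 2 * v 2 - freqDir 0 ξ * freqDir 1 ξ * v 1) * Complex.I_sq
        + v 2 * h2 - freqDir 0 ξ * h3
  · simp only [h, not_false_eq_true, indicator_of_notMem]
    ext i
    fin_cases i <;> simp

/-- The symbol is a nonnegative real scalar, so both properties hold frequency by frequency. -/
theorem absOp_symm_nonneg {B : Set Plane} (hB : MeasurableSet B) {k : ℝ} (hk : ∀ x ∈ B, ‖x‖ ≤ k) :
    (∀ x y : L2Scalar, inner ℝ (mulOp (absSymbol B) (memLp_absSymbol hB hk) x) y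
      = inner ℝ x (mulOp (absSymbol B) (memLp_absSymbol hB hk) y)) ∧
    ∀ x : L2Scalar, 0 ≤ inner ℝ (mulOp (absSymbol B) (memLp_absSymbol hB hk) x) x := by
  constructor
  · intro x y
    rw [L2.inner_def, L2.inner_def]
    refine integral_congr_ae ?_
    filter_upwards [coeFn_mulOp _ (memLp_absSymbol hB hk) x,
      coeFn_mulOp _ (memLp_absSymbol hB hk) y] with ξ h1 h2
    rw [h1, h2, absSymbol_apply, absSymbol_apply]
    by_cases h : ξ ∈ B
    · simp only [h, indicator_of_mem, ← Complex.real_smul, real_inner_smul_left,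
        real_inner_smul_right]
    · simp [h]
  · intro x
    rw [L2.inner_def]
    refine integral_nonneg_of_ae ?_
    filter_upwards [coeFn_mulOp _ (memLp_absSymbol hB hk) x] with ξ h1
    rw [h1, absSymbol_apply]
    by_cases h : ξ ∈ B
    · simp only [h, indicator_of_mem, ← Complex.real_smul, real_inner_smul_left]
      exact mul_nonneg (by positivity) real_inner_self_nonneg
    · simp [h]

end FrequencyEstimate

/-! ### Reduction to the abstract system on bounded frequencies -/

section FrequencyRep

theorem integral_smul_clm_comm {X E F : Type*} [MeasurableSpace X] {μ : Measure X}
    [NormedAddCommGroup E] [NormedSpace ℝ E] [NormedSpace ℂ E] [IsScalarTower ℝ ℂ E]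
    [CompleteSpace E] [NormedAddCommGroup F] [NormedSpace ℝ F] [NormedSpace ℂ F]
    [IsScalarTower ℝ ℂ F] [CompleteSpace F]
    (L : E →L[ℂ] F) {a : X → ℝ} {u : X → E} (h : Integrable (fun t => a t • u t) μ) :
    L (∫ t, a t • u t ∂μ) = ∫ t, a t • L (u t) ∂μ := by
  have := (L.restrictScalars ℝ).integral_comp_comm h
  simp only [map_smul, ContinuousLinearMap.coe_restrictScalars'] at this
  exact this.symm

/-- The real-linear operator of multiplication by `2π|ξ|` on the frequencies in `B`. -/
noncomputable def absOp {B : Set Plane} (hB : MeasurableSet B) {k : ℝ} (hk : ∀ x ∈ B, ‖x‖ ≤ k) :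
    L2Scalar →L[ℝ] L2Scalar :=
  (mulOp (absSymbol B) (memLp_absSymbol hB hk)).restrictScalars ℝ

variable {lam : ℝ → ℝ} {U F : ℝ → L2Vec} {G : L2Vec}

/-- The factor −i in the longitudinal symbol turns 2πi ξ·û_h into −2π|ξ| p, so the divergence
equation reads q' = f + R p. Test functions that do not vanish at 0 carry the normal trace into the
equation. -/
theorem IsFrequencySystem.vert_weak (h : IsFrequencySystem lam U F G) {B : Set Plane}
    (hB : MeasurableSet B) {k : ℝ} (hk : ∀ x ∈ B, ‖x‖ ≤ k) {a : ℝ → ℝ} (ha : ContDiff ℝ ∞ a)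
    (hac : HasCompactSupport a) :
    ∫ t in Ioi 0, deriv a t • mulOp _ (memLp_vertSymbol hB) (U t)
      = -(∫ t in Ioi 0, a t • (mulOp _ (memLp_vertSymbol hB) (F t)
          + absOp hB hk (mulOp _ (memLp_horSymbol hB) (U t))))
        + a 0 • mulOp _ (memLp_vertSymbol hB) G := by
  have hac' : HasCompactSupport (deriv a) := hac.deriv
  have hca : Continuous (deriv a) := ha.continuous_deriv (by simp)
  have i1 := integrable_compactSupport_smul hca hac' h.memLp
  have i2 := integrable_compactSupport_smul ha.continuous hac h.memLp
  have i3 := integrable_compactSupport_smul ha.continuous hac h.memLp_source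
  set Y := ∫ t in Ioi 0, a t • U t with hY
  have key : mulOp _ (memLp_vertSymbol hB)
      ((∫ t in Ioi 0, deriv a t • U t) + (∫ t in Ioi 0, a t • F t) - a 0 • G)
      = -absOp hB hk (mulOp _ (memLp_horSymbol hB) Y) := by
    refine Lp.ext ?_
    filter_upwards [h.div_eq a ha hac, coeFn_mulOp _ (memLp_vertSymbol hB)
      ((∫ t in Ioi 0, deriv a t • U t) + (∫ t in Ioi 0, a t • F t) - a 0 • G),
      Lp.coeFn_neg (absOp hB hk (mulOp _ (memLp_horSymbol hB) Y)),
      coeFn_mulOp _ (memLp_absSymbol hB hk) (mulOp _ (memLp_horSymbol hB) Y),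
      coeFn_mulOp _ (memLp_horSymbol hB) Y] with ξ h1 h2 h3 h4 h5
    have h4' : (absOp hB hk (mulOp _ (memLp_horSymbol hB) Y)) ξ
        = absSymbol B ξ ((mulOp _ (memLp_horSymbol hB) Y) ξ) := h4
    rw [h2, h3, Pi.neg_apply, h4', h5, vertSymbol_apply, absSymbol_apply, horSymbol_apply, h1]
    by_cases hξ : ξ ∈ B
    · simp only [hξ, indicator_of_mem, Fin.sum_univ_two]
      rw [← freqDir_mul_norm, ← freqDir_mul_norm]
      push_cast
      ring
    · simp [hξ]
  rw [map_sub, map_add, integral_smul_clm_comm _ i1, integral_smul_clm_comm _ i3,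
    (mulOp _ (memLp_vertSymbol hB)).map_smul_of_tower] at key
  have e2 : absOp hB hk (mulOp _ (memLp_horSymbol hB) Y)
      = ∫ t in Ioi 0, a t • absOp hB hk (mulOp _ (memLp_horSymbol hB) (U t)) := by
    have := integral_smul_clm_comm ((mulOp (absSymbol B) (memLp_absSymbol hB hk)).comp
      (mulOp _ (memLp_horSymbol hB))) i2
    exact this
  have i4 : Integrable (fun t => a t • absOp hB hk (mulOp _ (memLp_horSymbol hB) (U t)))
      (volume.restrict (Ioi 0)) :=
    integrable_compactSupport_smul ha.continuous hac
      ((absOp hB hk).comp_memLp' ((mulOp _ (memLp_horSymbol hB)).comp_memLp' h.memLp))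
  have i5 : Integrable (fun t => a t • mulOp _ (memLp_vertSymbol hB) (F t))
      (volume.restrict (Ioi 0)) :=
    integrable_compactSupport_smul ha.continuous hac
      ((mulOp _ (memLp_vertSymbol hB)).comp_memLp' h.memLp_source)
  simp only [smul_add]
  rw [integral_add i5 i4, ← e2]
  rw [sub_eq_iff_eq_add] at key
  rw [eq_sub_of_add_eq key]
  abel

/-- The longitudinal part of ∂_z û_h = 2πi ξ λ⁻¹ û₀ is p' = λ⁻¹ R q. The bound on λ⁻¹ is needed only
to make the integrals converge. -/
theorem IsFrequencySystem.hor_weak (h : IsFrequencySystem lam U F G)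
    {Lam : ℝ} (hLam : 1 ≤ Lam) (hlm : AEMeasurable lam (volume.restrict (Ioi 0)))
    (hlam : ∀ᵐ z ∂(volume.restrict (Ioi (0 : ℝ))), 1 / Lam ≤ lam z ∧ lam z ≤ Lam)
    {B : Set Plane} (hB : MeasurableSet B) {k : ℝ} (hk : ∀ x ∈ B, ‖x‖ ≤ k) {a : ℝ → ℝ}
    (ha : ContDiff ℝ ∞ a) (hac : HasCompactSupport a) (has : tsupport a ⊆ Ioi 0) :
    ∫ t in Ioi 0, deriv a t • mulOp _ (memLp_horSymbol hB) (U t)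
      = -∫ t in Ioi 0, a t • ((lam t)⁻¹ • absOp hB hk (mulOp _ (memLp_vertSymbol hB) (U t))) := by
  have hac' : HasCompactSupport (deriv a) := hac.deriv
  have hca : Continuous (deriv a) := ha.continuous_deriv (by simp)
  have i1 := integrable_compactSupport_smul hca hac' h.memLp
  have hlU : MemLp (fun t => (lam t)⁻¹ • U t) 2 (volume.restrict (Ioi 0)) := by
    refine MemLp.of_le_mul (c := Lam) h.memLp (hlm.inv.aestronglyMeasurable.smul h.memLp.1) ?_
    filter_upwards [hlam] with t ht
    have h0 : 0 < lam t := lt_of_lt_of_le (by positivity) ht.1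
    rw [norm_smul, norm_inv, Real.norm_of_nonneg h0.le]
    refine mul_le_mul_of_nonneg_right ?_ (norm_nonneg _)
    rw [inv_le_comm₀ h0 (by positivity), ← one_div]
    exact ht.1
  have i2 : Integrable (fun t => (a t * (lam t)⁻¹) • U t) (volume.restrict (Ioi 0)) := by
    simpa only [mul_smul] using integrable_compactSupport_smul ha.continuous hac hlU
  set Z := ∫ t in Ioi 0, (a t * (lam t)⁻¹) • U t with hZ
  have key : mulOp _ (memLp_horSymbol hB) (∫ t in Ioi 0, deriv a t • U t)
      = -absOp hB hk (mulOp _ (memLp_vertSymbol hB) Z) := by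
    refine Lp.ext ?_
    filter_upwards [h.vertical_eq a ha hac has 0, h.vertical_eq a ha hac has 1,
      coeFn_mulOp _ (memLp_horSymbol hB) (∫ t in Ioi 0, deriv a t • U t),
      Lp.coeFn_neg (absOp hB hk (mulOp _ (memLp_vertSymbol hB) Z)),
      coeFn_mulOp _ (memLp_absSymbol hB hk) (mulOp _ (memLp_vertSymbol hB) Z),
      coeFn_mulOp _ (memLp_vertSymbol hB) Z] with ξ h0 h1 h2 h3 h4 h5
    have h4' : (absOp hB hk (mulOp _ (memLp_vertSymbol hB) Z)) ξ
        = absSymbol B ξ ((mulOp _ (memLp_vertSymbol hB) Z) ξ) := h4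
    rw [h2, h3, Pi.neg_apply, h4', h5, vertSymbol_apply, absSymbol_apply, horSymbol_apply]
    by_cases hξ : ξ ∈ B
    · simp only [hξ, indicator_of_mem]
      rw [Fin.sum_univ_two, h0, h1, ← hZ]
      have e := sum_coord_mul_freqDir ξ
      rw [Fin.sum_univ_two] at e
      push_cast
      rw [← e]
      linear_combination (2 * Real.pi * ((ξ 0 : ℂ) * freqDir 0 ξ + (ξ 1 : ℂ) * freqDir 1 ξ) * Z ξ 0)
        * Complex.I_sq
    · simp [hξ]
  rw [integral_smul_clm_comm _ i1] at key
  rw [key]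
  congr 1
  have := integral_smul_clm_comm ((mulOp (absSymbol B) (memLp_absSymbol hB hk)).comp
      (mulOp _ (memLp_vertSymbol hB))) i2
  rw [show absOp hB hk (mulOp _ (memLp_vertSymbol hB) Z) = _ from this]
  simp only [mul_smul]
  rfl

/-- The exceptional null set of frequencies depends on the test function. The identity is therefore
read in L²(ℝ²), and the fundamental lemma is applied to the L²-valued function of z. Boundedness of
B makes the curl a bounded multiplier. -/
theorem IsFrequencySystem.curl_eq_zero (h : IsFrequencySystem lam U F G)
    {B : Set Plane} (hB : MeasurableSet B) {k : ℝ} (hk : ∀ x ∈ B, ‖x‖ ≤ k) :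
    ∀ᵐ t ∂(volume.restrict (Ioi (0 : ℝ))), mulOp _ (memLp_curlSymbol hB hk) (U t) = 0 := by
  set C := mulOp _ (memLp_curlSymbol hB hk)
  have hCU : MemLp (fun t => C (U t)) 2 (volume.restrict (Ioi 0)) := C.comp_memLp' h.memLp
  have key := isOpen_Ioi.ae_eq_zero_of_integral_contDiff_smul_eq_zero (μ := volume)
    (U := Ioi (0 : ℝ)) (f := fun t => C (U t))
    (locallyIntegrableOn_of_locallyIntegrable_restrict (hCU.locallyIntegrable (by norm_num))) ?_
  · rw [ae_restrict_iff' measurableSet_Ioi]; exact key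
  intro a ha hac has
  rw [← setIntegral_eq_integral_of_forall_compl_eq_zero (s := Ioi 0) fun t ht => by
      rw [image_eq_zero_of_notMem_tsupport fun h => ht (has h), zero_smul],
    ← integral_smul_clm_comm C (integrable_compactSupport_smul ha.continuous hac h.memLp)]
  refine Lp.ext ?_
  filter_upwards [h.curl_eq a ha hac has, coeFn_mulOp _ (memLp_curlSymbol hB hk)
    (∫ t in Ioi 0, a t • U t), Lp.coeFn_zero ℂ 2 (volume : Measure Plane)] with ξ h1 h2 h3
  rw [h2, h3, curlSymbol_apply]
  by_cases hξ : ξ ∈ B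
  · simp only [hξ, indicator_of_mem, h1, sub_self, Pi.zero_apply]
  · simp [hξ]

end FrequencyRep

/-! ### Estimates for the full field on bounded frequencies -/

section FrequencyRep

variable {lam : ℝ → ℝ} {U F : ℝ → L2Vec} {G : L2Vec}

theorem norm_mulOp_le_freqCut {B : Set Plane} (hB : MeasurableSet B) {m : Plane → CVec →L[ℂ] ℂ}
    (hm : MemLp m ⊤ volume) (h : ∀ ξ v, ‖m ξ v‖ ≤ ‖B.indicator (fun _ => v) ξ‖) (v : L2Vec) :
    ‖mulOp m hm v‖ ≤ ‖freqCut B hB v‖ := by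
  refine Lp.norm_le_norm_of_ae_le ?_
  filter_upwards [coeFn_mulOp m hm v, coeFn_freqCut hB v] with ξ h1 h2
  rw [h1, h2]
  exact h ξ (v ξ)

theorem norm_vertSymbol_apply_le (B : Set Plane) (ξ : Plane) (v : CVec) :
    ‖vertSymbol B ξ v‖ ≤ ‖B.indicator (fun _ => v) ξ‖ := by
  rw [vertSymbol_apply]
  by_cases h : ξ ∈ B
  · simpa [h] using PiLp.norm_apply_le v 0
  · simp [h]

theorem norm_horSymbol_apply_le (B : Set Plane) (ξ : Plane) (v : CVec) :
    ‖horSymbol B ξ v‖ ≤ ‖B.indicator (fun _ => v) ξ‖ := by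
  rw [horSymbol_apply]
  by_cases h : ξ ∈ B
  · simpa only [h, indicator_of_mem, norm_mul, norm_neg, Complex.norm_I, one_mul] using
      norm_freqDir_sum_le v ξ
  · simp [h]

theorem norm_sq_vertEmbed_add_horEmbed_le (ξ : Plane) (x y : ℂ) :
    ‖vertEmbed ξ x + horEmbed ξ y‖ ^ 2 ≤ ‖y‖ ^ 2 + ‖x‖ ^ 2 := by
  have h3 := norm_smul_freqDir_sum_le y ξ
  rw [vertEmbed_apply, horEmbed_apply, EuclideanSpace.norm_sq_eq, Fin.sum_univ_three]
  simp only [norm_mul] at h3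
  simp
  linarith

/-- The quantity that controls the frequencies in `B`. -/
noncomputable def freqEnergy (U F : ℝ → L2Vec) (G : L2Vec) (B : Set Plane) (hB : MeasurableSet B) :
    ℝ :=
  (∫ t in Ioi 0, ‖freqCut B hB (U t)‖ ^ 2) + (∫ t in Ioi 0, ‖freqCut B hB (F t)‖ ^ 2)
    + ‖freqCut B hB G‖ ^ 2

/-- A curl-free vector has no transverse part, so |v|² is at most the sum of the squares of its
vertical and longitudinal components. The weight |ξ| is at most the symbol 2π|ξ| of R. -/
theorem norm_sq_sqrtMul_le {B : Set Plane} (hB : MeasurableSet B) {k : ℝ} (hk : ∀ x ∈ B, ‖x‖ ≤ k)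
    {v : L2Vec} (hv : mulOp _ (memLp_curlSymbol hB hk) v = 0) :
    ‖scalarMul _ (measurable_sqrt_norm_indicator hB) (norm_sqrt_norm_indicator_le hk) v‖ ^ 2
      ≤ inner ℝ (absOp hB hk (mulOp _ (memLp_horSymbol hB) v)) (mulOp _ (memLp_horSymbol hB) v)
        + inner ℝ (absOp hB hk (mulOp _ (memLp_vertSymbol hB) v))
          (mulOp _ (memLp_vertSymbol hB) v) := by
  rw [norm_sq_eq_integral_norm_sq, L2.inner_def, L2.inner_def, ← integral_add
    (L2.integrable_inner _ _) (L2.integrable_inner _ _)]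
  refine integral_mono_ae ((Lp.memLp _).integrable_norm_pow (by norm_num))
    ((L2.integrable_inner _ _).add (L2.integrable_inner _ _)) ?_
  have hne : ∀ᵐ ξ : Plane, ξ ≠ 0 := by
    simp [ae_iff, measure_singleton]
  filter_upwards [hne, hv ▸ coeFn_mulOp _ (memLp_curlSymbol hB hk) v,
    Lp.coeFn_zero ℂ 2 (volume : Measure Plane),
    coeFn_scalarMul (measurable_sqrt_norm_indicator hB) (norm_sqrt_norm_indicator_le hk) v,
    coeFn_mulOp _ (memLp_horSymbol hB) v, coeFn_mulOp _ (memLp_vertSymbol hB) v,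
    coeFn_mulOp _ (memLp_absSymbol hB hk) (mulOp _ (memLp_horSymbol hB) v),
    coeFn_mulOp _ (memLp_absSymbol hB hk) (mulOp _ (memLp_vertSymbol hB) v)]
    with ξ h0 hc hz hs hh hw hah haw
  have hah' : (absOp hB hk (mulOp _ (memLp_horSymbol hB) v)) ξ
      = absSymbol B ξ ((mulOp _ (memLp_horSymbol hB) v) ξ) := hah
  have haw' : (absOp hB hk (mulOp _ (memLp_vertSymbol hB) v)) ξ
      = absSymbol B ξ ((mulOp _ (memLp_vertSymbol hB) v) ξ) := haw
  rw [hz, Pi.zero_apply] at hc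
  have hsum := vertEmbed_add_horEmbed_eq h0 hc.symm
  simp only [hs, hah', haw', hh, hw]
  by_cases hξ : ξ ∈ B
  · rw [absSymbol_apply, absSymbol_apply]
    simp only [hξ, indicator_of_mem, ← Complex.real_smul, real_inner_smul_left,
      real_inner_self_eq_norm_sq] at hsum ⊢
    have h2 : ‖v ξ‖ ^ 2 ≤ ‖horSymbol B ξ (v ξ)‖ ^ 2 + ‖vertSymbol B ξ (v ξ)‖ ^ 2 := by
      have := norm_sq_vertEmbed_add_horEmbed_le ξ (vertSymbol B ξ (v ξ)) (horSymbol B ξ (v ξ))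
      rwa [hsum] at this
    rw [norm_smul, mul_pow, Complex.norm_real, Real.norm_eq_abs, sq_abs,
      Real.sq_sqrt (norm_nonneg _), ← mul_add]
    have hpi : ‖ξ‖ ≤ 2 * Real.pi * ‖ξ‖ :=
      le_mul_of_one_le_left (norm_nonneg _) (by linarith [Real.pi_gt_three])
    exact mul_le_mul hpi h2 (by positivity) (by positivity)
  · simp [hξ, absSymbol_apply]

set_option maxHeartbeats 1000000 in
-- The abstract estimate gives continuous P and Q, and the field is rebuilt as the vertical
-- embedding of Q plus the longitudinal embedding of P. The bounds involve only the data at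
-- frequencies in B and not the radius k, so they survive the removal of the cut-off.
theorem IsFrequencySystem.exists_rep (h : IsFrequencySystem lam U F G)
    {Lam : ℝ} (hLam : 1 ≤ Lam) (hlm : AEMeasurable lam (volume.restrict (Ioi 0)))
    (hlam : ∀ᵐ z ∂(volume.restrict (Ioi (0 : ℝ))), 1 / Lam ≤ lam z ∧ lam z ≤ Lam)
    {B : Set Plane} (hB : MeasurableSet B) {k : ℝ} (hk : ∀ x ∈ B, ‖x‖ ≤ k) :
    ∃ V : ℝ → L2Vec, ContinuousOn V (Ici 0) ∧
      (∀ᵐ z ∂(volume.restrict (Ioi (0 : ℝ))), V z = freqCut B hB (U z)) ∧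
      (∀ᵐ ξ, V 0 ξ 0 = -(freqCut B hB G) ξ 0) ∧
      (∀ z, 0 ≤ z → ‖V z‖ ^ 2 ≤ 6 * Lam ^ 2 * freqEnergy U F G B hB) ∧
      ∫ t in Ioi 0, ‖scalarMul _ (measurable_sqrt_norm_indicator hB)
        (norm_sqrt_norm_indicator_le hk) (U t)‖ ^ 2 ≤ Lam ^ 2 * freqEnergy U F G B hB := by
  set μ := volume.restrict (Ioi (0 : ℝ)) with hμ
  set vert := mulOp _ (memLp_vertSymbol hB) with hvert
  set hor := mulOp _ (memLp_horSymbol hB) with hhor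
  have hp : MemLp (fun t => hor (U t)) 2 μ := hor.comp_memLp' h.memLp
  have hq : MemLp (fun t => vert (U t)) 2 μ := vert.comp_memLp' h.memLp
  have hf : MemLp (fun t => vert (F t)) 2 μ := vert.comp_memLp' h.memLp_source
  have hcU : MemLp (fun t => freqCut B hB (U t)) 2 μ := (freqCut B hB).comp_memLp' h.memLp
  have hcF : MemLp (fun t => freqCut B hB (F t)) 2 μ := (freqCut B hB).comp_memLp' h.memLp_source
  obtain ⟨P, Q, hPc, hQc, hPp, hQq, hQ0, E, hE, hS, hPb, hQb⟩ :=
    exists_continuous_rep_energy_bound (R := absOp hB hk) (absOp_symm_nonneg hB hk).1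
      (absOp_symm_nonneg hB hk).2 hLam hlm hlam hp hq hf (vert G)
      (fun a ha hac => h.vert_weak hB hk ha hac)
      (fun a ha hac has => h.hor_weak hLam hlm hlam hB hk ha hac has)
  have hcurl := h.curl_eq_zero hB hk
  have hvn : ∀ v, ‖vert v‖ ≤ ‖freqCut B hB v‖ :=
    norm_mulOp_le_freqCut hB _ (norm_vertSymbol_apply_le B)
  have hhn : ∀ v, ‖hor v‖ ≤ ‖freqCut B hB v‖ :=
    norm_mulOp_le_freqCut hB _ (norm_horSymbol_apply_le B)
  have hmono : ∀ {u w : ℝ → ℝ}, Integrable u μ → Integrable w μ → (∀ t, u t ≤ w t) →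
      ∫ t, u t ∂μ ≤ ∫ t, w t ∂μ := fun hu hw huw => integral_mono hu hw huw
  have hsq : ∀ {x y : ℝ}, 0 ≤ x → x ≤ y → x ^ 2 ≤ y ^ 2 := fun h0 hxy =>
    pow_le_pow_left₀ h0 hxy 2
  set N := freqEnergy U F G B hB with hN
  have nU : 0 ≤ ∫ t, ‖freqCut B hB (U t)‖ ^ 2 ∂μ := integral_nonneg fun t => by positivity
  have nF : 0 ≤ ∫ t, ‖freqCut B hB (F t)‖ ^ 2 ∂μ := integral_nonneg fun t => by positivity
  have nG : 0 ≤ ‖freqCut B hB G‖ ^ 2 := by positivity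
  have bp : ∫ t, ‖hor (U t)‖ ^ 2 ∂μ ≤ ∫ t, ‖freqCut B hB (U t)‖ ^ 2 ∂μ :=
    hmono (hp.integrable_norm_pow (by norm_num)) (hcU.integrable_norm_pow (by norm_num))
      fun t => hsq (norm_nonneg _) (hhn _)
  have bq : ∫ t, ‖vert (U t)‖ ^ 2 ∂μ ≤ ∫ t, ‖freqCut B hB (U t)‖ ^ 2 ∂μ :=
    hmono (hq.integrable_norm_pow (by norm_num)) (hcU.integrable_norm_pow (by norm_num))
      fun t => hsq (norm_nonneg _) (hvn _)
  have bf : ∫ t, ‖vert (F t)‖ ^ 2 ∂μ ≤ ∫ t, ‖freqCut B hB (F t)‖ ^ 2 ∂μ :=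
    hmono (hf.integrable_norm_pow (by norm_num)) (hcF.integrable_norm_pow (by norm_num))
      fun t => hsq (norm_nonneg _) (hvn _)
  have bg : ‖vert G‖ ^ 2 ≤ ‖freqCut B hB G‖ ^ 2 := hsq (norm_nonneg _) (hvn _)
  have hNdef : N = (∫ t, ‖freqCut B hB (U t)‖ ^ 2 ∂μ) + (∫ t, ‖freqCut B hB (F t)‖ ^ 2 ∂μ)
    + ‖freqCut B hB G‖ ^ 2 := rfl
  have hN0 : 0 ≤ N := by rw [hNdef]; exact add_nonneg (add_nonneg nU nF) nG
  have hLN : N ≤ Lam * N := le_mul_of_one_le_left hN0 hLam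
  have hEN : E ≤ Lam * N := by
    have h1 : (∫ t, ‖vert (F t)‖ ^ 2 ∂μ) ≤ Lam * ∫ t, ‖freqCut B hB (F t)‖ ^ 2 ∂μ :=
      bf.trans (le_mul_of_one_le_left nF hLam)
    have h2 : (∫ t, ‖hor (U t)‖ ^ 2 ∂μ) ≤ Lam * ∫ t, ‖freqCut B hB (U t)‖ ^ 2 ∂μ :=
      bp.trans (le_mul_of_one_le_left nU hLam)
    have h3 := mul_le_mul_of_nonneg_left bg (zero_le_one.trans hLam)
    rw [hE, hNdef]
    linarith
  have hLE : Lam * E ≤ Lam ^ 2 * N := by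
    have := mul_le_mul_of_nonneg_left hEN (zero_le_one.trans hLam)
    linarith
  set vE := mulOp _ memLp_vertEmbed with hvE
  set hE' := mulOp _ memLp_horEmbed with hhE
  refine ⟨fun z => vE (Q z) + hE' (P z), (vE.continuous.comp_continuousOn hQc).add
    (hE'.continuous.comp_continuousOn hPc), ?_, ?_, fun z hz => ?_, ?_⟩
  · filter_upwards [hPp, hQq, hcurl] with z h1 h2 h3
    rw [h1, h2]
    refine Lp.ext ?_
    -- At ξ = 0 the direction takes the value 0 and the decomposition fails; this is a single point,
    -- of measure zero.
    have hne : ∀ᵐ ξ : Plane, ξ ≠ 0 := by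
      simp [ae_iff, measure_singleton]
    filter_upwards [hne, Lp.coeFn_add (vE (vert (U z))) (hE' (hor (U z))),
      coeFn_mulOp _ memLp_vertEmbed (vert (U z)), coeFn_mulOp _ memLp_horEmbed (hor (U z)),
      coeFn_mulOp _ (memLp_vertSymbol hB) (U z), coeFn_mulOp _ (memLp_horSymbol hB) (U z),
      h3 ▸ coeFn_mulOp _ (memLp_curlSymbol hB hk) (U z),
      Lp.coeFn_zero ℂ 2 (volume : Measure Plane), coeFn_freqCut hB (U z)]
      with ξ g0 g1 g2 g3 g4 g5 g6 g7 g8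
    rw [g7, Pi.zero_apply] at g6
    rw [g1, Pi.add_apply, g2, g3, g4, g5, g8, vertEmbed_add_horEmbed_eq g0 g6.symm]
    rfl
  · filter_upwards [Lp.coeFn_add (vE (Q 0)) (hE' (P 0)), coeFn_mulOp _ memLp_vertEmbed (Q 0),
      coeFn_mulOp _ memLp_horEmbed (P 0), coeFn_mulOp _ (memLp_vertSymbol hB) G,
      coeFn_freqCut hB G, Lp.coeFn_neg (vert G)] with ξ g1 g2 g3 g4 g5 g6
    rw [g1, Pi.add_apply, g2, g3, g5, vertEmbed_apply, horEmbed_apply, hQ0, g6, Pi.neg_apply, g4,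
      vertSymbol_apply]
    by_cases hξ : ξ ∈ B <;> simp [hξ]
  · have h1 : ‖vE (Q z)‖ ≤ ‖Q z‖ := by
      simpa using norm_mulOp_le memLp_vertEmbed norm_vertEmbed_le (Q z)
    have h2 : ‖hE' (P z)‖ ≤ ‖P z‖ := by
      simpa using norm_mulOp_le memLp_horEmbed norm_horEmbed_le (P z)
    have h3 : ‖vE (Q z) + hE' (P z)‖ ^ 2 ≤ (‖Q z‖ + ‖P z‖) ^ 2 :=
      hsq (norm_nonneg _) ((norm_add_le _ _).trans (add_le_add h1 h2))
    have h4 := hPb z hz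
    have h5 := hQb z hz
    have h6 : N ≤ Lam ^ 2 * N := le_mul_of_one_le_left hN0 (one_le_pow₀ hLam)
    -- The constant 6 comes from (‖Q‖ + ‖P‖)² ≤ 2‖Q‖² + 2‖P‖², with ‖P‖² ≤ Lam² N and ‖Q‖² ≤ N +
    -- Lam² N ≤ 2 Lam² N.
    have h7 : (∫ t, ‖vert (F t)‖ ^ 2 ∂μ) + (∫ t, ‖vert (U t)‖ ^ 2 ∂μ) ≤ N := by
      rw [hNdef]; linarith
    have h8 := sq_nonneg (‖Q z‖ - ‖P z‖)
    show ‖vE (Q z) + hE' (P z)‖ ^ 2 ≤ 6 * Lam ^ 2 * N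
    linarith
  · refine le_trans ?_ (hS.trans hLE)
    have hRp : MemLp (fun t => absOp hB hk (hor (U t))) 2 μ := (absOp hB hk).comp_memLp' hp
    have hRq : MemLp (fun t => absOp hB hk (vert (U t))) 2 μ := (absOp hB hk).comp_memLp' hq
    refine integral_mono_ae (MemLp.integrable_norm_pow (p := 2)
      ((scalarMul _ _ _).comp_memLp' h.memLp) (by norm_num))
      ((hRp.integrable_real_inner hp).add (hRq.integrable_real_inner hq)) ?_
    filter_upwards [hcurl] with t ht using norm_sq_sqrtMul_le hB hk ht

end FrequencyRep

/-! ### Removal of the frequency cut-off -/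

section FrequencyLimit

theorem MeasureTheory.MemLp.integral_norm_sq_eq {X E : Type*} [MeasurableSpace X] {μ : Measure X}
    [NormedAddCommGroup E] {u : X → E} (hu : MemLp u 2 μ) :
    ∫ t, ‖u t‖ ^ 2 ∂μ = (eLpNorm u 2 μ).toReal ^ 2 := by
  rw [hu.eLpNorm_eq_integral_rpow_norm (by norm_num) (by norm_num),
    ENNReal.toReal_ofReal (by positivity)]
  simp only [ENNReal.toReal_ofNat, Real.rpow_ofNat]
  rw [← Real.rpow_natCast, ← Real.rpow_mul (by positivity)]
  norm_num

/-- The frequencies of size at most `k`. -/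
def freqBall (k : ℕ) : Set Plane := Metric.closedBall 0 k

theorem measurableSet_freqBall (k : ℕ) : MeasurableSet (freqBall k) :=
  Metric.isClosed_closedBall.measurableSet

theorem norm_le_of_mem_freqBall {k : ℕ} {ξ : Plane} (h : ξ ∈ freqBall k) : ‖ξ‖ ≤ k := by
  simpa [freqBall] using h

theorem eventually_mem_freqBall (ξ : Plane) : ∀ᶠ k : ℕ in atTop, ξ ∈ freqBall k := by
  filter_upwards [eventually_ge_atTop ⌈‖ξ‖⌉₊] with k hk
  simpa [freqBall] using Nat.ceil_le.mp hk

theorem norm_freqCut_mono {A B : Set Plane} (hA : MeasurableSet A) (hB : MeasurableSet B)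
    (hAB : A ⊆ B) (v : L2Vec) : ‖freqCut A hA v‖ ≤ ‖freqCut B hB v‖ := by
  refine Lp.norm_le_norm_of_ae_le ?_
  filter_upwards [coeFn_freqCut hA v, coeFn_freqCut hB v] with ξ h1 h2
  rw [h1, h2]
  exact norm_indicator_le_of_subset hAB _ _

theorem norm_freqCut_le {A : Set Plane} (hA : MeasurableSet A) (v : L2Vec) :
    ‖freqCut A hA v‖ ≤ ‖v‖ := by
  refine Lp.norm_le_norm_of_ae_le ?_
  filter_upwards [coeFn_freqCut hA v] with ξ h1
  rw [h1]
  exact norm_indicator_le_norm_self _ _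

theorem tendsto_freqCut_compl (v : L2Vec) :
    Tendsto (fun k => ‖freqCut (freqBall k)ᶜ (measurableSet_freqBall k).compl v‖ ^ 2) atTop
      (𝓝 0) := by
  simp only [norm_sq_eq_integral_norm_sq]
  rw [← integral_zero Plane ℝ (μ := volume)]
  refine tendsto_integral_of_dominated_convergence (fun ξ => ‖v ξ‖ ^ 2)
    (fun k => ((Lp.aestronglyMeasurable _).norm.pow 2))
    ((Lp.memLp v).integrable_norm_pow (by norm_num)) (fun k => ?_) ?_
  · filter_upwards [coeFn_freqCut (measurableSet_freqBall k).compl v] with ξ h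
    rw [h, norm_pow, norm_norm]
    exact pow_le_pow_left₀ (norm_nonneg _) (norm_indicator_le_norm_self _ _) 2
  · have := ae_all_iff.mpr fun k => coeFn_freqCut (measurableSet_freqBall k).compl v
    filter_upwards [this] with ξ h
    refine tendsto_const_nhds.congr' ?_
    filter_upwards [eventually_mem_freqBall ξ] with k hk
    rw [h]
    simp [hk]

theorem freqCut_sub_freqCut {A B : Set Plane} (hA : MeasurableSet A) (hB : MeasurableSet B)
    (hAB : A ⊆ B) (v : L2Vec) :
    freqCut B hB v - freqCut A hA v = freqCut (B \ A) (hB.diff hA) v := by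
  refine Lp.ext ?_
  filter_upwards [coeFn_freqCut hA v, coeFn_freqCut hB v, coeFn_freqCut (hB.diff hA) v,
    Lp.coeFn_sub (freqCut B hB v) (freqCut A hA v)] with ξ h1 h2 h3 h4
  rw [h4, Pi.sub_apply, h1, h2, h3]
  by_cases ha : ξ ∈ A
  · simp [ha, hAB ha]
  · by_cases hb : ξ ∈ B <;> simp [ha, hb]

theorem freqCut_univ (v : L2Vec) : freqCut univ MeasurableSet.univ v = v := by
  refine Lp.ext ?_
  filter_upwards [coeFn_freqCut MeasurableSet.univ v] with ξ h
  rw [h, indicator_univ]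

theorem tendsto_freqCut (v : L2Vec) :
    Tendsto (fun k => freqCut (freqBall k) (measurableSet_freqBall k) v) atTop (𝓝 v) := by
  rw [tendsto_iff_norm_sub_tendsto_zero]
  have h := (Real.continuous_sqrt.tendsto 0).comp (tendsto_freqCut_compl v)
  rw [Real.sqrt_zero] at h
  refine h.congr fun k => ?_
  have e := freqCut_sub_freqCut (measurableSet_freqBall k) MeasurableSet.univ (subset_univ _) v
  simp only [← compl_eq_univ_sdiff] at e
  rw [freqCut_univ] at e
  rw [Function.comp_apply, Real.sqrt_sq (norm_nonneg _), norm_sub_rev, e]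

variable {lam : ℝ → ℝ} {U F : ℝ → L2Vec} {G : L2Vec}

theorem IsFrequencySystem.freqEnergy_mono (h : IsFrequencySystem lam U F G) {A B : Set Plane}
    (hA : MeasurableSet A) (hB : MeasurableSet B) (hAB : A ⊆ B) :
    freqEnergy U F G A hA ≤ freqEnergy U F G B hB := by
  have key : ∀ {u : ℝ → L2Vec}, MemLp u 2 (volume.restrict (Ioi 0)) →
      ∫ t in Ioi 0, ‖freqCut A hA (u t)‖ ^ 2 ≤ ∫ t in Ioi 0, ‖freqCut B hB (u t)‖ ^ 2 := by
    intro u hu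
    refine integral_mono (MemLp.integrable_norm_pow (p := 2)
      ((freqCut A hA).comp_memLp' hu) (by norm_num)) (MemLp.integrable_norm_pow (p := 2)
      ((freqCut B hB).comp_memLp' hu) (by norm_num)) fun t => ?_
    exact pow_le_pow_left₀ (norm_nonneg _) (norm_freqCut_mono hA hB hAB _) 2
  exact add_le_add (add_le_add (key h.memLp) (key h.memLp_source))
    (pow_le_pow_left₀ (norm_nonneg _) (norm_freqCut_mono hA hB hAB _) 2)

theorem IsFrequencySystem.tendsto_freqEnergy_compl (h : IsFrequencySystem lam U F G) :
    Tendsto (fun k => freqEnergy U F G (freqBall k)ᶜ (measurableSet_freqBall k).compl) atTop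
      (𝓝 0) := by
  have key : ∀ {u : ℝ → L2Vec}, MemLp u 2 (volume.restrict (Ioi 0)) →
      Tendsto (fun k => ∫ t in Ioi 0,
        ‖freqCut (freqBall k)ᶜ (measurableSet_freqBall k).compl (u t)‖ ^ 2) atTop (𝓝 0) := by
    intro u hu
    suffices h0 : Tendsto (fun k => ∫ t in Ioi 0,
        ‖freqCut (freqBall k)ᶜ (measurableSet_freqBall k).compl (u t)‖ ^ 2) atTop
        (𝓝 (∫ _ in Ioi (0 : ℝ), (0 : ℝ))) by rwa [integral_zero] at h0
    refine tendsto_integral_of_dominated_convergence (fun t => ‖u t‖ ^ 2)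
      (fun k => (((freqCut _ _).continuous.comp_aestronglyMeasurable hu.1).norm.pow 2))
      (hu.integrable_norm_pow (by norm_num)) (fun k => .of_forall fun t => ?_)
      (.of_forall fun t => tendsto_freqCut_compl _)
    rw [norm_pow, norm_norm]
    exact pow_le_pow_left₀ (norm_nonneg _) (norm_freqCut_le _ _) 2
  simpa [freqEnergy] using ((key h.memLp).add (key h.memLp_source)).add (tendsto_freqCut_compl G)

/-- The sum of the norms of the data. -/
noncomputable def dataNorm (U F : ℝ → L2Vec) (G : L2Vec) : ℝ :=
  (eLpNorm U 2 (volume.restrict (Ioi 0))).toReal + (eLpNorm F 2 (volume.restrict (Ioi 0))).toReal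
    + ‖G‖

theorem IsFrequencySystem.freqEnergy_le (h : IsFrequencySystem lam U F G) {B : Set Plane}
    (hB : MeasurableSet B) : freqEnergy U F G B hB ≤ dataNorm U F G ^ 2 := by
  refine (h.freqEnergy_mono hB MeasurableSet.univ (subset_univ _)).trans ?_
  simp only [freqEnergy, freqCut_univ, dataNorm]
  rw [h.memLp.integral_norm_sq_eq, h.memLp_source.integral_norm_sq_eq]
  have h1 : 0 ≤ (eLpNorm U 2 (volume.restrict (Ioi 0))).toReal := ENNReal.toReal_nonneg
  have h2 : 0 ≤ (eLpNorm F 2 (volume.restrict (Ioi 0))).toReal := ENNReal.toReal_nonneg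
  have h3 := norm_nonneg G
  nlinarith [mul_nonneg h1 h2, mul_nonneg h1 h3, mul_nonneg h2 h3]

/-- The representatives on the balls of radius k converge uniformly on [0, ∞). The difference of two
of them is the representative on an annulus, which is bounded by the energy outside the smaller
ball. -/
theorem IsFrequencySystem.exists_continuous_rep (h : IsFrequencySystem lam U F G)
    {Lam : ℝ} (hLam : 1 ≤ Lam) (hlm : AEMeasurable lam (volume.restrict (Ioi 0)))
    (hlam : ∀ᵐ z ∂(volume.restrict (Ioi (0 : ℝ))), 1 / Lam ≤ lam z ∧ lam z ≤ Lam) :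
    ∃ V : ℝ → L2Vec, ContinuousOn V (Ici 0) ∧
      (∀ᵐ z ∂(volume.restrict (Ioi (0 : ℝ))), V z = U z) ∧ (∀ᵐ ξ, V 0 ξ 0 = -G ξ 0) ∧
      ∀ z, 0 ≤ z → ‖V z‖ ≤ 3 * Lam * dataNorm U F G := by
  choose V hVc hVU hVG hVb hVW using fun k : ℕ => h.exists_rep hLam hlm hlam
    (measurableSet_freqBall k) (fun _ => norm_le_of_mem_freqBall)
  have hdist : ∀ j k, j ≤ k → ∀ z, 0 ≤ z → ‖V k z - V j z‖ ^ 2 ≤ 6 * Lam ^ 2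
      * freqEnergy U F G (freqBall j)ᶜ (measurableSet_freqBall j).compl := by
    intro j k hjk z hz
    have hsub : freqBall j ⊆ freqBall k :=
      Metric.closedBall_subset_closedBall (Nat.cast_le.mpr hjk)
    have hA := (measurableSet_freqBall k).diff (measurableSet_freqBall j)
    obtain ⟨W, hWc, hWU, -, hWb, -⟩ := h.exists_rep hLam hlm hlam hA
      (fun ξ hξ => norm_le_of_mem_freqBall hξ.1)
    have hae : (fun z => V k z - V j z) =ᵐ[volume.restrict (Ici 0)] W := by
      rw [← restrict_Ioi_eq_restrict_Ici]
      filter_upwards [hVU k, hVU j, hWU] with z h1 h2 h3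
      rw [h1, h2, h3, freqCut_sub_freqCut _ _ hsub]
    -- Representatives agree almost everywhere by construction; continuity upgrades this to every z
    -- ≥ 0, including z = 0.
    have heq := Measure.eqOn_of_ae_eq hae ((hVc k).sub (hVc j)) hWc (by simp)
    have e : V k z - V j z = W z := heq hz
    rw [e]
    refine (hWb z hz).trans (mul_le_mul_of_nonneg_left ?_ (by positivity))
    exact h.freqEnergy_mono _ _ (fun ξ hξ => hξ.2)
  have hlim0 : Tendsto (fun j => 6 * Lam ^ 2
      * freqEnergy U F G (freqBall j)ᶜ (measurableSet_freqBall j).compl) atTop (𝓝 0) := by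
    simpa using h.tendsto_freqEnergy_compl.const_mul (6 * Lam ^ 2)
  have hcauchy : UniformCauchySeqOn V atTop (Ici 0) := by
    rw [Metric.uniformCauchySeqOn_iff]
    intro ε hε
    obtain ⟨N, hN⟩ := (hlim0.eventually (gt_mem_nhds (by positivity : 0 < (ε / 2) ^ 2))).exists
    have key : ∀ m, N ≤ m → ∀ z ∈ Ici (0 : ℝ), ‖V m z - V N z‖ < ε / 2 := fun m hm z hz =>
      lt_of_pow_lt_pow_left₀ 2 (by positivity) ((hdist N m hm z hz).trans_lt hN)
    refine ⟨N, fun m hm n hn z hz => ?_⟩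
    have h1 := key m hm z hz
    have h2 := key n hn z hz
    have h3 := dist_triangle_right (V m z) (V n z) (V N z)
    rw [dist_eq_norm (V m z) (V N z), dist_eq_norm (V n z) (V N z)] at h3
    linarith
  have hex : ∀ z, ∃ v, 0 ≤ z → Tendsto (fun k => V k z) atTop (𝓝 v) := by
    intro z
    by_cases hz : 0 ≤ z
    · obtain ⟨v, hv⟩ := cauchySeq_tendsto_of_complete (hcauchy.cauchySeq hz)
      exact ⟨v, fun _ => hv⟩
    · exact ⟨0, fun h => absurd h hz⟩
  choose V' hV' using hex
  have hunif : TendstoUniformlyOn V V' atTop (Ici 0) :=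
    hcauchy.tendstoUniformlyOn_of_tendsto fun z hz => hV' z hz
  refine ⟨V', hunif.continuousOn (Frequently.of_forall hVc), ?_, ?_, fun z hz => ?_⟩
  · filter_upwards [ae_all_iff.mpr hVU, ae_restrict_mem measurableSet_Ioi] with z h1 h2
    refine tendsto_nhds_unique (hV' z (le_of_lt h2)) ?_
    simp only [h1]
    exact tendsto_freqCut (U z)
  · set P := mulOp _ (memLp_vertSymbol (MeasurableSet.univ : MeasurableSet (univ : Set Plane)))
    have hP : ∀ v : L2Vec, P v =ᵐ[volume] fun ξ => v ξ 0 := by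
      intro v
      filter_upwards [coeFn_mulOp _
        (memLp_vertSymbol (MeasurableSet.univ : MeasurableSet (univ : Set Plane))) v] with ξ hξ
      rw [hξ, vertSymbol_apply, indicator_univ]
    have hk : ∀ k, P (V k 0) = -P (freqCut (freqBall k) (measurableSet_freqBall k) G) := by
      intro k
      refine Lp.ext ?_
      filter_upwards [hVG k, hP (V k 0), hP (freqCut (freqBall k) (measurableSet_freqBall k) G),
        Lp.coeFn_neg (P (freqCut (freqBall k) (measurableSet_freqBall k) G))] with ξ h1 h2 h3 h4
      rw [h2, h4, Pi.neg_apply, h3, h1]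
    have e : P (V' 0) = -P G := by
      refine tendsto_nhds_unique ((P.continuous.tendsto _).comp (hV' 0 le_rfl)) ?_
      have := ((P.continuous.tendsto _).comp (tendsto_freqCut G)).neg
      exact this.congr fun k => (hk k).symm
    filter_upwards [hP (V' 0), hP G, e ▸ Lp.coeFn_neg (P G)] with ξ h1 h2 h3
    rw [← h1, h3, Pi.neg_apply, h2]
  · have hd0 : 0 ≤ dataNorm U F G := by unfold dataNorm; positivity
    refine le_of_tendsto' ((hV' z hz).norm) fun k => ?_
    -- The constant 3 is an upper bound for √6.
    refine (abs_le_of_sq_le_sq' ?_ (by positivity)).2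
    have h1 := mul_le_mul_of_nonneg_left (h.freqEnergy_le (measurableSet_freqBall k))
      (by positivity : 0 ≤ 6 * Lam ^ 2)
    have h2 := hVb k z hz
    have h3 : 0 ≤ Lam ^ 2 * dataNorm U F G ^ 2 := by positivity
    linarith

end FrequencyLimit

/-! ### The half-derivative bound -/

section FrequencyWeight

theorem Lp_enorm_sq_eq_lintegral {X E : Type*} [MeasurableSpace X] {μ : Measure X}
    [NormedAddCommGroup E] (v : Lp E 2 μ) : ‖v‖ₑ ^ 2 = ∫⁻ x, ‖v x‖ₑ ^ 2 ∂μ := by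
  rw [Lp.enorm_def, eLpNorm_eq_lintegral_rpow_enorm_toReal (by norm_num) (by norm_num)]
  simp only [ENNReal.toReal_ofNat, ENNReal.rpow_ofNat]
  rw [← ENNReal.rpow_natCast, ← ENNReal.rpow_mul]
  norm_num

theorem eLpNorm_two_sq_eq_lintegral {X E : Type*} [MeasurableSpace X] {μ : Measure X}
    [NormedAddCommGroup E] (v : X → E) : eLpNorm v 2 μ ^ 2 = ∫⁻ x, ‖v x‖ₑ ^ 2 ∂μ := by
  rw [eLpNorm_eq_lintegral_rpow_enorm_toReal (by norm_num) (by norm_num)]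
  simp only [ENNReal.toReal_ofNat, ENNReal.rpow_ofNat]
  rw [← ENNReal.rpow_natCast, ← ENNReal.rpow_mul]
  norm_num

/-- An unbounded multiplier c is reached through its truncations to balls. Monotone convergence
carries the uniform bound to the limit; in particular almost every weighted slice is in L².
Measurability in z follows since the weighted slice is the L² limit of its truncations. -/
theorem exists_memLp_weighted {μ : Measure ℝ} {U : ℝ → L2Vec} (hU : MemLp U 2 μ)
    {c : Plane → ℂ} (hc : Measurable c)
    (hm : ∀ k, Measurable ((freqBall k).indicator c))
    (hb : ∀ k, ∃ K : ℝ, ∀ x, ‖(freqBall k).indicator c x‖ ≤ K) {K : ℝ≥0∞} (hK : K ≠ ⊤)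
    (hbound : ∀ k, ∫⁻ z, ‖scalarMul _ (hm k) (hb k) (U z)‖ₑ ^ 2 ∂μ ≤ K ^ 2) :
    ∃ W : ℝ → L2Vec, MemLp W 2 μ ∧ (∀ᵐ z ∂μ, W z =ᵐ[volume] fun ξ => c ξ • U z ξ) ∧
      eLpNorm W 2 μ ≤ K := by
  classical
  have hN : ∀ z, ⨆ k, ‖scalarMul _ (hm k) (hb k) (U z)‖ₑ ^ 2
      = ∫⁻ ξ, ‖c ξ • U z ξ‖ₑ ^ 2 := by
    intro z
    have h1 : ∀ k, ‖scalarMul _ (hm k) (hb k) (U z)‖ₑ ^ 2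
        = ∫⁻ ξ, ‖(freqBall k).indicator c ξ • U z ξ‖ₑ ^ 2 := by
      intro k
      rw [Lp_enorm_sq_eq_lintegral]
      refine lintegral_congr_ae ?_
      filter_upwards [coeFn_scalarMul (hm k) (hb k) (U z)] with ξ h
      rw [h]
    simp only [h1]
    rw [← lintegral_iSup']
    · refine lintegral_congr fun ξ => ?_
      refine le_antisymm (iSup_le fun k => ?_) ?_
      · by_cases h : ξ ∈ freqBall k <;> simp [h]
      · obtain ⟨k, hk⟩ := (eventually_mem_freqBall ξ).exists
        refine le_trans ?_ (le_iSup _ k)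
        simp [hk]
    · exact fun k => (((hm k).aestronglyMeasurable.smul
        (Lp.aestronglyMeasurable _)).enorm.pow_const 2)
    · refine .of_forall fun ξ j k hjk => ?_
      have hsub : freqBall j ⊆ freqBall k :=
        Metric.closedBall_subset_closedBall (Nat.cast_le.mpr hjk)
      by_cases h : ξ ∈ freqBall j
      · simp [h, hsub h]
      · simp [h]
  have hmono : ∀ z, Monotone fun k => ‖scalarMul _ (hm k) (hb k) (U z)‖ₑ ^ 2 := by
    intro z j k hjk
    have hsub : freqBall j ⊆ freqBall k :=
      Metric.closedBall_subset_closedBall (Nat.cast_le.mpr hjk)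
    refine pow_le_pow_left' (enorm_le_iff_norm_le.mpr (Lp.norm_le_norm_of_ae_le ?_)) 2
    filter_upwards [coeFn_scalarMul (hm k) (hb k) (U z), coeFn_scalarMul (hm j) (hb j) (U z)]
      with ξ h1 h2
    rw [h1, h2]
    by_cases h : ξ ∈ freqBall j
    · simp [h, hsub h]
    · simp [h]
  have hmeas : ∀ k, AEMeasurable (fun z => ‖scalarMul _ (hm k) (hb k) (U z)‖ₑ ^ 2) μ := fun k =>
    ((scalarMul _ (hm k) (hb k)).continuous.comp_aestronglyMeasurable hU.1).enorm.pow_const 2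
  have hint : ∫⁻ z, (∫⁻ ξ, ‖c ξ • U z ξ‖ₑ ^ 2) ∂μ ≤ K ^ 2 := by
    simp only [← hN]
    rw [lintegral_iSup' hmeas (.of_forall hmono)]
    exact iSup_le hbound
  have hNm : AEMeasurable (fun z => ∫⁻ ξ, ‖c ξ • U z ξ‖ₑ ^ 2) μ := by
    simp only [← hN]
    exact AEMeasurable.iSup hmeas
  have hfin : ∀ᵐ z ∂μ, MemLp (fun ξ => c ξ • U z ξ) 2 volume := by
    filter_upwards [ae_lt_top' hNm (hint.trans_lt (ENNReal.pow_lt_top hK.lt_top)).ne] with z hz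
    refine ⟨hc.aestronglyMeasurable.smul (Lp.aestronglyMeasurable _), ?_⟩
    rw [← eLpNorm_two_sq_eq_lintegral] at hz
    exact (ENNReal.pow_lt_top_iff.mp hz).resolve_right (by norm_num)
  let W : ℝ → L2Vec := fun z => if h : MemLp (fun ξ => c ξ • U z ξ) 2 volume then h.toLp _ else 0
  have hW : ∀ᵐ z ∂μ, W z =ᵐ[volume] fun ξ => c ξ • U z ξ := by
    filter_upwards [hfin] with z hz
    simp only [W, hz, ↓reduceDIte]
    exact hz.coeFn_toLp
  have hWm : AEStronglyMeasurable W μ := by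
    refine aestronglyMeasurable_of_tendsto_ae atTop
      (f := fun k z => scalarMul _ (hm k) (hb k) (U z))
      (fun k => (scalarMul _ (hm k) (hb k)).continuous.comp_aestronglyMeasurable hU.1) ?_
    filter_upwards [hW] with z hz
    refine (tendsto_freqCut (W z)).congr fun k => Lp.ext ?_
    filter_upwards [hz, coeFn_freqCut (measurableSet_freqBall k) (W z),
      coeFn_scalarMul (hm k) (hb k) (U z)] with ξ h1 h2 h3
    rw [h2, h3]
    by_cases h : ξ ∈ freqBall k <;> simp [h, h1]
  have hnorm : eLpNorm W 2 μ ≤ K := by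
    refine (ENNReal.pow_le_pow_left_iff two_ne_zero).mp ?_
    rw [eLpNorm_two_sq_eq_lintegral]
    refine le_trans (le_of_eq (lintegral_congr_ae ?_)) hint
    filter_upwards [hW] with z hz
    rw [Lp_enorm_sq_eq_lintegral]
    refine lintegral_congr_ae ?_
    filter_upwards [hz] with ξ h
    rw [h]
  exact ⟨W, ⟨hWm, hnorm.trans_lt hK.lt_top⟩, hW, hnorm⟩

/-- The Fourier multiplier of the Bessel potential of order `1 / 2`. -/
noncomputable def halfBessel (ξ : Plane) : ℂ := (((1 + ‖ξ‖ ^ 2) ^ (1 / 4 : ℝ) : ℝ) : ℂ)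

theorem norm_halfBessel_sq (ξ : Plane) : ‖halfBessel ξ‖ ^ 2 = Real.sqrt (1 + ‖ξ‖ ^ 2) := by
  rw [halfBessel, Complex.norm_real, Real.norm_eq_abs, sq_abs, ← Real.rpow_natCast,
    ← Real.rpow_mul (by positivity), Real.sqrt_eq_rpow]
  norm_num

theorem norm_halfBessel_sq_le (ξ : Plane) : ‖halfBessel ξ‖ ^ 2 ≤ 1 + ‖ξ‖ := by
  rw [norm_halfBessel_sq]
  refine Real.sqrt_le_iff.mpr ⟨by positivity, ?_⟩
  nlinarith [norm_nonneg ξ]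

theorem norm_le_norm_halfBessel_sq (ξ : Plane) : ‖ξ‖ ≤ ‖halfBessel ξ‖ ^ 2 := by
  rw [norm_halfBessel_sq]
  exact Real.le_sqrt_of_sq_le (by linarith)

theorem measurable_halfBessel : Measurable halfBessel := by
  unfold halfBessel; fun_prop

theorem norm_halfBessel_indicator_le (k : ℕ) :
    ∃ K : ℝ, ∀ x, ‖(freqBall k).indicator halfBessel x‖ ≤ K := by
  refine ⟨1 + k, fun x => ?_⟩
  by_cases h : x ∈ freqBall k
  · rw [indicator_of_mem h]
    have h1 := norm_halfBessel_sq_le x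
    have h2 := norm_le_of_mem_freqBall h
    nlinarith [norm_nonneg x, norm_nonneg (halfBessel x)]
  · rw [indicator_of_notMem h, norm_zero]
    positivity

variable {lam : ℝ → ℝ} {U F : ℝ → L2Vec} {G : L2Vec}

/-- The squared Bessel weight √(1 + |ξ|²) is at most 1 + |ξ|: the 1 is paid by the L² norm of U, the
|ξ| by the energy bound on each ball. This gives (1 + Lam²)N² ≤ (2 Lam N)². -/
theorem IsFrequencySystem.exists_halfBessel (h : IsFrequencySystem lam U F G)
    {Lam : ℝ} (hLam : 1 ≤ Lam) (hlm : AEMeasurable lam (volume.restrict (Ioi 0)))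
    (hlam : ∀ᵐ z ∂(volume.restrict (Ioi (0 : ℝ))), 1 / Lam ≤ lam z ∧ lam z ≤ Lam) :
    ∃ W : ℝ → L2Vec, MemLp W 2 (volume.restrict (Ioi 0)) ∧
      (∀ᵐ z ∂(volume.restrict (Ioi (0 : ℝ))), W z =ᵐ[volume] fun ξ => halfBessel ξ • U z ξ) ∧
      eLpNorm W 2 (volume.restrict (Ioi 0)) ≤ ENNReal.ofReal (2 * Lam * dataNorm U F G) := by
  have hd0 : 0 ≤ dataNorm U F G := by unfold dataNorm; positivity
  refine exists_memLp_weighted h.memLp measurable_halfBessel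
    (fun k => measurable_halfBessel.indicator (measurableSet_freqBall k))
    norm_halfBessel_indicator_le ENNReal.ofReal_ne_top fun k => ?_
  have hk : ∀ x ∈ freqBall k, ‖x‖ ≤ (k : ℝ) := fun _ => norm_le_of_mem_freqBall
  have hB := measurableSet_freqBall k
  set M := scalarMul _ (measurable_halfBessel.indicator hB) (norm_halfBessel_indicator_le k)
  set R := scalarMul _ (measurable_sqrt_norm_indicator hB) (norm_sqrt_norm_indicator_le hk)
  obtain ⟨-, -, -, -, -, hR⟩ := h.exists_rep hLam hlm hlam hB hk
  have hpt : ∀ v : L2Vec, ‖M v‖ ^ 2 ≤ ‖v‖ ^ 2 + ‖R v‖ ^ 2 := by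
    intro v
    rw [norm_sq_eq_integral_norm_sq, norm_sq_eq_integral_norm_sq, norm_sq_eq_integral_norm_sq,
      ← integral_add ((Lp.memLp v).integrable_norm_pow (by norm_num))
        ((Lp.memLp (R v)).integrable_norm_pow (by norm_num))]
    refine integral_mono_ae ((Lp.memLp (M v)).integrable_norm_pow (by norm_num))
      (((Lp.memLp v).integrable_norm_pow (by norm_num)).add
        ((Lp.memLp (R v)).integrable_norm_pow (by norm_num))) ?_
    filter_upwards [coeFn_scalarMul (measurable_halfBessel.indicator hB)
      (norm_halfBessel_indicator_le k) v, coeFn_scalarMul (measurable_sqrt_norm_indicator hB)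
      (norm_sqrt_norm_indicator_le hk) v] with ξ h1 h2
    simp only [M, R, h1, h2, norm_smul, mul_pow]
    by_cases hξ : ξ ∈ freqBall k
    · have := mul_le_mul_of_nonneg_right (norm_halfBessel_sq_le ξ) (sq_nonneg ‖v ξ‖)
      simp only [hξ, indicator_of_mem, Complex.norm_real, Real.norm_eq_abs, sq_abs,
        Real.sq_sqrt (norm_nonneg ξ)]
      linarith
    · simp [hξ]
  have hiM : Integrable (fun z => ‖M (U z)‖ ^ 2) (volume.restrict (Ioi 0)) :=
    MemLp.integrable_norm_pow (p := 2) (M.comp_memLp' h.memLp) (by norm_num)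
  have hiR : Integrable (fun z => ‖R (U z)‖ ^ 2) (volume.restrict (Ioi 0)) :=
    MemLp.integrable_norm_pow (p := 2) (R.comp_memLp' h.memLp) (by norm_num)
  have hiU : Integrable (fun z => ‖U z‖ ^ 2) (volume.restrict (Ioi 0)) :=
    h.memLp.integrable_norm_pow (by norm_num)
  have hle : ∫ z in Ioi 0, ‖M (U z)‖ ^ 2 ≤ (2 * Lam * dataNorm U F G) ^ 2 := by
    have h1 : ∫ z in Ioi 0, ‖M (U z)‖ ^ 2
        ≤ (∫ z in Ioi 0, ‖U z‖ ^ 2) + ∫ z in Ioi 0, ‖R (U z)‖ ^ 2 := by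
      rw [← integral_add hiU hiR]
      exact integral_mono hiM (hiU.add hiR) fun z => hpt _
    have h2 : ∫ z in Ioi 0, ‖U z‖ ^ 2 ≤ dataNorm U F G ^ 2 := by
      rw [h.memLp.integral_norm_sq_eq]
      refine pow_le_pow_left₀ ENNReal.toReal_nonneg ?_ 2
      unfold dataNorm
      have : 0 ≤ (eLpNorm F 2 (volume.restrict (Ioi 0))).toReal := ENNReal.toReal_nonneg
      linarith [norm_nonneg G]
    have h3 := mul_le_mul_of_nonneg_left (h.freqEnergy_le hB) (by positivity : 0 ≤ Lam ^ 2)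
    have h4 : dataNorm U F G ^ 2 ≤ Lam ^ 2 * dataNorm U F G ^ 2 :=
      le_mul_of_one_le_left (by positivity) (one_le_pow₀ hLam)
    nlinarith
  have e : ∀ z, ‖M (U z)‖ₑ ^ 2 = ENNReal.ofReal (‖M (U z)‖ ^ 2) := fun z => by
    rw [ENNReal.ofReal_pow (norm_nonneg _), ofReal_norm]
  simp only [e]
  rw [← ofReal_integral_eq_lintegral_ofReal hiM (.of_forall fun _ => by positivity),
    ← ENNReal.ofReal_pow (by positivity)]
  exact ENNReal.ofReal_le_ofReal hle

end FrequencyWeight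

/-! ### Pairing integrals of slices with tensor products -/

section Pairing

variable {X Y : Type*} [MeasurableSpace X] [MeasurableSpace Y] {μ : Measure X} {ν : Measure Y}

theorem memLp_two_mul_prod [SFinite μ] [SFinite ν] {c : X → ℝ} {b : Y → ℝ} (hc : MemLp c 2 μ)
    (hb : MemLp b 2 ν) : MemLp (fun p : X × Y => c p.1 * b p.2) 2 (μ.prod ν) := by
  refine (memLp_two_iff_integrable_sq (f := fun p : X × Y => c p.1 * b p.2)
    (hc.1.comp_fst.mul hb.1.comp_snd)).mpr ?_
  simp only [mul_pow]
  exact hc.integrable_sq.mul_prod hb.integrable_sq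

/-- The continuous linear functional `v ↦ ∫ b • α v`. -/
theorem exists_clm_integral_smul {b : Y → ℝ} (hb : MemLp b 2 ν) (α : CVec →L[ℂ] ℂ) :
    ∃ T : Lp CVec 2 ν →L[ℝ] ℂ, ∀ v, T v = ∫ x, b x • α (v x) ∂ν := by
  refine ⟨ContinuousLinearMap.lpPairing ν 2 2
    ((ContinuousLinearMap.lsmul ℝ ℝ).flip.comp (α.restrictScalars ℝ)).flip (hb.toLp b),
    fun v => ?_⟩
  rw [ContinuousLinearMap.lpPairing_eq_integral]
  refine integral_congr_ae ?_
  filter_upwards [hb.coeFn_toLp] with x hx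
  simp [hx]

/-- Pairing with b is continuous on L², so it enters the Bochner integral in t, and Fubini does the
rest. Weak identities on the half-space tested with c(z) b(x) thereby become identities on the plane
for ∫ c(t) S(t) dt. -/
theorem integral_smul_integral_slices [SFinite μ] [SFinite ν] {w : X × Y → CVec}
    (hw : MemLp w 2 (μ.prod ν)) {S : X → Lp CVec 2 ν} (hS : MemLp S 2 μ)
    (hSw : ∀ᵐ z ∂μ, S z =ᵐ[ν] fun x => w (z, x)) {c : X → ℝ} {b : Y → ℝ} (hc : MemLp c 2 μ)
    (hb : MemLp b 2 ν) (α : CVec →L[ℂ] ℂ) :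
    ∫ x, b x • α ((∫ t, c t • S t ∂μ) x) ∂ν = ∫ p, (c p.1 * b p.2) • α (w p) ∂(μ.prod ν) := by
  obtain ⟨T, hT⟩ := exists_clm_integral_smul hb α
  have hint : Integrable (fun t => c t • S t) μ := memLp_one_iff_integrable.mp (hS.smul hc)
  have hw' : Integrable (fun p : X × Y => (c p.1 * b p.2) • α (w p)) (μ.prod ν) :=
    memLp_one_iff_integrable.mp ((α.comp_memLp' hw).smul (memLp_two_mul_prod hc hb))
  rw [← hT, ← T.integral_comp_comm hint, integral_prod _ hw']
  refine integral_congr_ae ?_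
  filter_upwards [hSw] with z hz
  rw [T.map_smul, hT, ← integral_smul]
  refine integral_congr_ae ?_
  filter_upwards [hz] with x hx
  rw [hx, smul_smul]

end Pairing

/-! ### Test functions of the form a(z) b(x) -/

section TensorTests

theorem isTest_tensor {a : ℝ → ℝ} {b : Plane → ℝ} (ha : ContDiff ℝ ∞ a) (hac : HasCompactSupport a)
    (hb : ContDiff ℝ ∞ b) (hbc : HasCompactSupport b) :
    IsTest fun p : ℝ × Plane => a p.1 * b p.2 := by
  refine ⟨(ha.comp contDiff_fst).mul (hb.comp contDiff_snd), ?_⟩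
  refine HasCompactSupport.intro (hac.isCompact.prod hbc.isCompact) fun p hp => ?_
  by_contra h
  refine hp ⟨subset_tsupport _ (left_ne_zero_of_mul h), subset_tsupport _ (right_ne_zero_of_mul h)⟩

theorem tsupport_tensor_subset {a : ℝ → ℝ} {b : Plane → ℝ} (ha : tsupport a ⊆ Ioi 0) :
    tsupport (fun p : ℝ × Plane => a p.1 * b p.2) ⊆ halfSpace := by
  have h : tsupport (fun p : ℝ × Plane => a p.1 * b p.2) ⊆ tsupport a ×ˢ univ := by
    refine closure_minimal (fun p hp => ⟨subset_tsupport _ (left_ne_zero_of_mul hp), mem_univ _⟩)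
      ((isClosed_tsupport a).prod isClosed_univ)
  exact h.trans (prod_mono ha subset_rfl)

theorem fderiv_tensor {a : ℝ → ℝ} {b : Plane → ℝ} (ha : ContDiff ℝ ∞ a) (hb : ContDiff ℝ ∞ b)
    (p v : ℝ × Plane) : fderiv ℝ (fun p : ℝ × Plane => a p.1 * b p.2) p v
      = v.1 * deriv a p.1 * b p.2 + a p.1 * fderiv ℝ b p.2 v.2 := by
  have h1 : HasFDerivAt (fun p : ℝ × Plane => a p.1) _ p :=
    ((ha.differentiable (by norm_num)) p.1).hasFDerivAt.comp p hasFDerivAt_fst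
  have h2 : HasFDerivAt (fun p : ℝ × Plane => b p.2) _ p :=
    ((hb.differentiable (by norm_num)) p.2).hasFDerivAt.comp p hasFDerivAt_snd
  have h3 : HasFDerivAt (fun p : ℝ × Plane => a p.1 * b p.2) _ p := h1.mul h2
  rw [h3.fderiv]
  have e : fderiv ℝ a p.1 v.1 = v.1 * deriv a p.1 := by
    rw [fderiv_eq_smul_deriv, smul_eq_mul]
  simp [e]
  ring

theorem fderiv_tensor_dir_zero {a : ℝ → ℝ} {b : Plane → ℝ} (ha : ContDiff ℝ ∞ a)
    (hb : ContDiff ℝ ∞ b) (p : ℝ × Plane) :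
    fderiv ℝ (fun p : ℝ × Plane => a p.1 * b p.2) p (dir 0) = deriv a p.1 * b p.2 := by
  rw [fderiv_tensor ha hb]
  simp [dir]

theorem fderiv_tensor_dir_succ {a : ℝ → ℝ} {b : Plane → ℝ} (ha : ContDiff ℝ ∞ a)
    (hb : ContDiff ℝ ∞ b) (p : ℝ × Plane) (j : Fin 2) :
    fderiv ℝ (fun p : ℝ × Plane => a p.1 * b p.2) p (dir j.succ)
      = a p.1 * fderiv ℝ b p.2 (EuclideanSpace.single j 1) := by
  rw [fderiv_tensor ha hb]
  fin_cases j <;> simp [dir]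

theorem contDiff_fderiv_apply {b : Plane → ℝ} (hb : ContDiff ℝ ∞ b) (v : Plane) :
    ContDiff ℝ ∞ fun x => fderiv ℝ b x v :=
  (hb.fderiv_right (m := ∞) (by simp)).clm_apply contDiff_const

theorem hasCompactSupport_fderiv_apply' {b : Plane → ℝ} (hb : HasCompactSupport b) (v : Plane) :
    HasCompactSupport fun x => fderiv ℝ b x v :=
  hb.fderiv_apply (𝕜 := ℝ) v

theorem contDiff_deriv {a : ℝ → ℝ} (ha : ContDiff ℝ ∞ a) : ContDiff ℝ ∞ (deriv a) :=
  ((contDiff_infty_iff_deriv (𝕜 := ℝ)).mp ha).2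

theorem fderiv_fderiv_apply_comm {b : Plane → ℝ} (hb : ContDiff ℝ ∞ b) (v w x : Plane) :
    fderiv ℝ (fun y => fderiv ℝ b y v) x w = fderiv ℝ (fun y => fderiv ℝ b y w) x v := by
  have hd : DifferentiableAt ℝ (fderiv ℝ b) x :=
    (hb.fderiv_right (m := ∞) (by simp)).differentiable (by norm_num) x
  have h : ∀ v w : Plane, fderiv ℝ (fun y => fderiv ℝ b y v) x w = fderiv ℝ (fderiv ℝ b) x w v := by
    intro v w
    rw [fderiv_clm_apply hd (differentiableAt_const v)]
    simp
  rw [h, h]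
  exact (hb.contDiffAt.isSymmSndFDerivAt (by
    simpa using (WithTop.coe_le_coe.mpr le_top : ((2 : ℕ∞) : WithTop ℕ∞) ≤ ((⊤ : ℕ∞) : WithTop ℕ∞)))).eq w v

end TensorTests

/-! ### Complexification, and the Fourier transform under the z-integral -/

section Assembly

theorem norm_complexify (v : Vec) : ‖complexify v‖ = ‖v‖ := by
  simp [complexify, EuclideanSpace.norm_eq]

theorem continuous_complexify : Continuous complexify := by
  unfold complexify
  fun_prop

theorem memLp_complexify {X : Type*} [MeasurableSpace X] {μ : Measure X} {u : X → Vec}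
    (hu : MemLp u 2 μ) : MemLp (fun p => complexify (u p)) 2 μ :=
  hu.congr_norm (continuous_complexify.comp_aestronglyMeasurable hu.1)
    (.of_forall fun _ => (norm_complexify _).symm)

/-- The vertical complex vector with a given vertical component. -/
noncomputable def vertVec (r : ℝ) : CVec := EuclideanSpace.single 0 (r : ℂ)

theorem norm_vertVec (r : ℝ) : ‖vertVec r‖ = ‖r‖ := by
  simp [vertVec]

theorem continuous_vertVec : Continuous vertVec := by
  unfold vertVec
  refine (PiLp.continuous_toLp 2 _).comp ?_
  exact (continuous_single (0 : Fin 3)).comp Complex.continuous_ofReal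

theorem memLp_vertVec {X : Type*} [MeasurableSpace X] {μ : Measure X} {u : X → ℝ}
    (hu : MemLp u 2 μ) : MemLp (fun p => vertVec (u p)) 2 μ :=
  hu.congr_norm (continuous_vertVec.comp_aestronglyMeasurable hu.1)
    (.of_forall fun _ => (norm_vertVec _).symm)

theorem integral_smul_integral_slices_real {w : ℝ × Plane → CVec} (hw : MemLp w 2 halfVol)
    {S : ℝ → L2Vec} (hS : MemLp S 2 (volume.restrict (Ioi 0)))
    (hSw : ∀ᵐ z ∂(volume.restrict (Ioi (0 : ℝ))), S z =ᵐ[volume] fun x => w (z, x))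
    {c : ℝ → ℝ} {b : Plane → ℝ} (hc : MemLp c 2 (volume.restrict (Ioi 0))) (hb : MemLp b 2 volume)
    {α : CVec →L[ℂ] ℂ} {r : ℝ × Plane → ℝ} (hr : ∀ p, α (w p) = (r p : ℂ)) :
    ∫ x, b x • α ((∫ t in Ioi 0, c t • S t) x)
      = ((∫ p, c p.1 * b p.2 * r p ∂halfVol : ℝ) : ℂ) := by
  rw [halfVol_eq_prod] at hw ⊢
  rw [integral_smul_integral_slices hw hS hSw hc hb α, ← integral_complex_ofReal]
  simp [hr]

theorem fourier_integral_smul {μ : Measure ℝ} {S : ℝ → L2Vec} (hS : MemLp S 2 μ) {c : ℝ → ℝ}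
    (hc : MemLp c 2 μ) :
    FourierTransform.fourier (∫ t, c t • S t ∂μ)
      = ∫ t, c t • (FourierTransform.fourier (S t) : L2Vec) ∂μ := by
  have h := (Lp.fourierTransformₗᵢ Plane CVec).toContinuousLinearEquiv.toContinuousLinearMap
    |>.restrictScalars ℝ |>.integral_comp_comm (μ := μ) (φ := fun t => c t • S t)
    (memLp_one_iff_integrable.mp (hS.smul hc))
  refine Eq.trans h.symm ?_
  refine integral_congr_ae (.of_forall fun t => ?_)
  exact ((Lp.fourierTransformₗᵢ Plane CVec).toContinuousLinearEquiv.toContinuousLinearMap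
    |>.restrictScalars ℝ).map_smul (c t) (S t)

end Assembly

/-! ### Weak identities on tensor test functions -/

section Assembly

/-- Both sides are minus the integral of Ψ against the mixed derivative a' ∂_j b. The definition of
the weak gradient is used twice, with a' b in direction j and with a ∂_j b in direction z, and Ψ
disappears. -/
theorem HalfSpaceQG.IsWeakGradient.integral_tensor_comm {Ψ : ℝ × Plane → ℝ} {D : ℝ × Plane → Vec}
    (h : IsWeakGradient Ψ D) {a : ℝ → ℝ} {b : Plane → ℝ} (ha : ContDiff ℝ ∞ a)
    (hac : HasCompactSupport a) (has : tsupport a ⊆ Ioi 0) (hb : ContDiff ℝ ∞ b)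
    (hbc : HasCompactSupport b) (j : Fin 2) :
    ∫ p, deriv a p.1 * b p.2 * D p j.succ ∂halfVol
      = ∫ p, a p.1 * fderiv ℝ b p.2 (EuclideanSpace.single j 1) * D p 0 ∂halfVol := by
  have hb' := contDiff_fderiv_apply hb (EuclideanSpace.single j 1)
  have hbc' := hasCompactSupport_fderiv_apply' hbc (EuclideanSpace.single j 1)
  have h1 := h.integral_eq _ (isTest_tensor (contDiff_deriv ha) hac.deriv hb hbc)
    (tsupport_tensor_subset ((tsupport_deriv_subset).trans has)) j.succ
  have h2 := h.integral_eq _ (isTest_tensor ha hac hb' hbc')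
      (tsupport_tensor_subset (b := fun x => fderiv ℝ b x (EuclideanSpace.single j 1)) has) 0
  simp only [fderiv_tensor_dir_succ (contDiff_deriv ha) hb] at h1
  simp only [fderiv_tensor_dir_zero ha hb'] at h2
  have h3 := neg_injective (h1.symm.trans h2)
  simpa only [mul_comm, mul_left_comm] using h3

/-- The same elimination of Ψ, now by the symmetry of the second derivative of b. It is the weak
form of the vanishing of the horizontal curl. -/
theorem HalfSpaceQG.IsWeakGradient.integral_tensor_comm_horizontal {Ψ : ℝ × Plane → ℝ}
    {D : ℝ × Plane → Vec} (h : IsWeakGradient Ψ D) {a : ℝ → ℝ} {b : Plane → ℝ}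
    (ha : ContDiff ℝ ∞ a) (hac : HasCompactSupport a) (has : tsupport a ⊆ Ioi 0)
    (hb : ContDiff ℝ ∞ b) (hbc : HasCompactSupport b) (i j : Fin 2) :
    ∫ p, a p.1 * fderiv ℝ b p.2 (EuclideanSpace.single j 1) * D p i.succ ∂halfVol
      = ∫ p, a p.1 * fderiv ℝ b p.2 (EuclideanSpace.single i 1) * D p j.succ ∂halfVol := by
  have key : ∀ i j : Fin 2,
      ∫ p, Ψ p * (a p.1 * fderiv ℝ (fun y => fderiv ℝ b y (EuclideanSpace.single j 1)) p.2
        (EuclideanSpace.single i 1)) ∂halfVol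
      = -∫ p, D p i.succ * (a p.1 * fderiv ℝ b p.2 (EuclideanSpace.single j 1)) ∂halfVol := by
    intro i j
    have hb' := contDiff_fderiv_apply hb (EuclideanSpace.single j 1)
    have hbc' := hasCompactSupport_fderiv_apply' hbc (EuclideanSpace.single j 1)
    have h1 := h.integral_eq _ (isTest_tensor ha hac hb' hbc')
      (tsupport_tensor_subset (b := fun x => fderiv ℝ b x (EuclideanSpace.single j 1)) has) i.succ
    simpa only [fderiv_tensor_dir_succ ha hb'] using h1
  have h1 := key i j
  have h2 := key j i
  simp only [fderiv_fderiv_apply_comm hb (EuclideanSpace.single j 1)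
    (EuclideanSpace.single i 1)] at h1
  have h3 := neg_injective (h1.symm.trans h2)
  simpa only [mul_comm, mul_left_comm] using h3

theorem HalfSpaceQG.IsNormalTrace.integral_tensor {u : ℝ × Plane → Vec} {f : ℝ × Plane → ℝ}
    {g : Plane → ℝ} (h : IsNormalTrace u f g) (hu : MemLp u 2 halfVol)
    {a : ℝ → ℝ} {b : Plane → ℝ} (ha : ContDiff ℝ ∞ a) (hac : HasCompactSupport a)
    (hb : ContDiff ℝ ∞ b) (hbc : HasCompactSupport b) :
    (∫ p, deriv a p.1 * b p.2 * u p 0 ∂halfVol)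
      + ∑ j : Fin 2, ∫ p, a p.1 * fderiv ℝ b p.2 (EuclideanSpace.single j 1) * u p j.succ ∂halfVol
      = -(∫ p, a p.1 * b p.2 * f p ∂halfVol) + a 0 * ∫ x, b x * g x := by
  have hui : ∀ i, MemLp (fun p => u p i) 2 halfVol := fun i =>
    (EuclideanSpace.proj (𝕜 := ℝ) i).comp_memLp' hu
  have hint : ∀ (a : ℝ → ℝ) (b : Plane → ℝ), Continuous a → HasCompactSupport a → Continuous b →
      HasCompactSupport b → ∀ i, Integrable (fun p : ℝ × Plane => a p.1 * b p.2 * u p i) halfVol := by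
    intro a b ha hac hb hbc i
    have h2 : MemLp (fun p : ℝ × Plane => a p.1 * b p.2) 2 halfVol := by
      rw [halfVol_eq_prod]
      exact memLp_two_mul_prod (ha.memLp_of_hasCompactSupport hac)
        (hb.memLp_of_hasCompactSupport hbc)
    exact memLp_one_iff_integrable.mp ((hui i).mul h2)
  have h1 := h _ (isTest_tensor ha hac hb hbc)
  simp only [Fin.sum_univ_succ (n := 2), fderiv_tensor_dir_succ ha hb,
    fderiv_tensor_dir_zero ha hb] at h1
  rw [← integral_const_mul]
  have hI := hint _ _ (contDiff_deriv ha).continuous hac.deriv hb.continuous hbc 0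
  have hJ := fun j : Fin 2 => hint _ _ ha.continuous hac
    (contDiff_fderiv_apply hb (EuclideanSpace.single j 1)).continuous
    (hasCompactSupport_fderiv_apply' hbc (EuclideanSpace.single j 1)) j.succ
  rw [← integral_finsetSum _ fun j _ => hJ j,
    ← integral_add hI (integrable_finsetSum _ fun j _ => hJ j)]
  convert h1 using 1
  · refine integral_congr_ae (.of_forall fun p => ?_)
    simp [Fin.sum_univ_two]
    ring
  · congr 2
    · congr 1
      ext p
      ring
    · ext p
      ring

end Assembly

/-! ### The frequency system from the weak formulation -/

section Assembly

variable {u : ℝ × Plane → Vec} {f : ℝ × Plane → ℝ} {g : Plane → ℝ}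

/-- The `L²` functions `S z` are the slices of `w`. -/
structure IsSlice (w : ℝ × Plane → CVec) (S : ℝ → L2Vec) : Prop where
  memLp_fun : MemLp w 2 halfVol
  memLp : MemLp S 2 (volume.restrict (Ioi 0))
  slice_eq : ∀ᵐ z ∂(volume.restrict (Ioi (0 : ℝ))), S z =ᵐ[volume] fun x => w (z, x)
  norm_eq : eLpNorm S 2 (volume.restrict (Ioi 0)) = eLpNorm w 2 halfVol

theorem exists_isSlice {w : ℝ × Plane → CVec} (hw : MemLp w 2 halfVol) : ∃ S, IsSlice w S := by
  obtain ⟨S, h1, h2, h3⟩ := exists_memLp_slices (by rwa [halfVol_eq_prod] at hw)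
  exact ⟨S, hw, h1, h2, by rw [h3, halfVol_eq_prod]⟩

theorem memLp_two_of_hasCompactSupport {X : Type*} [TopologicalSpace X] [MeasurableSpace X]
    [OpensMeasurableSpace X] {μ : Measure X} [IsFiniteMeasureOnCompacts μ] {a : X → ℝ}
    (ha : Continuous a) (hac : HasCompactSupport a) : MemLp a 2 μ :=
  ha.memLp_of_hasCompactSupport hac

theorem inner_single_plane (ξ : Plane) (j : Fin 2) :
    ((inner ℝ ξ (EuclideanSpace.single j (1 : ℝ)) : ℝ) : ℂ) = (ξ j : ℂ) := by
  rw [EuclideanSpace.inner_single_right]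
  simp

/-- The normal trace formula on a(z) b(x) is a first-order weak identity in x, with coefficients
obtained by integrating out z. The source and the trace are stored as vertical vectors, so that all
data live in one L² space. -/
theorem IsSlice.div_eq {S SF : ℝ → L2Vec} {SG : L2Vec} (hS : IsSlice (fun p => complexify (u p)) S)
    (hSF : IsSlice (fun p => vertVec (f p)) SF) (hSG : SG =ᵐ[volume] fun x => vertVec (g x))
    (hu : MemLp u 2 halfVol) (htr : IsNormalTrace u f g) {a : ℝ → ℝ} (ha : ContDiff ℝ ∞ a)
    (hac : HasCompactSupport a) :
    ∀ᵐ ξ, ((∫ t in Ioi 0, deriv a t • (FourierTransform.fourier (S t) : L2Vec))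
        + (∫ t in Ioi 0, a t • (FourierTransform.fourier (SF t) : L2Vec))
        - a 0 • (FourierTransform.fourier SG : L2Vec)) ξ 0
      = 2 * Real.pi * Complex.I * ∑ j : Fin 2,
        (ξ j : ℂ) * (∫ t in Ioi 0, a t • (FourierTransform.fourier (S t) : L2Vec)) ξ j.succ := by
  have ha' : MemLp (deriv a) 2 (volume.restrict (Ioi 0)) :=
    memLp_two_of_hasCompactSupport (contDiff_deriv ha).continuous hac.deriv
  have ha0 : MemLp a 2 (volume.restrict (Ioi 0)) := memLp_two_of_hasCompactSupport ha.continuous hac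
  have hF := fourier_of_weak_identity (fun j : Fin 2 => EuclideanSpace.single j (1 : ℝ))
    ((∫ t in Ioi 0, deriv a t • S t) + (∫ t in Ioi 0, a t • SF t) - a 0 • SG)
    (∫ t in Ioi 0, a t • S t) (EuclideanSpace.proj 0) (fun j => EuclideanSpace.proj j.succ) ?_
  · have e : (FourierTransform.fourier ((∫ t in Ioi 0, deriv a t • S t)
          + (∫ t in Ioi 0, a t • SF t) - a 0 • SG) : L2Vec)
          = (∫ t in Ioi 0, deriv a t • (FourierTransform.fourier (S t) : L2Vec))
            + (∫ t in Ioi 0, a t • (FourierTransform.fourier (SF t) : L2Vec))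
            - a 0 • (FourierTransform.fourier SG : L2Vec) := by
      rw [← fourier_integral_smul hS.memLp ha', ← fourier_integral_smul hSF.memLp ha0]
      set L := (Lp.fourierTransformₗᵢ Plane CVec).toContinuousLinearEquiv.toContinuousLinearMap
        |>.restrictScalars ℝ
      exact (L.map_sub _ _).trans (congrArg₂ _ (L.map_add _ _) (L.map_smul _ _))
    rw [e, fourier_integral_smul hS.memLp ha0] at hF
    filter_upwards [hF] with ξ hξ
    simpa only [inner_single_plane, EuclideanSpace.coe_proj] using hξ
  · intro b hb hbc
    have hb2 : MemLp b 2 (volume : Measure Plane) := memLp_two_of_hasCompactSupport hb.continuous hbc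
    obtain ⟨T, hT⟩ := exists_clm_integral_smul hb2 (EuclideanSpace.proj (𝕜 := ℂ) (0 : Fin 3))
    have h1 : T SG = ((∫ x, b x * g x : ℝ) : ℂ) := by
      rw [hT, ← integral_complex_ofReal]
      refine integral_congr_ae ?_
      filter_upwards [hSG] with x hx
      simp [hx, vertVec]
    have h2 := integral_smul_integral_slices_real hS.memLp_fun hS.memLp hS.slice_eq ha' hb2
      (α := EuclideanSpace.proj 0) (r := fun p => u p 0) fun p => rfl
    have h3 := integral_smul_integral_slices_real hSF.memLp_fun hSF.memLp hSF.slice_eq ha0 hb2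
      (α := EuclideanSpace.proj 0) (r := f) fun p => by simp [vertVec]
    have h4 := fun j : Fin 2 => integral_smul_integral_slices_real hS.memLp_fun hS.memLp hS.slice_eq
      ha0 (memLp_two_of_hasCompactSupport
        (contDiff_fderiv_apply hb (EuclideanSpace.single j 1)).continuous
        (hasCompactSupport_fderiv_apply' hbc (EuclideanSpace.single j 1)))
      (α := EuclideanSpace.proj j.succ) (r := fun p => u p j.succ) fun p => rfl
    have h5 := htr.integral_tensor hu ha hac hb hbc
    rw [← hT, map_sub, map_add, map_smul, h1, hT, hT, h2, h3]
    simp only [h4]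
    rw [Complex.real_smul, ← Complex.ofReal_mul, ← Complex.ofReal_add, ← Complex.ofReal_sub,
      ← Complex.ofReal_sum, ← Complex.ofReal_add, Complex.ofReal_eq_zero]
    linarith

/-- The weak identity expresses ∂_z ∂_jΨ = ∂_j ∂_zΨ with ∂_zΨ = λ⁻¹ u₀. The factor λ⁻¹ is put on the
z-weight, which only has to be square integrable. -/
theorem IsSlice.vertical_eq {Ψ : ℝ × Plane → ℝ} {D : ℝ × Plane → Vec} {lam : ℝ → ℝ} {S : ℝ → L2Vec}
    (hS : IsSlice (fun p => complexify (u p)) S) (h : IsWeakGradient Ψ D)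
    (huD : ∀ (p : ℝ × Plane) (j : Fin 2), u p j.succ = D p j.succ)
    (huD0 : ∀ᵐ p ∂halfVol, (lam p.1)⁻¹ * u p 0 = D p 0) {a : ℝ → ℝ} (ha : ContDiff ℝ ∞ a)
    (hac : HasCompactSupport a) (has : tsupport a ⊆ Ioi 0)
    (hal : MemLp (fun t => a t * (lam t)⁻¹) 2 (volume.restrict (Ioi 0))) (j : Fin 2) :
    ∀ᵐ ξ, (∫ t in Ioi 0, deriv a t • (FourierTransform.fourier (S t) : L2Vec)) ξ j.succ
      = -(2 * Real.pi * Complex.I * ((ξ j : ℂ)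
        * (∫ t in Ioi 0, (a t * (lam t)⁻¹) • (FourierTransform.fourier (S t) : L2Vec)) ξ 0)) := by
  have ha' : MemLp (deriv a) 2 (volume.restrict (Ioi 0)) :=
    memLp_two_of_hasCompactSupport (contDiff_deriv ha).continuous hac.deriv
  have hF := fourier_of_weak_identity (fun _ : Unit => EuclideanSpace.single j (1 : ℝ))
    (∫ t in Ioi 0, deriv a t • S t) (∫ t in Ioi 0, (a t * (lam t)⁻¹) • S t)
    (EuclideanSpace.proj j.succ) (fun _ => -EuclideanSpace.proj 0) ?_
  · rw [fourier_integral_smul hS.memLp ha', fourier_integral_smul hS.memLp hal] at hF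
    filter_upwards [hF] with ξ hξ
    simpa only [inner_single_plane, EuclideanSpace.coe_proj, Finset.univ_unique,
      Finset.sum_singleton, neg_apply, mul_neg] using hξ
  · intro b hb hbc
    have hb2 : MemLp b 2 (volume : Measure Plane) := memLp_two_of_hasCompactSupport hb.continuous hbc
    have h2 := integral_smul_integral_slices_real hS.memLp_fun hS.memLp hS.slice_eq ha' hb2
      (α := EuclideanSpace.proj j.succ) (r := fun p => u p j.succ) fun p => rfl
    have h3 := integral_smul_integral_slices_real hS.memLp_fun hS.memLp hS.slice_eq
      hal (memLp_two_of_hasCompactSupport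
        (contDiff_fderiv_apply hb (EuclideanSpace.single j 1)).continuous
        (hasCompactSupport_fderiv_apply' hbc (EuclideanSpace.single j 1)))
      (α := -EuclideanSpace.proj 0) (r := fun p => -u p 0) fun p => by
        rw [Complex.ofReal_neg]; rfl
    simp only [Finset.univ_unique, Finset.sum_singleton]
    rw [h2, h3, ← Complex.ofReal_add, Complex.ofReal_eq_zero]
    simp only [huD, mul_neg, integral_neg]
    rw [h.integral_tensor_comm ha hac has hb hbc j, add_neg_eq_zero]
    refine integral_congr_ae ?_
    filter_upwards [huD0] with p hp
    rw [← hp]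
    ring

theorem IsSlice.curl_eq {Ψ : ℝ × Plane → ℝ} {D : ℝ × Plane → Vec} {S : ℝ → L2Vec}
    (hS : IsSlice (fun p => complexify (u p)) S) (h : IsWeakGradient Ψ D)
    (huD : ∀ (p : ℝ × Plane) (j : Fin 2), u p j.succ = D p j.succ)
    {a : ℝ → ℝ} (ha : ContDiff ℝ ∞ a) (hac : HasCompactSupport a) (has : tsupport a ⊆ Ioi 0) :
    ∀ᵐ ξ, (ξ 0 : ℂ) * (∫ t in Ioi 0, a t • (FourierTransform.fourier (S t) : L2Vec)) ξ 2
      = (ξ 1 : ℂ) * (∫ t in Ioi 0, a t • (FourierTransform.fourier (S t) : L2Vec)) ξ 1 := by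
  have ha0 : MemLp a 2 (volume.restrict (Ioi 0)) := memLp_two_of_hasCompactSupport ha.continuous hac
  have hF := fourier_of_weak_identity (fun j : Fin 2 => EuclideanSpace.single j (1 : ℝ))
    (0 : L2Vec) (∫ t in Ioi 0, a t • S t) 0 ![EuclideanSpace.proj 2, -EuclideanSpace.proj 1] ?_
  · rw [fourier_integral_smul hS.memLp ha0] at hF
    filter_upwards [hF] with ξ hξ
    simp only [inner_single_plane, zero_apply, Fin.sum_univ_two,
      Matrix.cons_val_zero, Matrix.cons_val_one, EuclideanSpace.coe_proj,
      neg_apply, mul_neg] at hξ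
    rcases mul_eq_zero.mp hξ.symm with h0 | h0
    · exact absurd h0 Complex.two_pi_I_ne_zero
    · exact add_neg_eq_zero.mp h0
  · intro b hb hbc
    have h4 := fun (j : Fin 2) (i : Fin 3) =>
      integral_smul_integral_slices_real hS.memLp_fun hS.memLp hS.slice_eq
      ha0 (memLp_two_of_hasCompactSupport
        (contDiff_fderiv_apply hb (EuclideanSpace.single j 1)).continuous
        (hasCompactSupport_fderiv_apply' hbc (EuclideanSpace.single j 1)))
      (α := EuclideanSpace.proj i) (r := fun p => u p i) fun p => rfl
    have h5 := h.integral_tensor_comm_horizontal ha hac has hb hbc 0 1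
    simp only [← huD] at h5
    simp only [zero_apply, smul_zero, integral_zero, zero_add, Fin.sum_univ_two,
      Matrix.cons_val_zero, Matrix.cons_val_one, neg_apply, smul_neg,
      integral_neg, h4]
    rw [add_neg_eq_zero, Complex.ofReal_inj]
    exact h5.symm

theorem memLp_mul_inv_of_bound {lam : ℝ → ℝ} {Lam : ℝ} (hLam : 0 < Lam) {μ : Measure ℝ}
    [IsFiniteMeasureOnCompacts μ] (hlm : AEMeasurable lam μ)
    (hlam : ∀ᵐ z ∂μ, 1 / Lam ≤ lam z ∧ lam z ≤ Lam) {a : ℝ → ℝ} (ha : Continuous a)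
    (hac : HasCompactSupport a) : MemLp (fun t => a t * (lam t)⁻¹) 2 μ := by
  refine ((memLp_two_of_hasCompactSupport ha hac).const_mul Lam).mono
    (ha.aestronglyMeasurable.mul hlm.inv.aestronglyMeasurable) ?_
  filter_upwards [hlam] with t ht
  have hpos : 0 < lam t := lt_of_lt_of_le (by positivity) ht.1
  rw [norm_mul, norm_mul, mul_comm, Real.norm_of_nonneg (inv_nonneg.mpr hpos.le),
    Real.norm_of_nonneg hLam.le]
  refine mul_le_mul_of_nonneg_right (inv_le_of_inv_le₀ hLam ?_) (norm_nonneg _)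
  simpa using ht.1

/-- The Fourier transforms in the horizontal variables of the slices of `∇_λ Ψ` and of the data
solve the frequency system. -/
theorem HalfSpaceQG.IsWeakGradient.exists_frequencySystem {lam : ℝ → ℝ} {Lam : ℝ} (hLam : 0 < Lam)
    (hlm : AEMeasurable lam (volume.restrict (Ioi 0)))
    (hlam : ∀ᵐ z ∂(volume.restrict (Ioi (0 : ℝ))), 1 / Lam ≤ lam z ∧ lam z ≤ Lam)
    {Ψ : ℝ × Plane → ℝ} {D : ℝ × Plane → Vec}
    (h : IsWeakGradient Ψ D) (hu : MemLp (lambdaGrad lam D) 2 halfVol) (hf : MemLp f 2 halfVol)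
    (htr : IsNormalTrace (lambdaGrad lam D) f g) (hg : MemLp g 2 volume) :
    ∃ (S U F : ℝ → L2Vec) (SG G : L2Vec), IsFrequencySystem lam U F G ∧
      (∀ z, U z = FourierTransform.fourier (S z)) ∧ G = FourierTransform.fourier SG ∧
      (∀ᵐ z ∂(volume.restrict (Ioi (0 : ℝ))),
        S z =ᵐ[volume] fun x => complexify (lambdaGrad lam D (z, x))) ∧
      (SG =ᵐ[volume] fun x => vertVec (g x)) ∧
      ENNReal.ofReal (dataNorm U F G) = eLpNorm g 2 volume + eLpNorm f 2 halfVol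
        + eLpNorm (lambdaGrad lam D) 2 halfVol := by
  obtain ⟨S, hS⟩ := exists_isSlice (memLp_complexify hu)
  obtain ⟨SF, hSF⟩ := exists_isSlice (memLp_vertVec hf)
  have hwg := memLp_vertVec hg
  have hSG : hwg.toLp _ =ᵐ[volume] fun x => vertVec (g x) := hwg.coeFn_toLp
  have hisom : ∀ v : L2Vec, ‖(FourierTransform.fourier v : L2Vec)‖ = ‖v‖ := fun v =>
    (Lp.fourierTransformₗᵢ Plane CVec).norm_map v
  have hmem : ∀ {S : ℝ → L2Vec}, MemLp S 2 (volume.restrict (Ioi 0)) →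
      MemLp (fun z => (FourierTransform.fourier (S z) : L2Vec)) 2 (volume.restrict (Ioi 0)) :=
    fun hS => hS.congr_norm ((Lp.fourierTransformₗᵢ Plane CVec).continuous.comp_aestronglyMeasurable
      hS.1) (.of_forall fun z => (hisom _).symm)
  have hnorm : ∀ {S : ℝ → L2Vec}, eLpNorm (fun z => (FourierTransform.fourier (S z) : L2Vec)) 2
      (volume.restrict (Ioi 0)) = eLpNorm S 2 (volume.restrict (Ioi 0)) := fun {S} =>
    eLpNorm_congr_norm_ae (.of_forall fun z => hisom _)
  have hsucc : ∀ (p : ℝ × Plane) (j : Fin 2), lambdaGrad lam D p j.succ = D p j.succ := by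
    intro p j
    fin_cases j <;> rfl
  have hD0 : ∀ᵐ p ∂halfVol, (lam p.1)⁻¹ * lambdaGrad lam D p 0 = D p 0 := by
    rw [halfVol_eq_prod]
    filter_upwards [Measure.quasiMeasurePreserving_fst.ae hlam] with p hp
    have hpos : 0 < lam p.1 := lt_of_lt_of_le (by positivity) hp.1
    change (lam p.1)⁻¹ * (lam p.1 * D p 0) = D p 0
    field_simp
  refine ⟨S, fun z => FourierTransform.fourier (S z), fun z => FourierTransform.fourier (SF z),
    hwg.toLp _, FourierTransform.fourier (hwg.toLp _), ⟨hmem hS.memLp, hmem hSF.memLp,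
    fun a ha hac => hS.div_eq hSF hSG hu htr ha hac, fun a ha hac has j =>
      hS.vertical_eq h hsucc hD0 ha hac has
        (memLp_mul_inv_of_bound hLam hlm hlam ha.continuous hac) j,
    fun a ha hac has => hS.curl_eq h hsucc ha hac has⟩, fun _ => rfl, rfl, hS.slice_eq, hSG, ?_⟩
  have e1 : eLpNorm (fun p => complexify (lambdaGrad lam D p)) 2 halfVol
      = eLpNorm (lambdaGrad lam D) 2 halfVol :=
    eLpNorm_congr_norm_ae (.of_forall fun p => norm_complexify _)
  have e2 : eLpNorm (fun p => vertVec (f p)) 2 halfVol = eLpNorm f 2 halfVol :=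
    eLpNorm_congr_norm_ae (.of_forall fun p => norm_vertVec _)
  have e3 : eLpNorm (fun p => vertVec (g p)) 2 volume = eLpNorm g 2 volume :=
    eLpNorm_congr_norm_ae (.of_forall fun p => norm_vertVec _)
  rw [dataNorm, hnorm, hnorm, hisom, Lp.norm_toLp, hS.norm_eq, hSF.norm_eq, e1, e2, e3,
    ENNReal.ofReal_add (by positivity) (by positivity), ENNReal.ofReal_add (by positivity)
    (by positivity), ENNReal.ofReal_toReal hu.2.ne, ENNReal.ofReal_toReal hf.2.ne,
    ENNReal.ofReal_toReal hg.2.ne]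
  ring

end Assembly

/-! ### The inverse Fourier transform on L¹ ∩ L² -/

section SupBound

theorem continuous_neg_innerₗ {V : Type*} [NormedAddCommGroup V] [InnerProductSpace ℝ V] :
    Continuous fun p : V × V => (-innerₗ V) p.1 p.2 := by
  change Continuous fun p : V × V => -inner ℝ p.1 p.2
  exact continuous_inner.neg

open scoped SchwartzMap FourierTransform

variable {V F : Type*} [NormedAddCommGroup V] [InnerProductSpace ℝ V] [FiniteDimensional ℝ V]
  [MeasurableSpace V] [BorelSpace V] [NormedAddCommGroup F] [InnerProductSpace ℂ F]

theorem norm_fourierInv_le_integral_norm (v : V → F) (x : V) : ‖𝓕⁻ v x‖ ≤ ∫ ξ, ‖v ξ‖ := by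
  rw [Real.fourierInv_eq]
  refine (norm_integral_le_integral_norm _).trans_eq ?_
  simp_rw [Circle.norm_smul]

variable [CompleteSpace F]

theorem integral_fourierInv_schwartz_smul (c : 𝓢(V, ℂ)) {v : V → F} (hv : Integrable v) :
    ∫ ξ, (𝓕⁻ c) ξ • v ξ = ∫ x, c x • 𝓕⁻ v x := by
  have h := VectorFourier.integral_fourierIntegral_smul_eq_flip (L := -innerₗ V) (μ := volume)
    (ν := volume) Real.continuous_fourierChar continuous_neg_innerₗ
    (SchwartzMap.integrable c) hv
  have e : (-innerₗ V).flip = -innerₗ V := by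
    ext x y
    simp [real_inner_comm]
  rw [e] at h
  rw [SchwartzMap.fourierInv_coe]
  exact h

/-- On `L¹ ∩ L²` the inverse Fourier transform is bounded by the `L¹` norm. -/
theorem norm_fourierInv_le_of_integrable (v : Lp F 2 (volume : Measure V)) (hv : Integrable v) :
    ∀ᵐ x, ‖(𝓕⁻ v : Lp F 2 (volume : Measure V)) x‖ ≤ ∫ ξ, ‖v ξ‖ := by
  have hc : Continuous (𝓕⁻ (v : V → F)) := by
    have := VectorFourier.fourierIntegral_continuous (L := -innerₗ V) Real.continuous_fourierChar
      continuous_neg_innerₗ hv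
    simpa using! this
  -- The inverse transform in L² and the one given by the integral have the same pairings with test
  -- functions, hence agree almost everywhere. The integral formula then gives the bound.
  have h := ae_eq_of_integral_contDiff_smul_eq (μ := volume)
    ((Lp.memLp (𝓕⁻ v : Lp F 2 (volume : Measure V))).locallyIntegrable (by norm_num))
    hc.locallyIntegrable (fun b hb hbc => ?_)
  · filter_upwards [h] with x hx
    rw [hx]
    exact norm_fourierInv_le_integral_norm _ _
  · have hg₁ : HasCompactSupport (Complex.ofRealCLM ∘ b) := hbc.comp_left rfl
    have hg₂ : ContDiff ℝ ∞ (Complex.ofRealCLM ∘ b) := Complex.ofRealCLM.contDiff.comp hb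
    set c : 𝓢(V, ℂ) := hg₁.toSchwartzMap hg₂
    have hcb : ∀ x, c x = (b x : ℂ) := fun x => rfl
    have h1 := congrArg (fun T => T c) (Lp.fourierInv_toTemperedDistribution_eq v)
    simp only [TemperedDistribution.fourierInv_apply, Lp.toTemperedDistribution_apply] at h1
    rw [integral_fourierInv_schwartz_smul c hv] at h1
    simp only [hcb, Complex.coe_smul] at h1
    exact h1.symm

end SupBound

/-! ### Integral of |ξ|⁻¹ over discs of the plane -/

section FractionalEmbedding

theorem integrableOn_inv_norm (A : ℝ) : IntegrableOn (fun ξ : Plane => ‖ξ‖⁻¹) (Metric.ball 0 A) := by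
  rw [integrableOn_fun_norm_addHaar volume (f := fun y : ℝ => y⁻¹)]
  have : IntegrableOn (fun _ : ℝ => (1 : ℝ)) (Ioo 0 A) := by simp
  refine this.congr_fun (fun y hy => ?_) measurableSet_Ioo
  simp [ne_of_gt hy.1]

theorem integral_inv_norm {A : ℝ} (hA : 0 ≤ A) :
    ∫ ξ in Metric.ball (0 : Plane) A, ‖ξ‖⁻¹ = 2 * Real.pi * A := by
  have h := integral_fun_norm_addHaar (volume : Measure Plane) ((Iio A).indicator fun y : ℝ => y⁻¹)
  have e : (fun ξ : Plane => (Iio A).indicator (fun y : ℝ => y⁻¹) ‖ξ‖)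
      = (Metric.ball (0 : Plane) A).indicator fun ξ => ‖ξ‖⁻¹ := by
    ext ξ
    simp [indicator]
  rw [e, integral_indicator measurableSet_ball] at h
  rw [h]
  have e2 : ∫ y in Ioi (0 : ℝ), y ^ (Module.finrank ℝ Plane - 1) • (Iio A).indicator
      (fun y : ℝ => y⁻¹) y = ∫ y in Ioo 0 A, (1 : ℝ) := by
    rw [← Ioi_inter_Iio, ← setIntegral_indicator measurableSet_Iio]
    refine setIntegral_congr_fun measurableSet_Ioi fun y hy => ?_
    have hy' : y ≠ 0 := ne_of_gt hy
    by_cases h : y < A <;> simp [h, hy']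
  rw [e2]
  simp [Measure.real, hA, Real.pi_nonneg]
  ring

end FractionalEmbedding

/-! ### The embedding of H^{1/2}(ℝ²) in L⁴(ℝ²) -/

section FractionalEmbedding

open scoped FourierTransform

variable {v : L2Vec} {M : ℝ}

/-- The weighted inequality |v| ≤ (M²/t)|ξ|⁻¹ + (t/4M²)|ξ||v|² splits the L¹ norm into two parts of
size at most t/4. The radius is chosen so that (M²/t) times the integral 2πA of |ξ|⁻¹ over the disc
of radius A equals t/4. -/
theorem integrable_lowFreq (hM : 0 < M) (hv : Integrable fun ξ => ‖ξ‖ * ‖v ξ‖ ^ 2)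
    (hvM : ∫ ξ, ‖ξ‖ * ‖v ξ‖ ^ 2 ≤ M ^ 2) {t : ℝ} (ht : 0 < t) :
    Integrable (freqCut (Metric.ball 0 (t ^ 2 / (8 * Real.pi * M ^ 2))) measurableSet_ball v) ∧
    ∫ ξ, ‖freqCut (Metric.ball 0 (t ^ 2 / (8 * Real.pi * M ^ 2))) measurableSet_ball v ξ‖
      ≤ t / 2 := by
  set A := t ^ 2 / (8 * Real.pi * M ^ 2) with hA
  have hA0 : 0 ≤ A := by positivity
  set w := freqCut (Metric.ball 0 A) measurableSet_ball v
  set φ : Plane → ℝ := fun ξ => M ^ 2 / t * (Metric.ball (0 : Plane) A).indicator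
    (fun ξ => ‖ξ‖⁻¹) ξ + t / (4 * M ^ 2) * (‖ξ‖ * ‖v ξ‖ ^ 2)
  have hi1 : Integrable ((Metric.ball (0 : Plane) A).indicator fun ξ => ‖ξ‖⁻¹) :=
    (integrable_indicator_iff measurableSet_ball).mpr (integrableOn_inv_norm A)
  have hφ : Integrable φ := (hi1.const_mul _).add (hv.const_mul _)
  have hne : ∀ᵐ ξ : Plane, ξ ≠ 0 := by
    rw [ae_iff]
    simp
  have hle : ∀ᵐ ξ, ‖w ξ‖ ≤ φ ξ := by
    filter_upwards [coeFn_freqCut (measurableSet_ball (x := (0 : Plane)) (ε := A)) v, hne] with ξ h h0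
    have hr : 0 < ‖ξ‖ := norm_pos_iff.mpr h0
    simp only [w, h, φ]
    by_cases hξ : ξ ∈ Metric.ball (0 : Plane) A
    · rw [indicator_of_mem hξ, indicator_of_mem hξ]
      have e : M ^ 2 / t * ‖ξ‖⁻¹ + t / (4 * M ^ 2) * (‖ξ‖ * ‖v ξ‖ ^ 2) - ‖v ξ‖
          = M ^ 2 / (t * ‖ξ‖) * (1 - t * ‖ξ‖ / (2 * M ^ 2) * ‖v ξ‖) ^ 2 := by
        field_simp
        ring
      have : 0 ≤ M ^ 2 / (t * ‖ξ‖) * (1 - t * ‖ξ‖ / (2 * M ^ 2) * ‖v ξ‖) ^ 2 := by positivity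
      linarith
    · rw [indicator_of_notMem hξ, indicator_of_notMem hξ, norm_zero]
      positivity
  refine ⟨hφ.mono' (Lp.aestronglyMeasurable _) hle, ?_⟩
  refine (integral_mono_ae (hφ.mono' (Lp.aestronglyMeasurable _) hle).norm hφ hle).trans ?_
  simp only [φ]
  rw [integral_add (hi1.const_mul _) (hv.const_mul _), integral_const_mul, integral_const_mul,
    integral_indicator measurableSet_ball, integral_inv_norm hA0]
  have h1 : M ^ 2 / t * (2 * Real.pi * A) = t / 4 := by
    rw [hA]
    field_simp
    norm_num
  have h2 : t / (4 * M ^ 2) * ∫ ξ, ‖ξ‖ * ‖v ξ‖ ^ 2 ≤ t / (4 * M ^ 2) * M ^ 2 :=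
    mul_le_mul_of_nonneg_left hvM (by positivity)
  have h3 : t / (4 * M ^ 2) * M ^ 2 = t / 4 := by field_simp
  linarith

/-- Frequencies below the level-dependent radius contribute at most t/2 pointwise, so where the
function exceeds t the high-frequency part exceeds t/2. Chebyshev's inequality in L² and Plancherel
bound the measure of that set. -/
theorem volume_superlevel_fourierInv_le (hM : 0 < M)
    (hv : Integrable fun ξ => ‖ξ‖ * ‖v ξ‖ ^ 2) (hvM : ∫ ξ, ‖ξ‖ * ‖v ξ‖ ^ 2 ≤ M ^ 2) {t : ℝ}
    (ht : 0 < t) :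
    volume {x | t < ‖(𝓕⁻ v : L2Vec) x‖} ≤ ENNReal.ofReal (4 / t ^ 2)
      * ∫⁻ ξ in (Metric.ball 0 (t ^ 2 / (8 * Real.pi * M ^ 2)))ᶜ, ‖v ξ‖ₑ ^ 2 := by
  set B : Set Plane := Metric.ball 0 (t ^ 2 / (8 * Real.pi * M ^ 2))
  have hB : MeasurableSet B := measurableSet_ball
  obtain ⟨h1, h2⟩ := integrable_lowFreq hM hv hvM ht
  set lo := freqCut B hB v
  set hi := freqCut Bᶜ hB.compl v
  have hsum : v = lo + hi := by
    have := freqCut_sub_freqCut hB MeasurableSet.univ (subset_univ _) v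
    simp only [← compl_eq_univ_sdiff] at this
    rw [freqCut_univ] at this
    rw [← sub_eq_iff_eq_add']
    exact this
  have hF : (𝓕⁻ v : L2Vec) = 𝓕⁻ lo + 𝓕⁻ hi := by
    conv_lhs => rw [hsum]
    exact (Lp.fourierTransformₗᵢ Plane CVec).symm.map_add lo hi
  have hsub : ∀ᵐ x, x ∈ {x | t < ‖(𝓕⁻ v : L2Vec) x‖} →
      x ∈ {x | ENNReal.ofReal (t / 2) ≤ ‖(𝓕⁻ hi : L2Vec) x‖ₑ} := by
    filter_upwards [norm_fourierInv_le_of_integrable lo h1,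
      Lp.coeFn_add (𝓕⁻ lo : L2Vec) (𝓕⁻ hi : L2Vec)] with x hx1 hx2 hx
    rw [hF] at hx
    simp only [hx2, Pi.add_apply] at hx
    have h3 := norm_add_le ((𝓕⁻ lo : L2Vec) x) ((𝓕⁻ hi : L2Vec) x)
    rw [← ofReal_norm]
    refine ENNReal.ofReal_le_ofReal ?_
    have := hx1.trans h2
    linarith
  refine (measure_mono_ae hsub).trans ((meas_ge_le_mul_pow_eLpNorm_enorm volume (p := 2) (by norm_num)
    (by norm_num) (Lp.aestronglyMeasurable _) (by simpa using ht) (by simp)).trans ?_)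
  have e1 : (ENNReal.ofReal (t / 2))⁻¹ ^ (2 : ℝ≥0∞).toReal = ENNReal.ofReal (4 / t ^ 2) := by
    rw [← ENNReal.ofReal_inv_of_pos (by positivity), ENNReal.toReal_ofNat, ENNReal.rpow_ofNat,
      ← ENNReal.ofReal_pow (by positivity)]
    congr 1
    field_simp
    norm_num
  have e2 : eLpNorm (𝓕⁻ hi : L2Vec) 2 volume ^ (2 : ℝ≥0∞).toReal = ∫⁻ ξ in Bᶜ, ‖v ξ‖ₑ ^ 2 := by
    have : ‖(𝓕⁻ hi : L2Vec)‖ₑ = ‖hi‖ₑ := by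
      rw [← ofReal_norm, ← ofReal_norm]
      exact congrArg _ ((Lp.fourierTransformₗᵢ Plane CVec).symm.norm_map hi)
    rw [ENNReal.toReal_ofNat, ENNReal.rpow_ofNat, ← Lp.enorm_def, this, Lp_enorm_sq_eq_lintegral,
      ← lintegral_indicator hB.compl]
    refine lintegral_congr_ae ?_
    filter_upwards [coeFn_freqCut hB.compl v] with ξ h
    rw [h]
    by_cases hξ : ξ ∈ B <;> simp [hξ]
  rw [e1, e2]

/-- Layer cake: insert the superlevel bound into 4 ∫ t³ |{|S| > t}| dt and exchange the integrals.
For fixed ξ only t² ≤ 8πM²|ξ| contributes, which produces the weight 16πM²|ξ| and restores the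
H^{1/2} integral. -/
theorem lintegral_fourierInv_pow_four_le (hM : 0 < M)
    (hv : Integrable fun ξ => ‖ξ‖ * ‖v ξ‖ ^ 2) (hvM : ∫ ξ, ‖ξ‖ * ‖v ξ‖ ^ 2 ≤ M ^ 2) :
    ∫⁻ x, ‖(𝓕⁻ v : L2Vec) x‖ₑ ^ 4 ≤ ENNReal.ofReal (64 * Real.pi * M ^ 4) := by
  set S : L2Vec := 𝓕⁻ v
  have h1 : ∫⁻ x, ‖S x‖ₑ ^ 4 = ENNReal.ofReal 4 * ∫⁻ t in Ioi (0 : ℝ),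
      volume {x | t < ‖S x‖} * ENNReal.ofReal (t ^ ((4 : ℝ) - 1)) := by
    rw [← lintegral_rpow_eq_lintegral_meas_lt_mul volume (.of_forall fun _ => norm_nonneg _)
      (Lp.aestronglyMeasurable S).norm.aemeasurable (by norm_num)]
    refine lintegral_congr fun x => ?_
    rw [← ofReal_norm, ← ENNReal.ofReal_pow (norm_nonneg _)]
    congr 1
    rw [← Real.rpow_natCast]
    norm_num
  set E : Set (ℝ × Plane) := {p | p.1 ^ 2 ≤ 8 * Real.pi * M ^ 2 * ‖p.2‖}
  have hE : MeasurableSet E := measurableSet_le (by fun_prop) (by fun_prop)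
  have h2 : ∫⁻ t in Ioi (0 : ℝ), volume {x | t < ‖S x‖} * ENNReal.ofReal (t ^ ((4 : ℝ) - 1))
      ≤ ∫⁻ t in Ioi (0 : ℝ), ∫⁻ ξ, E.indicator (fun p => ENNReal.ofReal (4 * p.1) * ‖v p.2‖ₑ ^ 2)
        (t, ξ) := by
    refine setLIntegral_mono_ae' measurableSet_Ioi (.of_forall fun t ht => ?_)
    have ht : 0 < t := ht
    refine (mul_le_mul_left (volume_superlevel_fourierInv_le hM hv hvM ht) _).trans_eq ?_
    rw [← lintegral_indicator measurableSet_ball.compl, mul_right_comm,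
      ← ENNReal.ofReal_mul (by positivity), ← lintegral_const_mul']
    · refine lintegral_congr fun ξ => ?_
      have hmem : ξ ∈ (Metric.ball (0 : Plane) (t ^ 2 / (8 * Real.pi * M ^ 2)))ᶜ ↔ (t, ξ) ∈ E := by
        simp only [E, mem_compl_iff, Metric.mem_ball, dist_zero_right, not_lt, mem_ofPred_eq]
        rw [div_le_iff₀ (by positivity), mul_comm]
      have e3 : 4 / t ^ 2 * t ^ ((4 : ℝ) - 1) = 4 * t := by
        have : t ^ ((4 : ℝ) - 1) = t ^ 3 := by
          rw [← Real.rpow_natCast]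
          norm_num
        rw [this]
        field_simp
      by_cases hξ : (t, ξ) ∈ E
      · rw [indicator_of_mem (hmem.mpr hξ), indicator_of_mem hξ, e3]
      · rw [indicator_of_notMem (fun h => hξ (hmem.mp h)), indicator_of_notMem hξ, mul_zero]
    · exact ENNReal.ofReal_ne_top
  have hmeas : Measurable fun p : ℝ × Plane => ENNReal.ofReal (4 * p.1) * ‖v p.2‖ₑ ^ 2 :=
    (by fun_prop : Measurable fun p : ℝ × Plane => ENNReal.ofReal (4 * p.1)).mul
      (((Lp.stronglyMeasurable v).measurable.comp measurable_snd).enorm.pow_const 2)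
  have h3 : ∀ ξ : Plane, ∫⁻ t in Ioi (0 : ℝ), E.indicator
      (fun p => ENNReal.ofReal (4 * p.1) * ‖v p.2‖ₑ ^ 2) (t, ξ)
      = ENNReal.ofReal (16 * Real.pi * M ^ 2) * ENNReal.ofReal (‖ξ‖ * ‖v ξ‖ ^ 2) := by
    intro ξ
    set R := Real.sqrt (8 * Real.pi * M ^ 2 * ‖ξ‖) with hR
    have hR0 : 0 ≤ R := Real.sqrt_nonneg _
    have e : ∀ t ∈ Ioi (0 : ℝ), E.indicator
        (fun p => ENNReal.ofReal (4 * p.1) * ‖v p.2‖ₑ ^ 2) (t, ξ)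
        = (Iic R).indicator (fun t => ENNReal.ofReal (4 * t)) t * ‖v ξ‖ₑ ^ 2 := by
      intro t ht
      have hm : (t, ξ) ∈ E ↔ t ∈ Iic R := by
        simp only [E, mem_ofPred_eq, mem_Iic, hR]
        exact (Real.le_sqrt' ht).symm
      by_cases h : t ∈ Iic R
      · rw [indicator_of_mem (hm.mpr h), indicator_of_mem h]
      · rw [indicator_of_notMem (fun h' => h (hm.mp h')), indicator_of_notMem h, zero_mul]
    rw [setLIntegral_congr_fun measurableSet_Ioi e, lintegral_mul_const' _ _ (by simp),
      setLIntegral_indicator measurableSet_Iic, inter_comm, Ioi_inter_Iic]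
    have e2 : ∫⁻ t in Ioc 0 R, ENNReal.ofReal (4 * t)
        = ENNReal.ofReal (16 * Real.pi * M ^ 2 * ‖ξ‖) := by
      rw [← ofReal_integral_eq_lintegral_ofReal]
      · rw [← intervalIntegral.integral_of_le hR0, intervalIntegral.integral_const_mul, integral_id,
          hR, Real.sq_sqrt (by positivity)]
        congr 1
        ring
      · exact (by fun_prop : Continuous fun t : ℝ => 4 * t).integrableOn_Ioc
      · filter_upwards [ae_restrict_mem measurableSet_Ioc] with t ht
        have := ht.1
        positivity
    rw [e2, ← ofReal_norm, ← ENNReal.ofReal_pow (norm_nonneg _), ← ENNReal.ofReal_mul (by positivity),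
      ← ENNReal.ofReal_mul (by positivity)]
    congr 1
    ring
  rw [h1]
  refine (mul_le_mul_right h2 _).trans ?_
  rw [lintegral_lintegral_swap (f := fun t ξ => E.indicator
    (fun p => ENNReal.ofReal (4 * p.1) * ‖v p.2‖ₑ ^ 2) (t, ξ)) (hmeas.indicator hE).aemeasurable]
  simp only [h3]
  rw [lintegral_const_mul' _ _ ENNReal.ofReal_ne_top, ← ofReal_integral_eq_lintegral_ofReal hv
    (.of_forall fun _ => by positivity), ← ENNReal.ofReal_mul (by positivity),
    ← ENNReal.ofReal_mul (by positivity)]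
  refine ENNReal.ofReal_le_ofReal ?_
  have := mul_le_mul_of_nonneg_left hvM (by positivity : 0 ≤ 4 * (16 * Real.pi * M ^ 2))
  calc _ = 4 * (16 * Real.pi * M ^ 2) * ∫ ξ, ‖ξ‖ * ‖v ξ‖ ^ 2 := by ring
    _ ≤ _ := this
    _ = _ := by ring

/-- The embedding `H^{1/2}(ℝ²) ⊆ L⁴(ℝ²)`. -/
theorem eLpNorm_four_le_of_halfBessel {S W : L2Vec}
    (hW : W =ᵐ[volume] fun ξ => halfBessel ξ • (𝓕 S : L2Vec) ξ) :
    eLpNorm S 4 volume ≤ 4 * ‖W‖ₑ := by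
  set v : L2Vec := 𝓕 S
  have hSv : (𝓕⁻ v : L2Vec) = S := (Lp.fourierTransformₗᵢ Plane CVec).symm_apply_apply S
  have hle : ∀ᵐ ξ, ‖ξ‖ * ‖v ξ‖ ^ 2 ≤ ‖W ξ‖ ^ 2 := by
    filter_upwards [hW] with ξ h
    rw [h, norm_smul, mul_pow]
    exact mul_le_mul_of_nonneg_right (norm_le_norm_halfBessel_sq ξ) (sq_nonneg _)
  have hv : Integrable fun ξ => ‖ξ‖ * ‖v ξ‖ ^ 2 := by
    refine ((Lp.memLp W).integrable_norm_pow (by norm_num)).mono'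
      (continuous_norm.aestronglyMeasurable.mul ((Lp.aestronglyMeasurable v).norm.pow 2)) ?_
    filter_upwards [hle] with ξ h
    rwa [Real.norm_of_nonneg (by positivity)]
  have hvM : ∫ ξ, ‖ξ‖ * ‖v ξ‖ ^ 2 ≤ ‖W‖ ^ 2 := by
    rw [norm_sq_eq_integral_norm_sq]
    exact integral_mono_ae hv ((Lp.memLp W).integrable_norm_pow (by norm_num)) hle
  -- The strict inequality keeps M positive even when W = 0; the sharp value is recovered by letting
  -- M decrease to ‖W‖. The constant 4 works because 64π ≤ 4⁴.
  have key : ∀ M : ℝ, ‖W‖ < M → eLpNorm S 4 volume ≤ ENNReal.ofReal (4 * M) := by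
    intro M hM
    have hM0 : 0 < M := (norm_nonneg W).trans_lt hM
    have h := lintegral_fourierInv_pow_four_le hM0 hv
      (hvM.trans (pow_le_pow_left₀ (norm_nonneg _) hM.le 2))
    rw [hSv] at h
    rw [eLpNorm_eq_lintegral_rpow_enorm_toReal (by norm_num) (by norm_num)]
    simp only [ENNReal.toReal_ofNat, ENNReal.rpow_ofNat]
    rw [one_div, ENNReal.rpow_inv_le_iff (by norm_num), ENNReal.rpow_ofNat,
      ← ENNReal.ofReal_pow (by positivity)]
    refine h.trans (ENNReal.ofReal_le_ofReal ?_)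
    nlinarith [Real.pi_lt_four, pow_pos hM0 4]
  have hlim : Tendsto (fun M : ℝ => ENNReal.ofReal (4 * M)) (𝓝[>] ‖W‖)
      (𝓝 (ENNReal.ofReal (4 * ‖W‖))) :=
    (ENNReal.continuous_ofReal.comp (continuous_const.mul continuous_id)).continuousWithinAt
  have h := ge_of_tendsto hlim (by
    filter_upwards [self_mem_nhdsWithin] with M hM using key M hM)
  rwa [ENNReal.ofReal_mul (by norm_num), ofReal_norm, ENNReal.ofReal_ofNat] at h

end FractionalEmbedding

/-! ### Bessel potentials and the return from the Fourier side -/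

section BesselPotential

open scoped FourierTransform SchwartzMap

/-- Tempered distributions with equal Fourier transforms are equal. On the Fourier side both are the
product with (1 + |ξ|²)^{1/4}, since s/2 = 1/4 for s = 1/2. -/
theorem besselPotential_eq_of_halfBessel {S W : L2Vec}
    (hW : W =ᵐ[volume] fun ξ => halfBessel ξ • (𝓕 S : L2Vec) ξ) :
    TemperedDistribution.besselPotential Plane CVec (1 / 2) (Lp.toTemperedDistribution S)
      = Lp.toTemperedDistribution (𝓕⁻ W : L2Vec) := by
  have hg : (fun x : Plane => (((1 + ‖x‖ ^ 2) ^ ((1 / 2 : ℝ) / 2) : ℝ) : ℂ)).HasTemperateGrowth := by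
    fun_prop
  have hinj : ∀ T₁ T₂ : 𝓢'(Plane, CVec), 𝓕 T₁ = 𝓕 T₂ → T₁ = T₂ := fun T₁ T₂ h => by
    simpa using congrArg (fun T : 𝓢'(Plane, CVec) => (𝓕⁻ T : 𝓢'(Plane, CVec))) h
  refine hinj _ _ ?_
  rw [TemperedDistribution.fourier_besselPotential_eq_smulLeftCLM_fourier_apply,
    Lp.fourier_toTemperedDistribution_eq, Lp.fourier_toTemperedDistribution_eq,
    FourierTransform.fourier_fourierInv_eq]
  ext1 c
  rw [TemperedDistribution.smulLeftCLM_apply_apply, Lp.toTemperedDistribution_apply,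
    Lp.toTemperedDistribution_apply]
  refine integral_congr_ae ?_
  filter_upwards [hW] with ξ h
  rw [h, SchwartzMap.smulLeftCLM_apply_apply hg, smul_smul, halfBessel, smul_eq_mul, mul_comm]
  norm_num

theorem isBesselPotential_of_halfBessel {u : Plane → Vec} {S W : L2Vec}
    (hS : S =ᵐ[volume] fun x => complexify (u x))
    (hW : W =ᵐ[volume] fun ξ => halfBessel ξ • (𝓕 S : L2Vec) ξ) :
    IsBesselPotential (1 / 2) u (𝓕⁻ W) := by
  have hv : MemLp (fun x => complexify (u x)) 2 volume := (Lp.memLp S).ae_eq hS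
  refine ⟨hv, ?_⟩
  have e : hv.toLp _ = S := Lp.ext (hv.coeFn_toLp.trans hS.symm)
  rw [e]
  exact besselPotential_eq_of_halfBessel hW

/-- The transform acts on vector-valued functions coordinatewise, so it commutes with α. This brings
the boundary condition on the vertical component back to physical space. -/
theorem fourierInv_apply_eq_zero {T : L2Vec} (α : CVec →L[ℂ] ℂ) (h : ∀ᵐ ξ, α (T ξ) = 0) :
    ∀ᵐ x, α ((𝓕⁻ T : L2Vec) x) = 0 := by
  have hmem : MemLp (fun x => α ((𝓕⁻ T : L2Vec) x)) 2 volume := α.comp_memLp' (Lp.memLp _)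
  refine ae_eq_zero_of_integral_contDiff_smul_eq_zero (hmem.locallyIntegrable (by norm_num))
    fun b hb hbc => ?_
  have hg₁ : HasCompactSupport (Complex.ofRealCLM ∘ b) := hbc.comp_left rfl
  have hg₂ : ContDiff ℝ ∞ (Complex.ofRealCLM ∘ b) := Complex.ofRealCLM.contDiff.comp hb
  set c : 𝓢(Plane, ℂ) := hg₁.toSchwartzMap hg₂
  have hcb : ∀ x, c x = (b x : ℂ) := fun x => rfl
  have h1 := integral_fourier_smul_clm α (𝓕⁻ T) (𝓕⁻ c)
  rw [FourierTransform.fourier_fourierInv_eq, FourierTransform.fourier_fourierInv_eq] at h1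
  simp only [hcb, Complex.coe_smul] at h1
  rw [h1]
  refine integral_eq_zero_of_ae ?_
  filter_upwards [h] with ξ hξ
  rw [hξ, smul_zero, Pi.zero_apply]

end BesselPotential

/-! ### Return to real vector fields -/

section RealPart

/-- The coordinatewise real part. -/
noncomputable def vecRealPart : CVec →L[ℝ] Vec :=
  LinearMap.mkContinuous
    { toFun := fun v => WithLp.toLp 2 fun i => (v i).re
      map_add' := fun v w => by ext i; simp
      map_smul' := fun c v => by ext i; simp } 1 fun v => by
    rw [one_mul, EuclideanSpace.norm_eq, EuclideanSpace.norm_eq]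
    refine Real.sqrt_le_sqrt (Finset.sum_le_sum fun i _ => ?_)
    exact pow_le_pow_left₀ (norm_nonneg _) (Complex.abs_re_le_norm (v i)) 2

theorem vecRealPart_apply (v : CVec) (i : Fin 3) : vecRealPart v i = (v i).re := rfl

theorem vecRealPart_complexify (v : Vec) : vecRealPart (complexify v) = v := by
  ext i
  rfl

theorem norm_vecRealPart_le (v : CVec) : ‖vecRealPart v‖ ≤ ‖v‖ := by
  have := vecRealPart.le_of_opNorm_le (LinearMap.mkContinuous_norm_le _ zero_le_one _) v
  rwa [one_mul] at this

end RealPart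

/-! ### Interpolation between L² and L⁴ -/

section Interpolation

variable {X E : Type*} [MeasurableSpace X] {μ : Measure X} [NormedAddCommGroup E] {u : X → E}

/-- Hölder with exponents 1/2 and 1/2, from |u|³ = (|u|²)^{1/2} (|u|⁴)^{1/2}. -/
theorem lintegral_enorm_pow_three_le (hu : AEStronglyMeasurable u μ) :
    ∫⁻ x, ‖u x‖ₑ ^ 3 ∂μ ≤ eLpNorm u 2 μ * eLpNorm u 4 μ ^ 2 := by
  have h := ENNReal.lintegral_mul_norm_pow_le (μ := μ) (f := fun x => ‖u x‖ₑ ^ 2)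
    (g := fun x => ‖u x‖ₑ ^ 4) (hu.enorm.pow_const 2) (hu.enorm.pow_const 4)
    (p := 1 / 2) (q := 1 / 2) (by norm_num) (by norm_num) (by norm_num)
  rw [eLpNorm_eq_lintegral_rpow_enorm_toReal (by norm_num) (by norm_num),
    eLpNorm_eq_lintegral_rpow_enorm_toReal (by norm_num) (by norm_num)]
  simp only [ENNReal.toReal_ofNat, ENNReal.rpow_ofNat]
  rw [← ENNReal.rpow_natCast ((∫⁻ x, ‖u x‖ₑ ^ 4 ∂μ) ^ (1 / 4 : ℝ)), ← ENNReal.rpow_mul]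
  convert h using 2
  · ext x
    rw [← ENNReal.rpow_natCast, ← ENNReal.rpow_natCast, ← ENNReal.rpow_natCast,
      ← ENNReal.rpow_mul, ← ENNReal.rpow_mul, ← ENNReal.rpow_add_of_nonneg _ _ (by norm_num)
      (by norm_num)]
    norm_num
  · norm_num

/-- Hölder with exponents 2/3 and 1/3, from |u|^{8/3} = (|u|²)^{2/3} (|u|⁴)^{1/3}, then raised to
the power 3/2. -/
theorem eLpNorm_eight_thirds_pow_four_le (hu : AEStronglyMeasurable u μ) :
    eLpNorm u (8 / 3) μ ^ 4 ≤ eLpNorm u 2 μ ^ 2 * eLpNorm u 4 μ ^ 2 := by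
  have h := ENNReal.lintegral_mul_norm_pow_le (μ := μ) (f := fun x => ‖u x‖ₑ ^ 2)
    (g := fun x => ‖u x‖ₑ ^ 4) (hu.enorm.pow_const 2) (hu.enorm.pow_const 4)
    (p := 2 / 3) (q := 1 / 3) (by norm_num) (by norm_num) (by norm_num)
  have hr : ((8 / 3 : ℝ≥0∞)).toReal = 8 / 3 := by
    rw [ENNReal.toReal_div]
    norm_num
  rw [eLpNorm_eq_lintegral_rpow_enorm_toReal (p := 2) (by norm_num) (by norm_num),
    eLpNorm_eq_lintegral_rpow_enorm_toReal (p := 4) (by norm_num) (by norm_num),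
    eLpNorm_eq_lintegral_rpow_enorm_toReal (p := 8 / 3) (by simp) (ENNReal.div_ne_top (by simp)
      (by simp)), hr]
  simp only [ENNReal.toReal_ofNat, ENNReal.rpow_ofNat]
  have e : ∀ x, (‖u x‖ₑ ^ 2) ^ (2 / 3 : ℝ) * (‖u x‖ₑ ^ 4) ^ (1 / 3 : ℝ) = ‖u x‖ₑ ^ (8 / 3 : ℝ) := by
    intro x
    rw [← ENNReal.rpow_natCast, ← ENNReal.rpow_natCast,
      ← ENNReal.rpow_mul, ← ENNReal.rpow_mul, ← ENNReal.rpow_add_of_nonneg _ _ (by norm_num)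
      (by norm_num)]
    norm_num
  simp only [e] at h
  have h' := ENNReal.rpow_le_rpow h (by norm_num : (0 : ℝ) ≤ 3 / 2)
  rw [ENNReal.mul_rpow_of_nonneg _ _ (by norm_num), ← ENNReal.rpow_mul, ← ENNReal.rpow_mul] at h'
  simp only [← ENNReal.rpow_natCast ((_ : ℝ≥0∞) ^ (_ : ℝ)), ← ENNReal.rpow_mul]
  norm_num at h' ⊢
  exact h'

end Interpolation

/-! ### The regularity theorem -/

section Main

theorem lintegral_halfVol_enorm_pow_three_le {u : ℝ × Plane → Vec} (hu : AEStronglyMeasurable u halfVol)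
    {m K : ℝ≥0∞} (hm : m ≠ ⊤)
    (h2 : ∀ᵐ z ∂(volume.restrict (Ioi (0 : ℝ))), eLpNorm (fun x => u (z, x)) 2 volume ≤ m)
    (h4 : ∫⁻ z in Ioi (0 : ℝ), eLpNorm (fun x => u (z, x)) 4 volume ^ 2 ≤ K) :
    ∫⁻ p, ‖u p‖ₑ ^ 3 ∂halfVol ≤ m * K := by
  rw [halfVol_eq_prod] at hu ⊢
  rw [lintegral_prod _ (hu.enorm.pow_const 3)]
  refine le_trans ?_ (mul_le_mul_right h4 m)
  rw [← lintegral_const_mul' _ _ hm]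
  refine lintegral_mono_ae ?_
  filter_upwards [h2, hu.prodMk_left] with z hz hmz
  exact (lintegral_enorm_pow_three_le hmz).trans (mul_le_mul_left hz _)

theorem mixedNorm_pow_four_le {u : ℝ × Plane → Vec} (hu : AEStronglyMeasurable u halfVol)
    {m K : ℝ≥0∞} (hm : m ≠ ⊤)
    (h2 : ∀ᵐ z ∂(volume.restrict (Ioi (0 : ℝ))), eLpNorm (fun x => u (z, x)) 2 volume ≤ m)
    (h4 : ∫⁻ z in Ioi (0 : ℝ), eLpNorm (fun x => u (z, x)) 4 volume ^ 2 ≤ K) :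
    mixedNorm 4 (8 / 3) u ^ 4 ≤ m ^ 2 * K := by
  rw [halfVol_eq_prod] at hu
  rw [mixedNorm, eLpNorm_eq_lintegral_rpow_enorm_toReal (by norm_num) (by norm_num)]
  simp only [ENNReal.toReal_ofNat, ENNReal.rpow_ofNat, enorm_eq_self]
  rw [← ENNReal.rpow_natCast, ← ENNReal.rpow_mul]
  norm_num
  refine le_trans ?_ (mul_le_mul_right h4 _)
  rw [← lintegral_const_mul' _ _ (ENNReal.pow_ne_top hm)]
  refine lintegral_mono_ae ?_
  filter_upwards [h2, hu.prodMk_left] with z hz hmz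
  exact (eLpNorm_eight_thirds_pow_four_le hmz).trans
    (mul_le_mul_left (ENNReal.pow_le_pow_left hz) _)

/-- The frequency-side bounds return to physical space by Plancherel. The constant 8 is 2 + 3 + 3,
from the H^{1/2} norm, the trace and the supremum; the constant 11 is 6 + 5, from the two
interpolated norms. -/
theorem regularity_estimate {Lam : ℝ} (hLam : 1 ≤ Lam) {lam : ℝ → ℝ}
    (hlm : AEMeasurable lam (volume.restrict (Ioi 0)))
    (hlam : ∀ᵐ z ∂(volume.restrict (Ioi (0 : ℝ))), 1 / Lam ≤ lam z ∧ lam z ≤ Lam)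
    {Ψ : ℝ × Plane → ℝ} {D : ℝ × Plane → Vec} {f : ℝ × Plane → ℝ} {g : Plane → ℝ}
    (h : IsWeakGradient Ψ D) (hu : MemLp (lambdaGrad lam D) 2 halfVol) (hf : MemLp f 2 halfVol)
    (htr : IsNormalTrace (lambdaGrad lam D) f g) (hg : MemLp g 2 volume) :
    (∃ (W : ℝ → Lp CVec 2 (volume : Measure Plane))
        (V : ℝ → Lp Vec 2 (volume : Measure Plane)),
      IsL2SobolevLift (1 / 2) (lambdaGrad lam D) W ∧
      IsContinuousRep (lambdaGrad lam D) V ∧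
      (∀ᵐ x, V 0 x 0 = -g x) ∧
      eLpNorm W 2 (volume.restrict (Ioi 0)) + ‖V 0‖ₑ + (⨆ z ∈ Ici (0 : ℝ), ‖V z‖ₑ)
        ≤ ENNReal.ofReal (8 * Lam) * (eLpNorm g 2 volume + eLpNorm f 2 halfVol
            + eLpNorm (lambdaGrad lam D) 2 halfVol)) ∧
    eLpNorm (lambdaGrad lam D) 3 halfVol + mixedNorm 4 (8 / 3) (lambdaGrad lam D)
      ≤ ENNReal.ofReal (11 * Lam) * (eLpNorm g 2 volume + eLpNorm f 2 halfVol
          + eLpNorm (lambdaGrad lam D) 2 halfVol) := by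
  have hLam0 : 0 < Lam := by linarith
  obtain ⟨S, U, F, SG, G, hsys, hUS, hGS, hSu, hSG, hN⟩ :=
    h.exists_frequencySystem hLam0 hlm hlam hu hf htr hg
  obtain ⟨V, hVc, hVU, hVG, hVb⟩ := hsys.exists_continuous_rep hLam hlm hlam
  obtain ⟨W, hWm, hWU, hWb⟩ := hsys.exists_halfBessel hLam hlm hlam
  rw [← hN]
  set N := dataNorm U F G
  have hN0 : 0 ≤ N := by simp only [N, dataNorm]; positivity
  set J := (Lp.fourierTransformₗᵢ Plane CVec).symm
  have hJU : ∀ z, J (U z) = S z := fun z => by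
    rw [hUS]
    exact (Lp.fourierTransformₗᵢ Plane CVec).symm_apply_apply (S z)
  have hJG : J G = SG := by
    rw [hGS]
    exact (Lp.fourierTransformₗᵢ Plane CVec).symm_apply_apply SG
  -- The inverse transform of V z is known to be the complexification of a real field only for
  -- almost every z. A continuous real-part map gives a real-valued representative for all z.
  set R : L2Vec →L[ℝ] Lp Vec 2 (volume : Measure Plane) := vecRealPart.compLpL 2 volume
  have hR : ∀ v : L2Vec, R v =ᵐ[volume] fun x => vecRealPart (v x) :=
    fun v => vecRealPart.coeFn_compLpL v
  have hRn : ∀ v : L2Vec, ‖R v‖ ≤ ‖v‖ := fun v => by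
    refine Lp.norm_le_norm_of_ae_le ?_
    filter_upwards [hR v] with x hx
    rw [hx]
    exact norm_vecRealPart_le _
  have hWS : ∀ᵐ z ∂(volume.restrict (Ioi (0 : ℝ))), W z =ᵐ[volume] fun ξ =>
      halfBessel ξ • (FourierTransform.fourier (S z) : L2Vec) ξ := by
    filter_upwards [hWU] with z hz
    rwa [← hUS]
  have hVn : ∀ z ∈ Ici (0 : ℝ), ‖R (J (V z))‖ₑ ≤ ENNReal.ofReal (3 * Lam * N) := fun z hz => by
    rw [← ofReal_norm]
    exact ENNReal.ofReal_le_ofReal ((hRn _).trans ((J.norm_map _).trans_le (hVb z hz)))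
  have hJW : eLpNorm (fun z => J (W z)) 2 (volume.restrict (Ioi 0))
      = eLpNorm W 2 (volume.restrict (Ioi 0)) :=
    eLpNorm_congr_norm_ae (.of_forall fun z => J.norm_map _)
  have hslice : ∀ {q : ℝ≥0∞}, ∀ᵐ z ∂(volume.restrict (Ioi (0 : ℝ))),
      eLpNorm (fun x => lambdaGrad lam D (z, x)) q volume = eLpNorm (S z) q volume := by
    intro q
    filter_upwards [hSu] with z hz
    refine eLpNorm_congr_norm_ae ?_
    filter_upwards [hz] with x hx
    rw [hx, norm_complexify]
  have h2 : ∀ᵐ z ∂(volume.restrict (Ioi (0 : ℝ))),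
      eLpNorm (fun x => lambdaGrad lam D (z, x)) 2 volume ≤ ENNReal.ofReal (3 * Lam * N) := by
    filter_upwards [hslice, hVU, ae_restrict_mem measurableSet_Ioi] with z h1 h3 hz
    rw [h1, ← Lp.enorm_def, ← hJU, ← h3, ← ofReal_norm, J.norm_map]
    exact ENNReal.ofReal_le_ofReal (hVb z (le_of_lt hz))
  have h4 : ∫⁻ z in Ioi (0 : ℝ), eLpNorm (fun x => lambdaGrad lam D (z, x)) 4 volume ^ 2
      ≤ ENNReal.ofReal (64 * Lam ^ 2 * N ^ 2) := by
    calc _ ≤ ∫⁻ z in Ioi (0 : ℝ), 16 * ‖W z‖ₑ ^ 2 := by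
          refine lintegral_mono_ae ?_
          filter_upwards [hslice (q := 4), hWS] with z h1 h3
          rw [h1]
          refine (ENNReal.pow_le_pow_left (eLpNorm_four_le_of_halfBessel h3)).trans_eq ?_
          rw [mul_pow]
          norm_num
      _ = 16 * eLpNorm W 2 (volume.restrict (Ioi 0)) ^ 2 := by
          rw [lintegral_const_mul' _ _ (by norm_num), eLpNorm_two_sq_eq_lintegral]
      _ ≤ 16 * ENNReal.ofReal (2 * Lam * N) ^ 2 := by gcongr
      _ = _ := by
          rw [← ENNReal.ofReal_pow (by positivity),
            show (16 : ℝ≥0∞) = ENNReal.ofReal 16 by norm_num, ← ENNReal.ofReal_mul (by norm_num)]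
          congr 1
          ring
  -- 3 · 64 = 192 ≤ 6³.
  have h3 : eLpNorm (lambdaGrad lam D) 3 halfVol ≤ ENNReal.ofReal (6 * Lam * N) := by
    rw [eLpNorm_eq_lintegral_rpow_enorm_toReal (by norm_num) (by norm_num)]
    simp only [ENNReal.toReal_ofNat, ENNReal.rpow_ofNat]
    rw [one_div, ENNReal.rpow_inv_le_iff (by norm_num), ENNReal.rpow_ofNat,
      ← ENNReal.ofReal_pow (by positivity)]
    refine (lintegral_halfVol_enorm_pow_three_le hu.1 ENNReal.ofReal_ne_top h2 h4).trans ?_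
    rw [← ENNReal.ofReal_mul (by positivity)]
    refine ENNReal.ofReal_le_ofReal ?_
    have : 0 ≤ (Lam * N) ^ 3 := by positivity
    nlinarith
  -- 3² · 64 = 576 ≤ 5⁴.
  have h83 : mixedNorm 4 (8 / 3) (lambdaGrad lam D) ≤ ENNReal.ofReal (5 * Lam * N) := by
    refine (ENNReal.pow_le_pow_left_iff (n := 4) (by norm_num)).mp ?_
    refine (mixedNorm_pow_four_le hu.1 ENNReal.ofReal_ne_top h2 h4).trans ?_
    rw [← ENNReal.ofReal_pow (by positivity), ← ENNReal.ofReal_pow (by positivity),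
      ← ENNReal.ofReal_mul (by positivity)]
    refine ENNReal.ofReal_le_ofReal ?_
    have : 0 ≤ (Lam * N) ^ 4 := by positivity
    nlinarith
  refine ⟨⟨fun z => J (W z), fun z => R (J (V z)), ⟨hWm.congr_norm
    (J.continuous.comp_aestronglyMeasurable hWm.1) (.of_forall fun z => (J.norm_map _).symm), ?_⟩,
    ⟨R.continuous.comp_continuousOn (J.continuous.comp_continuousOn hVc), ?_⟩, ?_, ?_⟩, ?_⟩
  · filter_upwards [hSu, hWS] with z h1 h2
    exact isBesselPotential_of_halfBessel h1 h2
  · filter_upwards [hSu, hVU] with z h1 h2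
    rw [h2, hJU]
    filter_upwards [h1, hR (S z)] with x hx1 hx2
    rw [hx2, hx1, vecRealPart_complexify]
  · have h0 := fourierInv_apply_eq_zero (T := V 0 + G) (EuclideanSpace.proj 0) (by
      filter_upwards [hVG, Lp.coeFn_add (V 0) G] with ξ h1 h2
      change (V 0 + G : L2Vec) ξ 0 = 0
      rw [h2, Pi.add_apply, PiLp.add_apply, h1, neg_add_cancel])
    have e : (FourierTransformInv.fourierInv (V 0 + G) : L2Vec) = J (V 0) + SG := by
      rw [← hJG]
      exact J.map_add _ _
    rw [e] at h0
    filter_upwards [h0, hSG, Lp.coeFn_add (J (V 0)) SG, hR (J (V 0))] with x h1 h2 h3 h4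
    rw [h4, vecRealPart_apply]
    rw [h3, Pi.add_apply, h2] at h1
    have h5 : (J (V 0) : L2Vec) x 0 = -(g x : ℂ) := by
      simpa [vertVec, add_eq_zero_iff_eq_neg] using h1
    rw [h5]
    simp
  · rw [hJW]
    refine (add_le_add (add_le_add hWb (hVn 0 self_mem_Ici)) (iSup₂_le hVn)).trans_eq ?_
    rw [← ENNReal.ofReal_add (by positivity) (by positivity),
      ← ENNReal.ofReal_add (by positivity) (by positivity), ← ENNReal.ofReal_mul (by positivity)]
    congr 1
    ring
  · refine (add_le_add h3 h83).trans_eq ?_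
    rw [← ENNReal.ofReal_add (by positivity) (by positivity), ← ENNReal.ofReal_mul (by positivity)]
    congr 1
    ring

end Main

theorem mainTheorem4 (Lam : ℝ) (hLam : 0 < Lam) :
    ∃ C : ℝ≥0, ∀ lam : ℝ → ℝ,
      AEMeasurable lam (volume.restrict (Ioi 0)) →
      (∀ᵐ z ∂(volume.restrict (Ioi (0 : ℝ))), 1 / Lam ≤ lam z ∧ lam z ≤ Lam) →
      ∀ (Ψ : ℝ × Plane → ℝ) (D : ℝ × Plane → Vec) (f : ℝ × Plane → ℝ) (g : Plane → ℝ),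
        IsWeakGradient Ψ D →
        MemLp (lambdaGrad lam D) 2 halfVol →
        IsWeakDiv (lambdaGrad lam D) f → MemLp f 2 halfVol →
        IsNormalTrace (lambdaGrad lam D) f g → MemLp g 2 volume →
        (∃ (W : ℝ → Lp CVec 2 (volume : Measure Plane))
            (V : ℝ → Lp Vec 2 (volume : Measure Plane)),
          IsL2SobolevLift (1 / 2) (lambdaGrad lam D) W ∧
          IsContinuousRep (lambdaGrad lam D) V ∧
          (∀ᵐ x, V 0 x 0 = -g x) ∧
          eLpNorm W 2 (volume.restrict (Ioi 0)) + ‖V 0‖ₑ + (⨆ z ∈ Ici (0 : ℝ), ‖V z‖ₑ)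
            ≤ C * (eLpNorm g 2 volume + eLpNorm f 2 halfVol
                + eLpNorm (lambdaGrad lam D) 2 halfVol)) ∧
        MemLp (lambdaGrad lam D) 3 halfVol ∧
        mixedNorm 4 (8 / 3) (lambdaGrad lam D) < ⊤ ∧
        eLpNorm (lambdaGrad lam D) 3 halfVol + mixedNorm 4 (8 / 3) (lambdaGrad lam D)
          ≤ C * (eLpNorm g 2 volume + eLpNorm f 2 halfVol
              + eLpNorm (lambdaGrad lam D) 2 halfVol) := by
  refine ⟨(11 * Lam).toNNReal, fun lam hlm hlam Ψ D f g h hu _ hf htr hg => ?_⟩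
  -- The half-line has positive measure, so the bounds on λ hold at some point, and there 1/Lam ≤
  -- Lam.
  have h1 : 1 ≤ Lam := by
    have : NeZero (volume.restrict (Ioi (0 : ℝ))) := ⟨by simp [Measure.restrict_eq_zero]⟩
    obtain ⟨z, hz⟩ := hlam.exists
    have := (div_le_iff₀ hLam).mp (hz.1.trans hz.2)
    nlinarith
  obtain ⟨⟨W, V, hW, hV, hVg, hb⟩, hb2⟩ := regularity_estimate h1 hlm hlam h hu hf htr hg
  have hlt := hb2.trans_lt (ENNReal.mul_lt_top ENNReal.ofReal_lt_top
    (ENNReal.add_lt_top.mpr ⟨ENNReal.add_lt_top.mpr ⟨hg.2, hf.2⟩, hu.2⟩))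
  rw [ENNReal.add_lt_top] at hlt
  refine ⟨⟨W, V, hW, hV, hVg, hb.trans (mul_le_mul_left ?_ _)⟩, ⟨hu.1, hlt.1⟩, hlt.2, hb2⟩
  exact ENNReal.ofReal_le_ofReal (by linarith)
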